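/- Let two isotropic elastic materials with shear moduli $\mu_\pm>0$ and Poisson ratios $\nu_\pm\in(-1,1/2)$ occupy (in plane strain) the half-planes $\pm x_2>0$. Put $$b=\frac{1-\nu_+}{\mu_+}+\frac{1-\nu_-}{\mu_-},\quad d_*=\frac{\mu_-(1-2\nu_+)-\mu_+(1-2\nu_-)}{2\mu_-(1-\nu_+)+2\mu_+(1-\nu_-)},\quad \epsilon=\frac1{2\pi}\log\frac{\mu_++(3-4\nu_+)\mu_-}{\mu_-+(3-4\nu_-)\mu_+},$$ $$d_0=(1-d_*^2)^{1/4},\qquad e_0=e^{\pi\epsilon/2},\qquad c_1^\pm=\frac{(1+i)\sqrt\pi}{2\Gamma(1/2\pm i\epsilon)},\qquad \mathcal B=\begin{pmatrix}1&-i\\ i&1\end{pmatrix}.$$ A *singular solution* is a complex displacement field $U=[U_1,U_2]^\top$, defined off the line $x_2=0$, of class $C^2$ and satisfying the equations of equilibrium without body forces in each open half-plane, such that: $U$ has one-sided limits on $x_2=0^\pm$, $x_1\ne0$, and is continuous across $x_2=0$, $x_1<0$; the traction $[\sigma_{21},\sigma_{22}]^\top$ has one-sided limits on $x_2=0^\pm$,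 $x_1\neq 0$, which coincide for $x_1<0$ and vanish for $x_1>0$ (traction-free crack faces); and $U$ is the sum of two fields that are homogeneous of degrees $-1/2+i\epsilon$ and $-1/2-i\epsilon$. Let $[\![U]\!](x_1)=U(x_1,0^+)-U(x_1,0^-)$, let $\Sigma(x_1)=[\Sigma_{21},\Sigma_{22}]^\top$ be the traction on $x_2=0$, and $$[\![\overline U]\!]^+(\beta)=\int_0^\infty[\![U]\!](x_1)e^{i\beta x_1}dx_1\ (\operatorname{Im}\beta>0),\qquad \overline\Sigma^-(\beta)=\int_{-\infty}^0\Sigma(x_1)e^{i\beta x_1}dx_1\ (\operatorname{Im}\beta<0),$$ the second integral being a Hadamard finite part at $x_1=0$. Let $\mathbb C^\pm=\{\beta\in\mathbb C:\pm\operatorname{Im}\beta>0\}$ and let $\beta_\pm^{z}$ be the power function on $\mathbb C^\pm$ with $\arg\beta\in(0,\pi)$, respectively $\arg\beta\in(-\pi,0)$, extended continuously to $\mathbb R\setminus\{0\}$. For $B^\pm(\beta)=-\epsilon\log(\mp i\beta)$ (principal logarithm) and $\beta\in\mathbb C^\pm\cup(\mathbb R\setminus\{0\})$ let $$X^\pm(\beta)=d_0^{\pm1}\begin{pmatrix}\cos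 B^\pm&-\sin B^\pm\\ \sin B^\pm&\cos B^\pm\end{pmatrix},\qquad G(\beta)=\begin{pmatrix}1&-i\,\mathrm{sign}(\beta)d_*\\ i\,\mathrm{sign}(\beta)d_*&1\end{pmatrix}\ (\beta\in\mathbb R\setminus\{0\}).$$ 1. $X^\pm$ is analytic in $\mathbb C^\pm$, continuous on $\overline{\mathbb C^\pm}\setminus\{0\}$ and invertible there, and for all real $\beta\neq0$ $$-\frac b{|\beta|}G(\beta)=-\frac b{\beta_+^{1/2}\beta_-^{1/2}}X^+(\beta)[X^-(\beta)]^{-1}.$$ 2. Consider the Wiener–Hopf problem for pairs $(\Phi^+,\Phi^-)$ of $\mathbb C^2$-valued functions, where $\Phi^\pm$ is analytic in $\mathbb C^\pm$ and continuous on $\overline{\mathbb C^\pm}\setminus\{0\}$, $\Phi^+=O(|\beta|^{-1/2})$ and $\Phi^-=O(|\beta|^{1/2})$ in $\mathbb C^\pm$ both as $\beta\to\infty$ and as $\beta\to0$, and $$\Phi^+(\beta)=-\frac b{|\beta|}G(\beta)\Phi^-(\beta),\qquad\beta\in\mathbb R\setminus\{0\}.$$ Its solutions are exactly $$\Phi^+(\beta)=\frac1{\beta_+^{1/2}}X^+(\beta)e,\qquad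 \Phi^-(\beta)=-\frac{\beta_-^{1/2}}bX^-(\beta)e,\qquad e=[e_1,e_2]^\top\in\mathbb C^2,$$ and $e$ is uniquely determined by the solution. 3. For every singular solution, $[\![\overline U]\!]^+$ and $\overline\Sigma^-$ (extended to the real axis without the origin) solve this problem, and each solution of the problem arises from exactly one singular solution. 4. The singular solutions form a complex vector space of dimension $2$. It has a basis $U^1,U^2$ for which $e_1U^1+e_2U^2$ has the transforms given in 2 with $e=[e_1,e_2]^\top$, for all $e\in\mathbb C^2$. In particular (with the $j$-th column belonging to $U^j$) the transforms are $$[\![\overline{\boldsymbol U}]\!]^+=\begin{pmatrix}p&-q\\q&p\end{pmatrix},\quad p=\tfrac{d_0}2\beta_+^{-1/2}\big(e_0\beta_+^{i\epsilon}+e_0^{-1}\beta_+^{-i\epsilon}\big),\quad q=\tfrac{id_0}2\beta_+^{-1/2}\big(e_0\beta_+^{i\epsilon}-e_0^{-1}\beta_+^{-i\epsilon}\big),$$ $$\overline{\boldsymbol\Sigma}^-=\begin{pmatrix}s&-t\\t&s\end{pmatrix},\quad s=-\tfrac1{2bd_0}\beta_-^{1/2}\big(e_0^{-1}\beta_-^{i\epsilon}+e_0\beta_-^{-i\epsilon}\big),\quad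 t=-\tfrac i{2bd_0}\beta_-^{1/2}\big(e_0^{-1}\beta_-^{i\epsilon}-e_0\beta_-^{-i\epsilon}\big).$$ The symmetric weight function matrix $[\![\boldsymbol U]\!](x_1)$ vanishes for $x_1<0$, and $$[\![\boldsymbol U]\!](x_1)=\frac1{2d_0\sqrt{2\pi x_1}}\left\{\frac{x_1^{-i\epsilon}}{c_1^+}\mathcal B+\frac{x_1^{i\epsilon}}{c_1^-}\mathcal B^\top\right\},\qquad x_1>0.$$ The traction matrix (rows $\Sigma_{21},\Sigma_{22}$) vanishes for $x_1>0$, and $$\boldsymbol\Sigma(x_1)=\frac{(-x_1)^{-3/2}}{2bd_0^3\sqrt{2\pi}}\left\{\frac{1/2+i\epsilon}{c_1^+}(-x_1)^{-i\epsilon}\mathcal B+\frac{1/2-i\epsilon}{c_1^-}(-x_1)^{i\epsilon}\mathcal B^\top\right\},\qquad x_1<0.$$ -/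

import Mathlib

open Filter Topology MeasureTheory
open scoped Matrix

noncomputable section

namespace InterfaceCrack

/-! ### Materials and bimaterial constants -/

/-- An isotropic elastic material: shear modulus and Poisson ratio. -/
structure Material where
  mu : ℝ
  nu : ℝ
  mu_pos : 0 < mu
  nu_gt : -1 < nu
  nu_lt : nu < 1 / 2

/-- The two materials; `plus` occupies `x₂ > 0` and `minus` occupies `x₂ < 0`. -/
structure Bimaterial where
  plus : Material
  minus : Material

namespace Bimaterial

variable (m : Bimaterial)

/-- `b = (1 - ν₊)/μ₊ + (1 - ν₋)/μ₋`. -/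
def b : ℝ := (1 - m.plus.nu) / m.plus.mu + (1 - m.minus.nu) / m.minus.mu

/-- The Dundurs parameter `d_*`. -/
def dStar : ℝ :=
  (m.minus.mu * (1 - 2 * m.plus.nu) - m.plus.mu * (1 - 2 * m.minus.nu)) /
    (2 * m.minus.mu * (1 - m.plus.nu) + 2 * m.plus.mu * (1 - m.minus.nu))

/-- The oscillation index `ε`. -/
def eps : ℝ :=
  1 / (2 * Real.pi) *
    Real.log ((m.plus.mu + (3 - 4 * m.plus.nu) * m.minus.mu) /
      (m.minus.mu + (3 - 4 * m.minus.nu) * m.plus.mu))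

/-- `d₀ = (1 - d_*²)^{1/4}`. -/
def d0 : ℝ := (1 - m.dStar ^ 2) ^ (1 / 4 : ℝ)

/-- `e₀ = exp(π ε / 2)`. -/
def e0 : ℝ := Real.exp (m.eps * Real.pi / 2)

/-- `c₁⁺ = (1 + i) √π / (2 Γ(1/2 + iε))`. -/
def c1Plus : ℂ :=
  (1 + Complex.I) * (Real.sqrt Real.pi : ℂ) /
    (2 * Complex.Gamma (1 / 2 + Complex.I * (m.eps : ℂ)))

/-- `c₁⁻ = (1 + i) √π / (2 Γ(1/2 - iε))`. -/
def c1Minus : ℂ :=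
  (1 + Complex.I) * (Real.sqrt Real.pi : ℂ) /
    (2 * Complex.Gamma (1 / 2 - Complex.I * (m.eps : ℂ)))

end Bimaterial

/-! ### The elasticity problem for the singular solutions

Points of the plane are pairs `(x₁, x₂)`. The index `0 : Fin 2` stands for the first and
`1 : Fin 2` for the second coordinate direction. -/

/-- Complex valued plane displacement fields. -/
abbrev Disp : Type := ℝ × ℝ → Fin 2 → ℂ

/-- The open upper half of the plane (material `+`). -/
def upperBody : Set (ℝ × ℝ) := {p | 0 < p.2}

/-- The open lower half of the plane (material `-`). -/
def lowerBody : Set (ℝ × ℝ) := {p | p.2 < 0}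

/-- Partial derivative in the `k`-th coordinate direction. -/
def pd (k : Fin 2) (f : ℝ × ℝ → ℂ) (p : ℝ × ℝ) : ℂ :=
  fderiv ℝ f p ((![(1, 0), (0, 1)] : Fin 2 → ℝ × ℝ) k)

/-- Plane strain stress (Hooke's law): `σᵢⱼ = λ δᵢⱼ div U + μ (∂ᵢ Uⱼ + ∂ⱼ Uᵢ)` with the Lame
modulus `λ = 2 μ ν / (1 - 2 ν)`. -/
def stress (M : Material) (U : Disp) (i j : Fin 2) (p : ℝ × ℝ) : ℂ :=
  (if i = j then ((2 * M.mu * M.nu / (1 - 2 * M.nu) : ℝ) : ℂ) else 0) *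
      (∑ k, pd k (fun q => U q k) p) +
    (M.mu : ℂ) * (pd i (fun q => U q j) p + pd j (fun q => U q i) p)

/-- The traction vector `[σ₂₁, σ₂₂]` on lines parallel to the interface. -/
def traction (M : Material) (U : Disp) (p : ℝ × ℝ) : Fin 2 → ℂ := fun i => stress M U 1 i p

/-- Classical equilibrium without body forces, `div σ = 0`, in the open set `S`. -/
def IsEquilibrium (M : Material) (S : Set (ℝ × ℝ)) (U : Disp) : Prop :=
  ContDiffOn ℝ 2 U S ∧ ∀ p ∈ S, ∀ i, ∑ j, pd j (stress M U i j) p = 0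

/-- The filter of points tending to `(x₁, 0)` from the upper half-plane. -/
def fromAbove (x : ℝ) : Filter (ℝ × ℝ) := 𝓝[upperBody] (x, 0)

/-- The filter of points tending to `(x₁, 0)` from the lower half-plane. -/
def fromBelow (x : ℝ) : Filter (ℝ × ℝ) := 𝓝[lowerBody] (x, 0)

/-- `A` is (positively) homogeneous of complex degree `z` in each open half-plane. -/
def IsHomogeneous (z : ℂ) (A : Disp) : Prop :=
  ∀ t : ℝ, 0 < t → ∀ p : ℝ × ℝ, p.2 ≠ 0 → A (t • p) = (t : ℂ) ^ z • A p

/-- The singular solutions of the homogeneous problem with the crack along `x₁ > 0`. A field is a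
pair of fields in the two open half-planes; its (immaterial) values on the line `x₂ = 0` are set
to zero by `offLine`, and only one-sided limits on that line are used. -/
structure IsSingularSolution (m : Bimaterial) (U : Disp) : Prop where
  offLine : ∀ p : ℝ × ℝ, p.2 = 0 → U p = 0
  equilibriumPlus : IsEquilibrium m.plus upperBody U
  equilibriumMinus : IsEquilibrium m.minus lowerBody U
  traces : ∀ x : ℝ, 0 < x →
    (∃ a, Tendsto U (fromAbove x) (𝓝 a)) ∧ ∃ a, Tendsto U (fromBelow x) (𝓝 a)
  continuous : ∀ x : ℝ, x < 0 →
    ∃ a, Tendsto U (fromAbove x) (𝓝 a) ∧ Tendsto U (fromBelow x) (𝓝 a)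
  tractionContinuous : ∀ x : ℝ, x < 0 →
    ∃ s, Tendsto (traction m.plus U) (fromAbove x) (𝓝 s) ∧
      Tendsto (traction m.minus U) (fromBelow x) (𝓝 s)
  tractionFree : ∀ x : ℝ, 0 < x →
    Tendsto (traction m.plus U) (fromAbove x) (𝓝 0) ∧
      Tendsto (traction m.minus U) (fromBelow x) (𝓝 0)
  homogeneous : ∃ A B : Disp,
    IsHomogeneous (-(1 / 2) + Complex.I * (m.eps : ℂ)) A ∧
    IsHomogeneous (-(1 / 2) - Complex.I * (m.eps : ℂ)) B ∧
    ∀ p : ℝ × ℝ, p.2 ≠ 0 → U p = A p + B p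

/-- The jump `⟦U⟧(x₁) = U(x₁, 0⁺) - U(x₁, 0⁻)`. -/
def jump (U : Disp) (x : ℝ) : Fin 2 → ℂ :=
  limUnder (fromAbove x) U - limUnder (fromBelow x) U

/-- The traction `Σ(x₁) = [Σ₂₁, Σ₂₂]` on the line `x₂ = 0`, taken from above (for a singular
solution the limit from below is the same). -/
def lineTraction (m : Bimaterial) (U : Disp) (x : ℝ) : Fin 2 → ℂ :=
  limUnder (fromAbove x) (traction m.plus U)

/-! ### Linearity of the problem -/

theorem isOpen_upperBody : IsOpen upperBody := isOpen_lt continuous_const continuous_snd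

theorem isOpen_lowerBody : IsOpen lowerBody := isOpen_lt continuous_snd continuous_const

theorem contDiffOn_comp {S : Set (ℝ × ℝ)} {U : Disp} (hU : ContDiffOn ℝ 2 U S) (k : Fin 2) :
    ContDiffOn ℝ 2 (fun q => U q k) S := contDiffOn_pi.1 hU k

theorem differentiableAt_comp {S : Set (ℝ × ℝ)} (hS : IsOpen S) {U : Disp}
    (hU : ContDiffOn ℝ 2 U S) (k : Fin 2) {p : ℝ × ℝ} (hp : p ∈ S) :
    DifferentiableAt ℝ (fun q => U q k) p :=
  ((contDiffOn_comp hU k).contDiffAt (hS.mem_nhds hp)).differentiableAt (by norm_num)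

theorem differentiableAt_pd {S : Set (ℝ × ℝ)} (hS : IsOpen S) {U : Disp}
    (hU : ContDiffOn ℝ 2 U S) (j k : Fin 2) {p : ℝ × ℝ} (hp : p ∈ S) :
    DifferentiableAt ℝ (pd j (fun q => U q k)) p := by
  have h1 : ContDiffAt ℝ 2 (fun q => U q k) p := (contDiffOn_comp hU k).contDiffAt (hS.mem_nhds hp)
  have h2 : ContDiffAt ℝ 1 (fderiv ℝ (fun q => U q k)) p := h1.fderiv_right (by norm_num)
  exact (h2.differentiableAt (by norm_num)).clm_apply (differentiableAt_const _)

theorem differentiableAt_stress {S : Set (ℝ × ℝ)} (hS : IsOpen S) (M : Material) {U : Disp}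
    (hU : ContDiffOn ℝ 2 U S) (i j : Fin 2) {p : ℝ × ℝ} (hp : p ∈ S) :
    DifferentiableAt ℝ (stress M U i j) p := by
  have h := fun j k => differentiableAt_pd hS hU j k hp
  unfold stress
  simp only [Fin.sum_univ_two]
  exact (((h 0 0).add (h 1 1)).const_mul _).add (((h i j).add (h j i)).const_mul _)

theorem stress_add {S : Set (ℝ × ℝ)} (hS : IsOpen S) (M : Material) {U V : Disp}
    (hU : ContDiffOn ℝ 2 U S) (hV : ContDiffOn ℝ 2 V S) (i j : Fin 2) {p : ℝ × ℝ} (hp : p ∈ S) :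
    stress M (U + V) i j p = stress M U i j p + stress M V i j p := by
  have h : ∀ a k, pd a (fun q => (U + V) q k) p =
      pd a (fun q => U q k) p + pd a (fun q => V q k) p := fun a k => by
    have := fderiv_add (differentiableAt_comp hS hU k hp) (differentiableAt_comp hS hV k hp)
    have h2 : (fun q => (U + V) q k) = (fun q => U q k) + fun q => V q k := rfl
    unfold pd
    rw [h2, this]
    rfl
  simp only [stress, h, Finset.sum_add_distrib]
  ring

theorem stress_smul (M : Material) (c : ℂ) (U : Disp) (i j : Fin 2) (p : ℝ × ℝ) :
    stress M (c • U) i j p = c * stress M U i j p := by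
  have h : ∀ a k, pd a (fun q => (c • U) q k) p = c * pd a (fun q => U q k) p := fun a k => by
    have h2 : (fun q => (c • U) q k) = c • fun q => U q k := rfl
    unfold pd
    rw [h2, fderiv_const_smul_field]
    rfl
  simp only [stress, h, ← Finset.mul_sum]
  ring

theorem IsEquilibrium.add {S : Set (ℝ × ℝ)} (hS : IsOpen S) {M : Material} {U V : Disp}
    (hU : IsEquilibrium M S U) (hV : IsEquilibrium M S V) : IsEquilibrium M S (U + V) := by
  refine ⟨hU.1.add hV.1, fun p hp i => ?_⟩
  have h : ∀ j, pd j (stress M (U + V) i j) p =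
      pd j (stress M U i j) p + pd j (stress M V i j) p := fun j => by
    have h1 : stress M (U + V) i j =ᶠ[𝓝 p] stress M U i j + stress M V i j := by
      filter_upwards [hS.mem_nhds hp] with q hq
      exact stress_add hS M hU.1 hV.1 i j hq
    simp only [pd, h1.fderiv_eq]
    rw [fderiv_add (differentiableAt_stress hS M hU.1 i j hp)
      (differentiableAt_stress hS M hV.1 i j hp)]
    rfl
  simp only [h, Finset.sum_add_distrib, hU.2 p hp i, hV.2 p hp i, add_zero]

theorem IsEquilibrium.smul {S : Set (ℝ × ℝ)} {M : Material} {U : Disp} (c : ℂ)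
    (hU : IsEquilibrium M S U) : IsEquilibrium M S (c • U) := by
  refine ⟨hU.1.const_smul c, fun p hp i => ?_⟩
  have h : ∀ j, pd j (stress M (c • U) i j) p = c * pd j (stress M U i j) p := fun j => by
    have h1 : stress M (c • U) i j = c • stress M U i j := by
      funext q
      exact stress_smul M c U i j q
    unfold pd
    rw [h1, fderiv_const_smul_field]
    rfl
  simp only [h, ← Finset.mul_sum, hU.2 p hp i, mul_zero]

theorem tendsto_traction_add {S : Set (ℝ × ℝ)} (hS : IsOpen S) {M : Material} {U V : Disp}
    (hU : IsEquilibrium M S U) (hV : IsEquilibrium M S V) {x : ℝ × ℝ} {s t : Fin 2 → ℂ}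
    (hs : Tendsto (traction M U) (𝓝[S] x) (𝓝 s)) (ht : Tendsto (traction M V) (𝓝[S] x) (𝓝 t)) :
    Tendsto (traction M (U + V)) (𝓝[S] x) (𝓝 (s + t)) := by
  refine (hs.add ht).congr' ?_
  filter_upwards [self_mem_nhdsWithin] with q hq
  funext i
  exact (stress_add hS M hU.1 hV.1 1 i hq).symm

theorem tendsto_traction_smul {M : Material} {U : Disp} (c : ℂ) {l : Filter (ℝ × ℝ)}
    {s : Fin 2 → ℂ} (hs : Tendsto (traction M U) l (𝓝 s)) :
    Tendsto (traction M (c • U)) l (𝓝 (c • s)) := by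
  refine (hs.const_smul c).congr fun q => ?_
  funext i
  exact (stress_smul M c U 1 i q).symm

theorem isHomogeneous_add {z : ℂ} {A B : Disp} (hA : IsHomogeneous z A) (hB : IsHomogeneous z B) :
    IsHomogeneous z (A + B) := fun t ht p hp => by
  simp only [Pi.add_apply, hA t ht p hp, hB t ht p hp, smul_add]

theorem isHomogeneous_smul {z : ℂ} {A : Disp} (c : ℂ) (hA : IsHomogeneous z A) :
    IsHomogeneous z (c • A) := fun t ht p hp => by
  simp only [Pi.smul_apply, hA t ht p hp, smul_comm c]

theorem isSingularSolution_add {m : Bimaterial} {U V : Disp} (hU : IsSingularSolution m U)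
    (hV : IsSingularSolution m V) : IsSingularSolution m (U + V) where
  offLine p hp := by simp only [Pi.add_apply, hU.offLine p hp, hV.offLine p hp, add_zero]
  equilibriumPlus := hU.equilibriumPlus.add isOpen_upperBody hV.equilibriumPlus
  equilibriumMinus := hU.equilibriumMinus.add isOpen_lowerBody hV.equilibriumMinus
  traces x hx := by
    obtain ⟨⟨a, ha⟩, a2, ha2⟩ := hU.traces x hx
    obtain ⟨⟨b, hb⟩, b2, hb2⟩ := hV.traces x hx
    exact ⟨⟨a + b, ha.add hb⟩, a2 + b2, ha2.add hb2⟩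
  continuous x hx := by
    obtain ⟨a, ha, ha2⟩ := hU.continuous x hx
    obtain ⟨b, hb, hb2⟩ := hV.continuous x hx
    exact ⟨a + b, ha.add hb, ha2.add hb2⟩
  tractionContinuous x hx := by
    obtain ⟨a, ha, ha2⟩ := hU.tractionContinuous x hx
    obtain ⟨b, hb, hb2⟩ := hV.tractionContinuous x hx
    exact ⟨a + b,
      tendsto_traction_add isOpen_upperBody hU.equilibriumPlus hV.equilibriumPlus ha hb,
      tendsto_traction_add isOpen_lowerBody hU.equilibriumMinus hV.equilibriumMinus ha2 hb2⟩
  tractionFree x hx := by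
    obtain ⟨ha, ha2⟩ := hU.tractionFree x hx
    obtain ⟨hb, hb2⟩ := hV.tractionFree x hx
    have h1 := tendsto_traction_add isOpen_upperBody hU.equilibriumPlus hV.equilibriumPlus ha hb
    have h2 :=
      tendsto_traction_add isOpen_lowerBody hU.equilibriumMinus hV.equilibriumMinus ha2 hb2
    rw [add_zero] at h1 h2
    exact ⟨h1, h2⟩
  homogeneous := by
    obtain ⟨A, B, hA, hB, h⟩ := hU.homogeneous
    obtain ⟨C, D, hC, hD, h2⟩ := hV.homogeneous
    refine ⟨A + C, B + D, isHomogeneous_add hA hC, isHomogeneous_add hB hD, fun p hp => ?_⟩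
    simp only [Pi.add_apply, h p hp, h2 p hp]
    abel

theorem isSingularSolution_smul {m : Bimaterial} {U : Disp} (c : ℂ)
    (hU : IsSingularSolution m U) : IsSingularSolution m (c • U) where
  offLine p hp := by simp only [Pi.smul_apply, hU.offLine p hp, smul_zero]
  equilibriumPlus := hU.equilibriumPlus.smul c
  equilibriumMinus := hU.equilibriumMinus.smul c
  traces x hx := by
    obtain ⟨⟨a, ha⟩, a2, ha2⟩ := hU.traces x hx
    exact ⟨⟨c • a, ha.const_smul c⟩, c • a2, ha2.const_smul c⟩
  continuous x hx := by
    obtain ⟨a, ha, ha2⟩ := hU.continuous x hx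
    exact ⟨c • a, ha.const_smul c, ha2.const_smul c⟩
  tractionContinuous x hx := by
    obtain ⟨a, ha, ha2⟩ := hU.tractionContinuous x hx
    exact ⟨c • a, tendsto_traction_smul c ha, tendsto_traction_smul c ha2⟩
  tractionFree x hx := by
    obtain ⟨ha, ha2⟩ := hU.tractionFree x hx
    have h1 := tendsto_traction_smul c ha
    have h2 := tendsto_traction_smul c ha2
    rw [smul_zero] at h1 h2
    exact ⟨h1, h2⟩
  homogeneous := by
    obtain ⟨A, B, hA, hB, h⟩ := hU.homogeneous
    refine ⟨c • A, c • B, isHomogeneous_smul c hA, isHomogeneous_smul c hB, fun p hp => ?_⟩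
    simp only [Pi.smul_apply, h p hp, smul_add]

theorem stress_zero (M : Material) (i j : Fin 2) : stress M 0 i j = 0 := by
  funext p
  have h := stress_smul M 0 0 i j p
  rwa [zero_smul, zero_mul] at h

theorem isSingularSolution_zero (m : Bimaterial) : IsSingularSolution m 0 := by
  have ht : ∀ M, traction M 0 = fun _ => 0 := fun M => by
    funext p i
    exact congrFun (stress_zero M 1 i) p
  have he : ∀ M S, IsEquilibrium M S 0 := fun M S =>
    ⟨contDiffOn_const, fun p _ i => by
      simp only [stress_zero]
      simp [pd, Pi.zero_def]⟩
  refine ⟨fun _ _ => rfl, he _ _, he _ _, fun x _ => ⟨⟨0, tendsto_const_nhds⟩, 0,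
    tendsto_const_nhds⟩, fun x _ => ⟨0, tendsto_const_nhds, tendsto_const_nhds⟩, fun x _ => ?_,
    fun x _ => ?_, 0, 0, fun t _ p _ => ?_, fun t _ p _ => ?_, fun p _ => ?_⟩
  · rw [ht, ht]
    exact ⟨0, tendsto_const_nhds, tendsto_const_nhds⟩
  · rw [ht, ht]
    exact ⟨tendsto_const_nhds, tendsto_const_nhds⟩
  · simp
  · simp
  · simp

/-- The complex vector space of singular solutions. -/
def singularSolutions (m : Bimaterial) : Submodule ℂ Disp where
  carrier := {U | IsSingularSolution m U}
  add_mem' := isSingularSolution_add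
  zero_mem' := isSingularSolution_zero m
  smul_mem' c _ hU := isSingularSolution_smul c hU

/-! ### Fourier transforms -/

/-- Hadamard finite part as `δ → 0⁺`: `g δ` equals a finite combination of powers `δ^z` with
`Re z < 0`, plus a remainder that tends to `L`. -/
def HasFinitePart (g : ℝ → ℂ) (L : ℂ) : Prop :=
  ∃ (s : Finset ℂ) (c : ℂ → ℂ), (∀ z ∈ s, z.re < 0) ∧
    Tendsto (fun δ : ℝ => g δ - ∑ z ∈ s, c z * (δ : ℂ) ^ z) (𝓝[>] 0) (𝓝 L)

/-- `L = ∫₀^∞ f(x) e^{iβx} dx`, as an absolutely convergent integral. -/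
def HasPlusTransform (f : ℝ → ℂ) (β L : ℂ) : Prop :=
  IntegrableOn (fun x : ℝ => f x * Complex.exp (Complex.I * β * x)) (Set.Ioi 0) ∧
    ∫ x in Set.Ioi (0 : ℝ), f x * Complex.exp (Complex.I * β * x) = L

/-- `L = ∫_{-∞}^0 f(x) e^{iβx} dx`, where the integral is taken in the sense of the Hadamard
finite part at `x = 0` (tractions of singular solutions are of order `|x|^{-3/2}` there). -/
def HasMinusTransform (f : ℝ → ℂ) (β L : ℂ) : Prop :=
  (∀ δ : ℝ, 0 < δ →
    IntegrableOn (fun x : ℝ => f x * Complex.exp (Complex.I * β * x)) (Set.Iio (-δ))) ∧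
    HasFinitePart
      (fun δ => ∫ x in Set.Iio (-δ), f x * Complex.exp (Complex.I * β * x)) L

/-- `Φp` on the upper half-plane and `Φm` on the lower half-plane are the Fourier transforms of
the displacement jump and of the traction of `U`. -/
def IsTransformPair (m : Bimaterial) (U : Disp) (Φp Φm : ℂ → Fin 2 → ℂ) : Prop :=
  (∀ β : ℂ, 0 < β.im → ∀ i, HasPlusTransform (fun x => jump U x i) β (Φp β i)) ∧
    ∀ β : ℂ, β.im < 0 → ∀ i, HasMinusTransform (fun x => lineTraction m U x i) β (Φm β i)

/-! ### The Wiener-Hopf problem -/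

/-- The open upper half-plane `ℂ⁺`. -/
def CPlus : Set ℂ := {β | 0 < β.im}

/-- The open lower half-plane `ℂ⁻`. -/
def CMinus : Set ℂ := {β | β.im < 0}

/-- The closed upper half-plane without the origin. -/
def CPlusBar : Set ℂ := {β | 0 ≤ β.im ∧ β ≠ 0}

/-- The closed lower half-plane without the origin. -/
def CMinusBar : Set ℂ := {β | β.im ≤ 0 ∧ β ≠ 0}

/-- `β₊^z`: the power function on `ℂ⁺`, with the argument of `β` in `(0, π)`, together with its
boundary values on the real axis (argument `0` for `β > 0` and `π` for `β < 0`). -/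
def powPlus (β z : ℂ) : ℂ :=
  Complex.exp (z * (Complex.log (-Complex.I * β) + Complex.I * (Real.pi / 2)))

/-- `β₋^z`: the power function on `ℂ⁻`, with the argument of `β` in `(-π, 0)`, together with its
boundary values on the real axis (argument `0` for `β > 0` and `-π` for `β < 0`). -/
def powMinus (β z : ℂ) : ℂ :=
  Complex.exp (z * (Complex.log (Complex.I * β) - Complex.I * (Real.pi / 2)))

namespace Bimaterial

variable (m : Bimaterial)

/-- `B⁺(β) = -ε log(-iβ)`. -/
def BPlus (β : ℂ) : ℂ := -(m.eps : ℂ) * Complex.log (-Complex.I * β)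

/-- `B⁻(β) = -ε log(iβ)`. -/
def BMinus (β : ℂ) : ℂ := -(m.eps : ℂ) * Complex.log (Complex.I * β)

/-- The factor `X⁺`. -/
def XPlus (β : ℂ) : Matrix (Fin 2) (Fin 2) ℂ :=
  (m.d0 : ℂ) • !![Complex.cos (m.BPlus β), -Complex.sin (m.BPlus β);
    Complex.sin (m.BPlus β), Complex.cos (m.BPlus β)]

/-- The factor `X⁻`. -/
def XMinus (β : ℂ) : Matrix (Fin 2) (Fin 2) ℂ :=
  (m.d0 : ℂ)⁻¹ • !![Complex.cos (m.BMinus β), -Complex.sin (m.BMinus β);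
    Complex.sin (m.BMinus β), Complex.cos (m.BMinus β)]

/-- The matrix `G(β)`, for real `β`. -/
def G (β : ℝ) : Matrix (Fin 2) (Fin 2) ℂ :=
  !![1, -Complex.I * (SignType.sign β : ℝ) * (m.dStar : ℂ);
    Complex.I * (SignType.sign β : ℝ) * (m.dStar : ℂ), 1]

/-- The homogeneous Wiener-Hopf problem `Φ⁺ = -(b/|β|) G Φ⁻` on the real axis, for functions
analytic in `ℂ⁺`, `ℂ⁻`, continuous up to the real axis without the origin, and of order
`|β|^{-1/2}`, `|β|^{1/2}` respectively, both at infinity and at zero. -/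
structure IsWienerHopfSolution (Φp Φm : ℂ → Fin 2 → ℂ) : Prop where
  analyticPlus : DifferentiableOn ℂ Φp CPlus
  analyticMinus : DifferentiableOn ℂ Φm CMinus
  continuousPlus : ContinuousOn Φp CPlusBar
  continuousMinus : ContinuousOn Φm CMinusBar
  equation : ∀ β : ℝ, β ≠ 0 →
    Φp (β : ℂ) = (-((m.b : ℂ) / (|β| : ℝ))) • (m.G β *ᵥ Φm (β : ℂ))
  plusAtInfinity :
    Φp =O[Bornology.cobounded ℂ ⊓ 𝓟 CPlus] fun β => ‖β‖ ^ (-(1 / 2) : ℝ)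
  minusAtInfinity :
    Φm =O[Bornology.cobounded ℂ ⊓ 𝓟 CMinus] fun β => ‖β‖ ^ (1 / 2 : ℝ)
  plusAtZero : Φp =O[𝓝[CPlus] 0] fun β => ‖β‖ ^ (-(1 / 2) : ℝ)
  minusAtZero : Φm =O[𝓝[CMinus] 0] fun β => ‖β‖ ^ (1 / 2 : ℝ)

/-- `β₊^{-1/2} X⁺(β) e`. -/
def whPlus (e : Fin 2 → ℂ) (β : ℂ) : Fin 2 → ℂ :=
  (1 / powPlus β (1 / 2)) • (m.XPlus β *ᵥ e)

/-- `-(β₋^{1/2}/b) X⁻(β) e`. -/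
def whMinus (e : Fin 2 → ℂ) (β : ℂ) : Fin 2 → ℂ :=
  (-(powMinus β (1 / 2) / (m.b : ℂ))) • (m.XMinus β *ᵥ e)

/-! ### Explicit weight functions

In the following matrices the `j`-th column belongs to the `j`-th weight function. -/

/-- The transformed symmetric weight function matrix. -/
def jumpHat (β : ℂ) : Matrix (Fin 2) (Fin 2) ℂ :=
  let u := powPlus β (Complex.I * m.eps)
  let v := powPlus β (-Complex.I * m.eps)
  let p := (m.d0 : ℂ) / 2 * powPlus β (-(1 / 2)) * (m.e0 * u + 1 / m.e0 * v)
  let q := Complex.I * (m.d0 : ℂ) / 2 * powPlus β (-(1 / 2)) * (m.e0 * u - 1 / m.e0 * v)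
  !![p, -q; q, p]

/-- The transformed traction matrix. -/
def tractionHat (β : ℂ) : Matrix (Fin 2) (Fin 2) ℂ :=
  let u := powMinus β (Complex.I * m.eps)
  let v := powMinus β (-Complex.I * m.eps)
  let p := -(1 / (2 * (m.b : ℂ) * m.d0)) * powMinus β (1 / 2) * (1 / m.e0 * u + m.e0 * v)
  let q := -(Complex.I / (2 * (m.b : ℂ) * m.d0)) * powMinus β (1 / 2) *
    (1 / m.e0 * u - m.e0 * v)
  !![p, -q; q, p]

end Bimaterial

/-- The matrix `𝓑`. -/
def matB : Matrix (Fin 2) (Fin 2) ℂ := !![1, -Complex.I; Complex.I, 1]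

namespace Bimaterial

variable (m : Bimaterial)

/-- The symmetric weight function matrix `⟦U⟧(x₁)`. -/
def jumpMatrix (x : ℝ) : Matrix (Fin 2) (Fin 2) ℂ :=
  if 0 < x then
    (1 / (2 * (m.d0 : ℂ) * (Real.sqrt (2 * Real.pi * x) : ℂ))) •
      (((x : ℂ) ^ (-Complex.I * m.eps) / m.c1Plus) • matB +
        ((x : ℂ) ^ (Complex.I * m.eps) / m.c1Minus) • matBᵀ)
  else 0

/-- The traction matrix `Σ(x₁)`, with rows `Σ₂₁`, `Σ₂₂`. -/
def tractionMatrix (x : ℝ) : Matrix (Fin 2) (Fin 2) ℂ :=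
  if x < 0 then
    (((-x) ^ (-(3 / 2) : ℝ) : ℝ) /
        (2 * (m.b : ℂ) * (m.d0 : ℂ) ^ 3 * (Real.sqrt (2 * Real.pi) : ℂ))) •
      (((1 / 2 + Complex.I * m.eps) / m.c1Plus * ((-x : ℝ) : ℂ) ^ (-Complex.I * m.eps)) • matB +
        ((1 / 2 - Complex.I * m.eps) / m.c1Minus * ((-x : ℝ) : ℂ) ^ (Complex.I * m.eps)) • matBᵀ)
  else 0

end Bimaterial

end InterfaceCrack

end

/-!
The matrix functions `X^±` are, up to the scalars `d₀^{±1}`, rotations through the complex angles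
`-ε log (∓iβ)`. On the real axis the two angles differ by `± iπε`, and `d_* = tanh πε`,
`d₀² cosh πε = 1`; so `X⁺ (X⁻)⁻¹ = G` (`XPlus_mul_XMinus_inv`), which is the factorization.

For a solution of the Wiener-Hopf problem, the functions `β₊^{1/2} (X⁺)⁻¹ Φ⁺` and
`-b β₋^{-1/2} (X⁻)⁻¹ Φ⁻` agree on the real axis and are bounded, because a rotation through an angle
of bounded imaginary part is. By Morera's theorem they are one holomorphic function off the origin,
and by Liouville's theorem this function is a constant `e`
(`exists_eq_const_of_differentiableAt_off_real`, `IsWienerHopfSolution.exists_eq`).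

The singular solutions are computed in physical space. In each half-plane, Navier's equations make
`(λ + 2μ) div U ± i μ rot U` holomorphic, respectively antiholomorphic. A homogeneous field of degree
`l` therefore has Kolosov-Muskhelishvili potentials that are multiples of `z^l`, and it depends on
four coefficients `A`, `C`, `E`, `F` in each half-plane (`exists_eq_kolField`). Traction-free crack
faces determine `E` and `F`, continuity of tractions ahead of the crack determines the lower
coefficients from the upper ones, and continuity of displacements becomes an equation for the degree
alone (`IsSingularSolution.exists_eq_modeField`, `IsCrackDegree`). It leaves the coefficient `A` for
the degree `-1/2 + iε` and `C` for `-1/2 - iε`. A singular solution is only assumed to be a sum of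
two homogeneous fields; these are recovered as combinations of the solution and one of its
dilations, so they are singular solutions themselves (`IsSingularSolution.exists_eq_wave`). If
`ε = 0`, the two degrees coincide, and both coefficients are free.

On the crack line, jump and traction of the two normalized solutions (`wave`) are powers times the
eigenvectors `[1, ∓i]` of all rotations. Their transforms are Gamma integrals, the one of the
traction after an integration by parts which splits off the divergent power of the finite part
(`tendsto_laplace_finitePart`). Expanding a constant vector `e` in the eigenvectors yields a linear
isomorphism `weightField` from `ℂ²` onto the singular solutions, under which the transforms are the
solutions of the Wiener-Hopf problem. The reflection formula for `Γ(1/2 + iε)` gives the constants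
of the explicit weight functions.
-/

namespace InterfaceCrack

/-! ### Analytic continuation across the real axis -/

section Painleve

variable {E : Type*} [NormedAddCommGroup E]

/-- A continuous function on a disk that is holomorphic off the real axis is conservative: a
rectangle that meets the real axis is cut along it. -/
theorem isConservativeOn_of_differentiableAt_off_real [NormedSpace ℂ E] {f : ℂ → E}
    {c : ℂ} {r : ℝ}
    (hc : ContinuousOn f (Metric.ball c r))
    (hd : ∀ z ∈ Metric.ball c r, z.im ≠ 0 → DifferentiableAt ℂ f z) :
    Complex.IsConservativeOn f (Metric.ball c r) := by
  intro z w hzw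
  rw [← add_eq_zero_iff_eq_neg, Complex.wedgeIntegral_add_wedgeIntegral_eq]
  have hRect : ∀ y₁ y₂ : ℝ, Set.uIcc y₁ y₂ ⊆ Set.uIcc z.im w.im →
      Set.uIcc z.re w.re ×ℂ Set.uIcc y₁ y₂ ⊆ Metric.ball c r := fun y₁ y₂ h =>
    (Set.inter_subset_inter_right _ (Set.preimage_mono h)).trans hzw
  have key : ∀ y₁ y₂ : ℝ, Set.uIcc y₁ y₂ ⊆ Set.uIcc z.im w.im →
      (0 : ℝ) ∉ Set.Ioo (min y₁ y₂) (max y₁ y₂) →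
      (∫ x : ℝ in z.re..w.re, f (x + y₁ * Complex.I)) -
        (∫ x : ℝ in z.re..w.re, f (x + y₂ * Complex.I)) +
      Complex.I • (∫ y : ℝ in y₁..y₂, f (w.re + y * Complex.I)) -
      Complex.I • (∫ y : ℝ in y₁..y₂, f (z.re + y * Complex.I)) = 0 := by
    intro y₁ y₂ hy h0
    have := Complex.integral_boundary_rect_eq_zero_of_differentiable_on_off_countable f
      (⟨z.re, y₁⟩ : ℂ) (⟨w.re, y₂⟩ : ℂ) ∅ Set.countable_empty (hc.mono (hRect y₁ y₂ hy)) ?_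
    · simpa using this
    · rintro x ⟨⟨hx1, hx2⟩, -⟩
      refine hd x (hRect y₁ y₂ hy ⟨Set.Ioo_subset_Icc_self hx1, Set.Ioo_subset_Icc_self hx2⟩) ?_
      intro hx
      exact h0 (hx ▸ hx2)
  have hint : ∀ a : ℝ, a ∈ Set.uIcc z.re w.re → ∀ y₁ y₂ : ℝ,
      Set.uIcc y₁ y₂ ⊆ Set.uIcc z.im w.im →
      IntervalIntegrable (fun y : ℝ => f (a + y * Complex.I)) volume y₁ y₂ := by
    intro a ha y₁ y₂ hy
    refine ContinuousOn.intervalIntegrable (hc.comp (by fun_prop) fun y hyy => ?_)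
    refine hRect y₁ y₂ hy ⟨?_, ?_⟩
    · simpa using ha
    · simpa using hyy
  by_cases h0 : (0 : ℝ) ∈ Set.Ioo (min z.im w.im) (max z.im w.im)
  · have h0' : (0 : ℝ) ∈ Set.uIcc z.im w.im := Set.Ioo_subset_Icc_self h0
    have s1 : Set.uIcc z.im 0 ⊆ Set.uIcc z.im w.im :=
      Set.uIcc_subset_uIcc Set.left_mem_uIcc h0'
    have s2 : Set.uIcc 0 w.im ⊆ Set.uIcc z.im w.im :=
      Set.uIcc_subset_uIcc h0' Set.right_mem_uIcc
    have k1 := key z.im 0 s1 (by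
      rintro ⟨h1, h2⟩
      rcases le_total z.im 0 with h | h <;> simp [h] at h1 h2)
    have k2 := key 0 w.im s2 (by
      rintro ⟨h1, h2⟩
      rcases le_total w.im 0 with h | h <;> simp [h] at h1 h2)
    rw [← intervalIntegral.integral_add_adjacent_intervals
        (hint w.re Set.right_mem_uIcc z.im 0 s1) (hint w.re Set.right_mem_uIcc 0 w.im s2),
      ← intervalIntegral.integral_add_adjacent_intervals
        (hint z.re Set.left_mem_uIcc z.im 0 s1) (hint z.re Set.left_mem_uIcc 0 w.im s2),
      smul_add, smul_add]
    rw [← add_zero (0 : E)]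
    nth_rewrite 1 [← k1]
    rw [← k2]
    abel
  · exact key z.im w.im subset_rfl h0

/-- Painlevé's theorem on a removable line: a continuous function on an open set that is
holomorphic off the real axis is holomorphic. -/
theorem differentiableOn_of_differentiableAt_off_real [NormedSpace ℂ E] [CompleteSpace E]
    {f : ℂ → E} {S : Set ℂ} (hS : IsOpen S)
    (hc : ContinuousOn f S) (hd : ∀ z ∈ S, z.im ≠ 0 → DifferentiableAt ℂ f z) :
    DifferentiableOn ℂ f S := by
  intro z hz
  obtain ⟨r, hr, hrS⟩ := Metric.isOpen_iff.1 hS z hz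
  have h := isConservativeOn_of_differentiableAt_off_real (hc.mono hrS)
    fun w hw => hd w (hrS hw)
  have := (h.isExactOn_ball (hc.mono hrS)).differentiableOn Metric.isOpen_ball
  exact (this.differentiableAt (Metric.ball_mem_nhds z hr)).differentiableWithinAt

theorem neBot_nhdsWithin_im_ne_zero (z : ℂ) : (𝓝[{w : ℂ | w.im ≠ 0}] z).NeBot := by
  have h : Dense {w : ℂ | w.im ≠ 0} := by
    have : {w : ℂ | w.im ≠ 0} = Complex.im ⁻¹' {0}ᶜ := rfl
    rw [this]
    exact (dense_compl_singleton (0 : ℝ)).preimage Complex.isOpenMap_im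
  exact mem_closure_iff_nhdsWithin_neBot.1 (h z)

/-- A bound off the real axis on an open set extends to the real points of continuity. -/
theorem norm_le_of_norm_le_off_real {f : ℂ → E} {S : Set ℂ} (hS : IsOpen S)
    (hc : ContinuousOn f S) {C : ℝ} (hC : ∀ z ∈ S, z.im ≠ 0 → ‖f z‖ ≤ C) :
    ∀ z ∈ S, ‖f z‖ ≤ C := by
  intro z hz
  have := neBot_nhdsWithin_im_ne_zero z
  have ht : Tendsto (fun w => ‖f w‖) (𝓝[{w : ℂ | w.im ≠ 0}] z) (𝓝 ‖f z‖) :=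
    ((hc.continuousAt (hS.mem_nhds hz)).norm.tendsto).mono_left nhdsWithin_le_nhds
  refine le_of_tendsto ht ?_
  filter_upwards [self_mem_nhdsWithin, nhdsWithin_le_nhds (hS.mem_nhds hz)] with w h1 h2
  exact hC w h2 h1

/-- Liouville's theorem for functions on `ℂ \ {0}` that are continuous, holomorphic off the real
axis, and bounded off the real axis near `0` and near infinity. -/
theorem exists_eq_const_of_differentiableAt_off_real [NormedSpace ℂ E] [CompleteSpace E]
    {f : ℂ → E} (hc : ContinuousOn f {0}ᶜ)
    (hd : ∀ z : ℂ, z.im ≠ 0 → DifferentiableAt ℂ f z)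
    (h0 : f =O[𝓝[{w : ℂ | w.im ≠ 0}] 0] fun _ => (1 : ℝ))
    (hi : f =O[Bornology.cobounded ℂ ⊓ 𝓟 {w : ℂ | w.im ≠ 0}] fun _ => (1 : ℝ)) :
    ∃ e, ∀ z : ℂ, z ≠ 0 → f z = e := by
  have hdiff : DifferentiableOn ℂ f {0}ᶜ :=
    differentiableOn_of_differentiableAt_off_real isOpen_compl_singleton hc fun z _ => hd z
  obtain ⟨C₀, hC₀⟩ := h0.bound
  rw [eventually_nhdsWithin_iff, Metric.eventually_nhds_iff] at hC₀
  obtain ⟨δ, hδ, hC₀⟩ := hC₀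
  obtain ⟨C₁, hC₁⟩ := hi.bound
  rw [eventually_inf_principal, (Metric.hasBasis_cobounded_compl_closedBall (0 : ℂ)).eventually_iff]
    at hC₁
  obtain ⟨R, -, hC₁⟩ := hC₁
  have b0 : ∀ z ∈ Metric.ball (0 : ℂ) δ \ {0}, ‖f z‖ ≤ C₀ :=
    norm_le_of_norm_le_off_real (Metric.isOpen_ball.sdiff isClosed_singleton)
      (hc.mono fun z hz => hz.2) fun z hz hz2 => by simpa using hC₀ hz.1 hz2
  have b1 : ∀ z ∈ (Metric.closedBall (0 : ℂ) (max R 0))ᶜ, ‖f z‖ ≤ C₁ := by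
    refine norm_le_of_norm_le_off_real Metric.isClosed_closedBall.isOpen_compl
      (hc.mono fun z hz h => hz ?_) fun z hz hz2 => ?_
    · rw [h]; simp
    · have : z ∈ (Metric.closedBall (0 : ℂ) R)ᶜ := fun h =>
        hz (Metric.closedBall_subset_closedBall (le_max_left _ _) h)
      simpa using hC₁ this hz2
  -- the singularity at the origin is removable
  set g := Function.update f 0 (limUnder (𝓝[≠] 0) f) with hg
  have hg1 : ∀ z : ℂ, z ≠ 0 → g z = f z := fun z hz => Function.update_of_ne hz _ _
  have hgd : Differentiable ℂ g := by
    have h := Complex.differentiableOn_update_limUnder_of_bddAbove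
      (Metric.ball_mem_nhds (0 : ℂ) hδ) (hdiff.mono fun z hz => hz.2)
      ⟨C₀, by rintro _ ⟨z, hz, rfl⟩; exact b0 z hz⟩
    intro z
    by_cases hz : z = 0
    · subst hz
      exact h.differentiableAt (Metric.ball_mem_nhds _ hδ)
    · refine (hdiff.differentiableAt (isOpen_compl_singleton.mem_nhds hz)).congr_of_eventuallyEq ?_
      filter_upwards [isOpen_compl_singleton.mem_nhds hz] with w hw
      exact hg1 w hw
  have hgb : Bornology.IsBounded (Set.range g) := by
    obtain ⟨C₂, hC₂⟩ := (isCompact_closedBall (0 : ℂ) (max R 0)).exists_bound_of_continuousOn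
      hgd.continuous.continuousOn
    rw [isBounded_iff_forall_norm_le]
    refine ⟨max C₁ C₂, ?_⟩
    rintro _ ⟨z, rfl⟩
    by_cases hz : z ∈ Metric.closedBall (0 : ℂ) (max R 0)
    · exact (hC₂ z hz).trans (le_max_right _ _)
    · have hz0 : z ≠ 0 := fun h => hz (by rw [h]; simp)
      rw [hg1 z hz0]
      exact (b1 z hz).trans (le_max_left _ _)
  obtain ⟨e, he⟩ := hgd.exists_const_forall_eq_of_bounded hgb
  exact ⟨e, fun z hz => (hg1 z hz).symm.trans (he z)⟩

end Painleve

/-! ### The bimaterial constants -/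

namespace Bimaterial

variable (m : Bimaterial)

theorem b_pos : 0 < m.b := by
  have h1 := m.plus.nu_lt
  have h2 := m.minus.nu_lt
  exact add_pos (div_pos (by linarith) m.plus.mu_pos) (div_pos (by linarith) m.minus.mu_pos)

theorem b_ne_zero : (m.b : ℂ) ≠ 0 := Complex.ofReal_ne_zero.2 m.b_pos.ne'

/-- The defining equation `e^{2πε} (μ₋ + κ₋ μ₊) = μ₊ + κ₊ μ₋` of the oscillation index, with
`κ = 3 - 4ν`. -/
theorem exp_two_pi_eps_mul :
    Real.exp (2 * Real.pi * m.eps) * (m.minus.mu + (3 - 4 * m.minus.nu) * m.plus.mu) =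
      m.plus.mu + (3 - 4 * m.plus.nu) * m.minus.mu := by
  have h1 := m.plus.nu_lt
  have h2 := m.minus.nu_lt
  have h3 := m.plus.mu_pos
  have h4 := m.minus.mu_pos
  have hp : 0 < m.plus.mu + (3 - 4 * m.plus.nu) * m.minus.mu :=
    add_pos h3 (mul_pos (by linarith) h4)
  have hm : 0 < m.minus.mu + (3 - 4 * m.minus.nu) * m.plus.mu :=
    add_pos h4 (mul_pos (by linarith) h3)
  have : 2 * Real.pi * m.eps = Real.log ((m.plus.mu + (3 - 4 * m.plus.nu) * m.minus.mu) /
      (m.minus.mu + (3 - 4 * m.minus.nu) * m.plus.mu)) := by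
    unfold eps
    field_simp
  rw [this, Real.exp_log (div_pos hp hm), div_mul_cancel₀ _ hm.ne']

/-- The Dundurs parameter is `d_* = tanh (πε)`. -/
theorem dStar_mul_cosh : m.dStar * Real.cosh (Real.pi * m.eps) = Real.sinh (Real.pi * m.eps) := by
  have h1 := m.plus.nu_lt
  have h2 := m.minus.nu_lt
  have hD : 0 < 2 * m.minus.mu * (1 - m.plus.nu) + 2 * m.plus.mu * (1 - m.minus.nu) :=
    add_pos (mul_pos (by linarith [m.minus.mu_pos]) (by linarith))
      (mul_pos (by linarith [m.plus.mu_pos]) (by linarith))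
  have h := m.exp_two_pi_eps_mul
  have hE : Real.exp (2 * Real.pi * m.eps) =
      Real.exp (Real.pi * m.eps) * Real.exp (Real.pi * m.eps) := by
    rw [← Real.exp_add]; congr 1; ring
  rw [hE] at h
  have hi : Real.exp (-(Real.pi * m.eps)) * Real.exp (Real.pi * m.eps) = 1 := by
    rw [← Real.exp_add]; simp
  rw [Real.cosh_eq, Real.sinh_eq, dStar]
  generalize Real.exp (Real.pi * m.eps) = x at *
  generalize Real.exp (-(Real.pi * m.eps)) = y at *
  rw [div_mul_eq_mul_div, div_eq_iff hD.ne']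
  linear_combination (-y / 2) * h +
    (m.minus.mu + (3 - 4 * m.minus.nu) * m.plus.mu) * x / 2 * hi

theorem dStar_sq_add : m.dStar ^ 2 * Real.cosh (Real.pi * m.eps) ^ 2 + 1 =
    Real.cosh (Real.pi * m.eps) ^ 2 := by
  have h := Real.cosh_sq (Real.pi * m.eps)
  rw [← mul_pow, dStar_mul_cosh, h]

theorem one_sub_dStar_sq_pos : 0 < 1 - m.dStar ^ 2 := by
  have h := m.dStar_sq_add
  have hc := Real.cosh_pos (Real.pi * m.eps)
  by_contra! hn
  nlinarith [mul_nonneg (neg_nonneg.2 hn) (sq_nonneg (Real.cosh (Real.pi * m.eps)))]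

theorem d0_pos : 0 < m.d0 := Real.rpow_pos_of_pos m.one_sub_dStar_sq_pos _

theorem d0_ne_zero : (m.d0 : ℂ) ≠ 0 := Complex.ofReal_ne_zero.2 m.d0_pos.ne'

theorem d0_sq_mul_cosh : m.d0 ^ 2 * Real.cosh (Real.pi * m.eps) = 1 := by
  have hc := Real.cosh_pos (Real.pi * m.eps)
  have h4 : m.d0 ^ 4 = 1 - m.dStar ^ 2 := by
    rw [d0, ← Real.rpow_natCast, ← Real.rpow_mul m.one_sub_dStar_sq_pos.le]
    norm_num
  have h := m.dStar_sq_add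
  have h2 : (m.d0 ^ 2 * Real.cosh (Real.pi * m.eps)) ^ 2 = 1 := by
    rw [mul_pow, ← pow_mul, h4]; linarith
  exact (pow_eq_one_iff_of_nonneg (by positivity) two_ne_zero).1 h2

end Bimaterial

/-! ### Powers on the closed half-planes without the origin -/

/-- The branch of the logarithm on the half-plane `0 < σ Im β` (`σ = ±1`) and on its boundary
without the origin, with imaginary part between `0` and `σπ`. -/
noncomputable def halfLog (σ : ℝ) (β : ℂ) : ℂ :=
  Complex.log (-(σ * Complex.I) * β) + σ * Complex.I * (Real.pi / 2)

/-- The closed half-plane `0 ≤ σ Im β` without the origin. -/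
def halfBar (σ : ℝ) : Set ℂ := {β | 0 ≤ σ * β.im ∧ β ≠ 0}

theorem halfBar_one : halfBar 1 = CPlusBar := by simp [halfBar, CPlusBar]

theorem halfBar_neg_one : halfBar (-1) = CMinusBar := by simp [halfBar, CMinusBar]

theorem powPlus_eq (β z : ℂ) : powPlus β z = Complex.exp (z * halfLog 1 β) := by
  simp [powPlus, halfLog]

theorem powMinus_eq (β z : ℂ) : powMinus β z = Complex.exp (z * halfLog (-1) β) := by
  simp [powMinus, halfLog, sub_eq_add_neg]

theorem mem_slitPlane_of_mem_halfBar {σ : ℝ} (hσ : σ ≠ 0) {β : ℂ} (hβ : β ∈ halfBar σ) :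
    -(σ * Complex.I) * β ∈ Complex.slitPlane := by
  rw [Complex.mem_slitPlane_iff]
  rcases hβ.1.lt_or_eq with h | h
  · left; simpa using h
  · right
    have him : β.im = 0 := by simpa [hσ] using h.symm
    have hre : β.re ≠ 0 := fun h2 => hβ.2 (Complex.ext h2 him)
    simpa using ⟨hσ, hre⟩

theorem differentiableAt_log_halfBar {σ : ℝ} (hσ : σ ≠ 0) {β : ℂ} (hβ : β ∈ halfBar σ) :
    DifferentiableAt ℂ (fun β => Complex.log (-(σ * Complex.I) * β)) β :=
  ((differentiableAt_id).const_mul _).clog (mem_slitPlane_of_mem_halfBar hσ hβ)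

theorem differentiableAt_halfLog {σ : ℝ} (hσ : σ ≠ 0) {β : ℂ} (hβ : β ∈ halfBar σ) :
    DifferentiableAt ℂ (halfLog σ) β :=
  (differentiableAt_log_halfBar hσ hβ).add_const _

theorem exp_halfLog {σ : ℝ} (hσ : σ = 1 ∨ σ = -1) {β : ℂ} (hβ : β ≠ 0) :
    Complex.exp (halfLog σ β) = β := by
  have hI : Complex.exp (Complex.I * (Real.pi / 2)) = Complex.I := by
    rw [mul_comm]; exact Complex.exp_pi_div_two_mul_I
  rcases hσ with rfl | rfl
  · rw [halfLog, Complex.exp_add, Complex.exp_log (by simpa using hβ)]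
    simp only [Complex.ofReal_one, one_mul, hI]
    linear_combination (-β) * Complex.I_mul_I
  · rw [halfLog, Complex.exp_add, Complex.exp_log (by simpa using hβ)]
    simp only [Complex.ofReal_neg, Complex.ofReal_one, neg_mul, one_mul, Complex.exp_neg, hI,
      Complex.inv_I]
    linear_combination (-β) * Complex.I_mul_I

theorem hasDerivAt_halfLog {σ : ℝ} (hσ : σ = 1 ∨ σ = -1) {β : ℂ} (hβ : β ∈ halfBar σ) :
    HasDerivAt (halfLog σ) β⁻¹ β := by
  have hσ0 : (σ : ℂ) ≠ 0 := by rcases hσ with rfl | rfl <;> simp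
  have h := (((hasDerivAt_id' β).const_mul (-(σ * Complex.I))).clog
    (mem_slitPlane_of_mem_halfBar (by exact_mod_cast hσ0) hβ)).add_const
      (σ * Complex.I * (Real.pi / 2))
  have hβ0 := hβ.2
  have e : -(σ * Complex.I) * 1 / (-(σ * Complex.I) * β) = β⁻¹ := by field_simp
  rwa [e] at h

theorem re_halfLog {σ : ℝ} (hσ : σ = 1 ∨ σ = -1) (β : ℂ) :
    (halfLog σ β).re = Real.log ‖β‖ := by
  rcases hσ with rfl | rfl <;> simp [halfLog, Complex.log_re]

/-- On the positive half-axis the branch is the real logarithm. -/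
theorem halfLog_of_pos {σ : ℝ} (hσ : σ = 1 ∨ σ = -1) {x : ℝ} (hx : 0 < x) :
    halfLog σ x = Real.log x := by
  have h1 : Complex.log (-Complex.I * x) = Real.log x - Complex.I * (Real.pi / 2) := by
    rw [mul_comm, Complex.log_ofReal_mul hx (by simp)]
    simp [Complex.log_neg_I]; ring
  have h2 : Complex.log (Complex.I * x) = Real.log x + Complex.I * (Real.pi / 2) := by
    rw [mul_comm, Complex.log_ofReal_mul hx (by simp)]
    simp [Complex.log_I]; ring
  rcases hσ with rfl | rfl
  · simp only [halfLog, Complex.ofReal_one, one_mul, h1]; ring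
  · simp only [halfLog, Complex.ofReal_neg, Complex.ofReal_one, neg_mul, one_mul, neg_neg, h2]; ring

/-- On the negative half-axis the branch has imaginary part `σπ`. -/
theorem halfLog_of_neg {σ : ℝ} (hσ : σ = 1 ∨ σ = -1) {x : ℝ} (hx : x < 0) :
    halfLog σ x = Real.log (-x) + σ * Complex.I * Real.pi := by
  have hx' : 0 < -x := by linarith
  have h1 : Complex.log (-Complex.I * x) = Real.log (-x) + Complex.I * (Real.pi / 2) := by
    have : -Complex.I * x = ((-x : ℝ) : ℂ) * Complex.I := by push_cast; ring
    rw [this, Complex.log_ofReal_mul hx' (by simp), Complex.log_I]; ring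
  have h2 : Complex.log (Complex.I * x) = Real.log (-x) - Complex.I * (Real.pi / 2) := by
    have : Complex.I * x = ((-x : ℝ) : ℂ) * -Complex.I := by push_cast; ring
    rw [this, Complex.log_ofReal_mul hx' (by simp), Complex.log_neg_I]; ring
  rcases hσ with rfl | rfl
  · simp only [halfLog, Complex.ofReal_one, one_mul, h1]; ring
  · simp only [halfLog, Complex.ofReal_neg, Complex.ofReal_one, neg_mul, one_mul, neg_neg, h2]; ring

theorem norm_exp_mul_halfLog {σ : ℝ} (hσ : σ = 1 ∨ σ = -1) {β : ℂ} (hβ : β ≠ 0) (s : ℝ) :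
    ‖Complex.exp (s * halfLog σ β)‖ = ‖β‖ ^ s := by
  rw [Complex.norm_exp, Complex.re_ofReal_mul, re_halfLog hσ,
    Real.rpow_def_of_pos (norm_pos_iff.2 hβ), mul_comm]

/-! ### Complex rotations -/

/-- The rotation matrix of a complex angle. -/
noncomputable def rot (θ : ℂ) : Matrix (Fin 2) (Fin 2) ℂ :=
  !![Complex.cos θ, -Complex.sin θ; Complex.sin θ, Complex.cos θ]

theorem rot_mul (a b : ℂ) : rot a * rot b = rot (a + b) := by
  ext i j
  fin_cases i <;> fin_cases j <;>
    simp [rot, Matrix.mul_apply, Fin.sum_univ_two, Complex.cos_add, Complex.sin_add] <;> ring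

theorem rot_zero : rot 0 = 1 := by
  ext i j
  fin_cases i <;> fin_cases j <;> simp [rot]

theorem det_rot (θ : ℂ) : (rot θ).det = 1 := by
  rw [rot, Matrix.det_fin_two_of]
  linear_combination Complex.cos_sq_add_sin_sq θ

theorem rot_mulVec (θ : ℂ) (v : Fin 2 → ℂ) : rot θ *ᵥ v =
    ![Complex.cos θ * v 0 - Complex.sin θ * v 1, Complex.sin θ * v 0 + Complex.cos θ * v 1] := by
  ext i
  fin_cases i <;> simp [rot, Matrix.mulVec, dotProduct, Fin.sum_univ_two, sub_eq_add_neg]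

theorem norm_cos_le (θ : ℂ) : ‖Complex.cos θ‖ ≤ Real.exp |θ.im| := by
  rw [Complex.cos, norm_div, Complex.norm_ofNat, div_le_iff₀ two_pos]
  refine (norm_add_le _ _).trans ?_
  rw [Complex.norm_exp, Complex.norm_exp]
  have h1 : Real.exp (θ * Complex.I).re ≤ Real.exp |θ.im| :=
    Real.exp_le_exp.2 (by simpa using neg_le_abs θ.im)
  have h2 : Real.exp (-θ * Complex.I).re ≤ Real.exp |θ.im| :=
    Real.exp_le_exp.2 (by simpa using le_abs_self θ.im)
  linarith

theorem norm_sin_le (θ : ℂ) : ‖Complex.sin θ‖ ≤ Real.exp |θ.im| := by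
  rw [Complex.sin, norm_div, Complex.norm_ofNat, div_le_iff₀ two_pos, norm_mul, Complex.norm_I,
    mul_one]
  refine (norm_sub_le _ _).trans ?_
  rw [Complex.norm_exp, Complex.norm_exp]
  have h1 : Real.exp (θ * Complex.I).re ≤ Real.exp |θ.im| :=
    Real.exp_le_exp.2 (by simpa using neg_le_abs θ.im)
  have h2 : Real.exp (-θ * Complex.I).re ≤ Real.exp |θ.im| :=
    Real.exp_le_exp.2 (by simpa using le_abs_self θ.im)
  linarith

theorem norm_rot_mulVec_le (θ : ℂ) (v : Fin 2 → ℂ) :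
    ‖rot θ *ᵥ v‖ ≤ 2 * Real.exp |θ.im| * ‖v‖ := by
  have hc := norm_cos_le θ
  have hs := norm_sin_le θ
  have h0 := norm_le_pi_norm v 0
  have h1 := norm_le_pi_norm v 1
  rw [rot_mulVec, pi_norm_le_iff_of_nonneg (by positivity)]
  have key : ∀ a b : ℂ, ‖a‖ ≤ Real.exp |θ.im| → ‖b‖ ≤ Real.exp |θ.im| →
      ‖a * v 0‖ + ‖b * v 1‖ ≤ 2 * Real.exp |θ.im| * ‖v‖ := by
    intro a b ha hb
    rw [norm_mul, norm_mul]
    have h2 := mul_le_mul ha h0 (norm_nonneg _) (Real.exp_nonneg _)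
    have h3 := mul_le_mul hb h1 (norm_nonneg _) (Real.exp_nonneg _)
    linarith
  intro i
  fin_cases i
  · exact (norm_sub_le _ _).trans (key _ _ hc hs)
  · exact (norm_add_le _ _).trans (key _ _ hs hc)

theorem differentiableWithinAt_rot_mulVec {S : Set ℂ} {β : ℂ} {θ : ℂ → ℂ} {v : ℂ → Fin 2 → ℂ}
    (hθ : DifferentiableWithinAt ℂ θ S β) (hv : DifferentiableWithinAt ℂ v S β) :
    DifferentiableWithinAt ℂ (fun β => rot (θ β) *ᵥ v β) S β := by
  have hv' := differentiableWithinAt_pi.1 hv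
  rw [differentiableWithinAt_pi]
  intro i
  simp only [rot_mulVec]
  fin_cases i
  · exact (hθ.ccos.mul (hv' 0)).sub (hθ.csin.mul (hv' 1))
  · exact (hθ.csin.mul (hv' 0)).add (hθ.ccos.mul (hv' 1))

theorem continuousWithinAt_rot_mulVec {S : Set ℂ} {β : ℂ} {θ : ℂ → ℂ} {v : ℂ → Fin 2 → ℂ}
    (hθ : ContinuousWithinAt θ S β) (hv : ContinuousWithinAt v S β) :
    ContinuousWithinAt (fun β => rot (θ β) *ᵥ v β) S β := by
  have hv' := continuousWithinAt_pi.1 hv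
  have hc : ContinuousWithinAt (fun β => Complex.cos (θ β)) S β :=
    Complex.continuous_cos.continuousAt.comp_continuousWithinAt hθ
  have hs : ContinuousWithinAt (fun β => Complex.sin (θ β)) S β :=
    Complex.continuous_sin.continuousAt.comp_continuousWithinAt hθ
  rw [continuousWithinAt_pi]
  intro i
  simp only [rot_mulVec]
  fin_cases i
  · exact (hc.mul (hv' 0)).sub (hs.mul (hv' 1))
  · exact (hs.mul (hv' 0)).add (hc.mul (hv' 1))

/-! ### The factorization -/

namespace Bimaterial

variable (m : Bimaterial)

/-- The angle of the rotations `X^±`, for `σ = ±1`. -/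
noncomputable def angle (σ : ℝ) (β : ℂ) : ℂ := -(m.eps : ℂ) * Complex.log (-(σ * Complex.I) * β)

theorem XPlus_eq (β : ℂ) : m.XPlus β = (m.d0 : ℂ) • rot (m.angle 1 β) := by
  simp [XPlus, rot, angle, BPlus]

theorem XMinus_eq (β : ℂ) : m.XMinus β = (m.d0 : ℂ)⁻¹ • rot (m.angle (-1) β) := by
  simp [XMinus, rot, angle, BMinus]

theorem differentiableAt_angle {σ : ℝ} (hσ : σ ≠ 0) {β : ℂ} (hβ : β ∈ halfBar σ) :
    DifferentiableAt ℂ (m.angle σ) β :=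
  (differentiableAt_log_halfBar hσ hβ).const_mul _

theorem abs_im_angle_le (σ : ℝ) (β : ℂ) : |(m.angle σ β).im| ≤ |m.eps| * Real.pi := by
  rw [angle, ← Complex.ofReal_neg, Complex.im_ofReal_mul, abs_mul, abs_neg, Complex.log_im]
  exact mul_le_mul_of_nonneg_left (Complex.abs_arg_le_pi _) (abs_nonneg _)

theorem inv_smul_rot {c : ℂ} (hc : c ≠ 0) (θ : ℂ) : (c • rot θ)⁻¹ = c⁻¹ • rot (-θ) := by
  refine Matrix.inv_eq_right_inv ?_
  rw [smul_mul_smul_comm, rot_mul, add_neg_cancel, rot_zero, mul_inv_cancel₀ hc, one_smul]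

theorem angle_sub_angle {x : ℝ} (hx : x ≠ 0) :
    m.angle 1 x - m.angle (-1) x = (SignType.sign x : ℝ) * (Real.pi * m.eps : ℝ) * Complex.I := by
  have h1 : ∀ σ : ℝ, Complex.log (-(σ * Complex.I) * x) =
      halfLog σ x - σ * Complex.I * (Real.pi / 2) := fun σ => by simp [halfLog]
  simp only [angle, h1]
  rcases hx.lt_or_gt with h | h
  · rw [halfLog_of_neg (Or.inl rfl) h, halfLog_of_neg (Or.inr rfl) h, sign_neg h]
    simp
    ring
  · rw [halfLog_of_pos (Or.inl rfl) h, halfLog_of_pos (Or.inr rfl) h, sign_pos h]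
    simp
    ring

/-- On the real axis `X⁺ (X⁻)⁻¹ = G`: the angles differ by `± iπε`, and `d₀² cosh πε = 1`,
`d₀² sinh πε = d_*`. -/
theorem XPlus_mul_XMinus_inv {x : ℝ} (hx : x ≠ 0) :
    m.XPlus x * (m.XMinus x)⁻¹ = m.G x := by
  have hc : (m.d0 : ℂ) ^ 2 * Complex.cosh (Real.pi * m.eps : ℝ) = 1 := by
    rw [← Complex.ofReal_cosh]; exact_mod_cast m.d0_sq_mul_cosh
  have hs : (m.d0 : ℂ) ^ 2 * Complex.sinh (Real.pi * m.eps : ℝ) = m.dStar := by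
    have h : m.d0 ^ 2 * Real.sinh (Real.pi * m.eps) = m.dStar := by
      rw [← m.dStar_mul_cosh]
      linear_combination m.dStar * m.d0_sq_mul_cosh
    rw [← Complex.ofReal_sinh]; exact_mod_cast h
  rw [XPlus_eq, XMinus_eq, inv_smul_rot (inv_ne_zero m.d0_ne_zero), smul_mul_smul_comm, rot_mul,
    ← sub_eq_add_neg, m.angle_sub_angle hx, inv_inv, ← pow_two]
  rcases hx.lt_or_gt with h | h
  · rw [sign_neg h]
    have e : (((SignType.neg : SignType) : ℝ) : ℂ) * (Real.pi * m.eps : ℝ) * Complex.I =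
        -((Real.pi * m.eps : ℝ) * Complex.I) := by simp
    ext i j
    rw [show (-1 : SignType) = SignType.neg from rfl, e]
    fin_cases i <;> fin_cases j <;>
      simp only [rot, G, sign_neg h, Matrix.smul_apply, Fin.zero_eta, Fin.mk_one, Fin.isValue,
        Matrix.of_apply, Matrix.cons_val', Matrix.cons_val_zero, Matrix.cons_val_one,
        Matrix.cons_val_fin_one, Complex.cos_neg, Complex.sin_neg, Complex.cos_mul_I,
        Complex.sin_mul_I, smul_eq_mul, hc, SignType.coe_neg_one, Complex.ofReal_neg,
        Complex.ofReal_one]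
    · linear_combination Complex.I * hs
    · linear_combination -Complex.I * hs
  · rw [sign_pos h]
    have e : (((SignType.pos : SignType) : ℝ) : ℂ) * (Real.pi * m.eps : ℝ) * Complex.I =
        (Real.pi * m.eps : ℝ) * Complex.I := by simp
    ext i j
    rw [show (1 : SignType) = SignType.pos from rfl, e]
    fin_cases i <;> fin_cases j <;>
      simp only [rot, G, sign_pos h, Matrix.smul_apply, Fin.zero_eta, Fin.mk_one, Fin.isValue,
        Matrix.of_apply, Matrix.cons_val', Matrix.cons_val_zero, Matrix.cons_val_one,
        Matrix.cons_val_fin_one, Complex.cos_mul_I,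
        Complex.sin_mul_I, smul_eq_mul, hc, SignType.coe_one,
        Complex.ofReal_one]
    · linear_combination -Complex.I * hs
    · linear_combination Complex.I * hs

theorem powPlus_mul_powMinus {x : ℝ} (hx : x ≠ 0) :
    powPlus x (1 / 2) * powMinus x (1 / 2) = (|x| : ℝ) := by
  rw [powPlus_eq, powMinus_eq, ← Complex.exp_add]
  rcases hx.lt_or_gt with h | h
  · rw [halfLog_of_neg (Or.inl rfl) h, halfLog_of_neg (Or.inr rfl) h, abs_of_neg h]
    have : (1 / 2 : ℂ) * (Real.log (-x) + (1 : ℝ) * Complex.I * Real.pi) +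
        1 / 2 * (Real.log (-x) + (-1 : ℝ) * Complex.I * Real.pi) = Real.log (-x) := by
      push_cast; ring
    rw [this, ← Complex.ofReal_exp, Real.exp_log (by linarith)]
  · rw [halfLog_of_pos (Or.inl rfl) h, halfLog_of_pos (Or.inr rfl) h, abs_of_pos h, ← add_mul]
    norm_num
    rw [← Complex.ofReal_exp, Real.exp_log h]

theorem factorization {x : ℝ} (hx : x ≠ 0) :
    (-((m.b : ℂ) / (|x| : ℝ))) • m.G x =
      (-((m.b : ℂ) / (powPlus x (1 / 2) * powMinus x (1 / 2)))) •
        (m.XPlus x * (m.XMinus x)⁻¹) := by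
  rw [powPlus_mul_powMinus hx, m.XPlus_mul_XMinus_inv hx]

theorem isUnit_det_XPlus (β : ℂ) : IsUnit (m.XPlus β).det := by
  rw [XPlus_eq, Matrix.det_smul, det_rot]
  simpa using m.d0_ne_zero

theorem isUnit_det_XMinus (β : ℂ) : IsUnit (m.XMinus β).det := by
  rw [XMinus_eq, Matrix.det_smul, det_rot]
  simpa using m.d0_ne_zero

theorem differentiableAt_rot_angle {σ : ℝ} (hσ : σ ≠ 0) {β : ℂ} (hβ : β ∈ halfBar σ)
    (c : ℂ) (i j : Fin 2) : DifferentiableAt ℂ (fun β => (c • rot (m.angle σ β)) i j) β := by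
  have h := m.differentiableAt_angle hσ hβ
  fin_cases i <;> fin_cases j
  exacts [h.ccos.const_mul c, h.csin.neg.const_mul c, h.csin.const_mul c, h.ccos.const_mul c]

theorem CPlus_subset : CPlus ⊆ CPlusBar := fun β hβ =>
  ⟨le_of_lt hβ, fun h => by simp [CPlus, h] at hβ⟩

theorem CMinus_subset : CMinus ⊆ CMinusBar := fun β hβ =>
  ⟨le_of_lt hβ, fun h => by simp [CMinus, h] at hβ⟩

theorem differentiableAt_XPlus {β : ℂ} (hβ : β ∈ CPlusBar) (i j : Fin 2) :
    DifferentiableAt ℂ (fun β => m.XPlus β i j) β := by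
  simp only [XPlus_eq]
  exact m.differentiableAt_rot_angle one_ne_zero (halfBar_one ▸ hβ) _ i j

theorem differentiableAt_XMinus {β : ℂ} (hβ : β ∈ CMinusBar) (i j : Fin 2) :
    DifferentiableAt ℂ (fun β => m.XMinus β i j) β := by
  simp only [XMinus_eq]
  exact m.differentiableAt_rot_angle (by norm_num) (halfBar_neg_one ▸ hβ) _ i j

end Bimaterial

/-! ### The solutions of the Wiener-Hopf problem -/

namespace Bimaterial

variable (m : Bimaterial)

/-- The field `v` multiplied by `c β^t` and by the rotation through `s` times the angle of `X^±`. -/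
noncomputable def twist (σ t : ℝ) (c : ℂ) (s : ℝ) (v : ℂ → Fin 2 → ℂ) (β : ℂ) : Fin 2 → ℂ :=
  (c * Complex.exp (t * halfLog σ β)) • (rot (s * m.angle σ β) *ᵥ v β)

variable {m}

theorem twist_twist {c : ℂ} (hc : c ≠ 0) (σ t s : ℝ) (v : ℂ → Fin 2 → ℂ) (β : ℂ) :
    m.twist σ (-t) c⁻¹ (-s) (m.twist σ t c s v) β = v β := by
  have h1 : (((-s : ℝ) : ℂ) * m.angle σ β + s * m.angle σ β) = 0 := by push_cast; ring
  have h2 : (((-t : ℝ) : ℂ) * halfLog σ β) = -(t * halfLog σ β) := by push_cast; ring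
  simp only [twist, Matrix.mulVec_smul, smul_smul, Matrix.mulVec_mulVec, rot_mul, h1, rot_zero,
    Matrix.one_mulVec, h2, Complex.exp_neg]
  have := Complex.exp_ne_zero (t * halfLog σ β)
  have e : c⁻¹ * (Complex.exp (t * halfLog σ β))⁻¹ * (c * Complex.exp (t * halfLog σ β)) = 1 := by
    field_simp
  rw [e, one_smul]

theorem differentiableWithinAt_twist {σ : ℝ} (hσ : σ ≠ 0) {β : ℂ} (hβ : β ∈ halfBar σ) {S : Set ℂ}
    {v : ℂ → Fin 2 → ℂ} (hv : DifferentiableWithinAt ℂ v S β) (t : ℝ) (c : ℂ) (s : ℝ) :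
    DifferentiableWithinAt ℂ (m.twist σ t c s v) S β := by
  have h1 := (differentiableAt_halfLog hσ hβ).differentiableWithinAt (s := S)
  have h2 := (m.differentiableAt_angle hσ hβ).differentiableWithinAt (s := S)
  exact ((h1.const_mul _).cexp.const_mul c).smul
    (differentiableWithinAt_rot_mulVec (h2.const_mul _) hv)

theorem continuousWithinAt_twist {σ : ℝ} (hσ : σ ≠ 0) {β : ℂ} (hβ : β ∈ halfBar σ) {S : Set ℂ}
    {v : ℂ → Fin 2 → ℂ} (hv : ContinuousWithinAt v S β) (t : ℝ) (c : ℂ) (s : ℝ) :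
    ContinuousWithinAt (m.twist σ t c s v) S β := by
  have h1 := (differentiableAt_halfLog hσ hβ).continuousAt.continuousWithinAt (s := S)
  have h2 := (m.differentiableAt_angle hσ hβ).continuousAt.continuousWithinAt (s := S)
  exact (continuousWithinAt_const.mul (Complex.continuous_exp.continuousAt.comp_continuousWithinAt
    (continuousWithinAt_const.mul h1))).smul
    (continuousWithinAt_rot_mulVec (continuousWithinAt_const.mul h2) hv)

/-- The rotation does not change the order of growth, since the imaginary part of its angle is
bounded. -/
theorem isBigO_twist {σ : ℝ} (hσ : σ = 1 ∨ σ = -1) {l : Filter ℂ} (hl : ∀ᶠ β in l, β ≠ 0)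
    {v : ℂ → Fin 2 → ℂ} {r : ℝ} (hv : v =O[l] fun β => ‖β‖ ^ r) (t : ℝ) (c : ℂ) (s : ℝ) :
    m.twist σ t c s v =O[l] fun β => ‖β‖ ^ (t + r) := by
  obtain ⟨C, hC⟩ := hv.bound
  refine Asymptotics.IsBigO.of_bound
    (‖c‖ * (2 * Real.exp (|s| * (|m.eps| * Real.pi)) * C)) ?_
  filter_upwards [hl, hC] with β hβ hb
  have hr := norm_rot_mulVec_le (s * m.angle σ β) (v β)
  have hi : |((s : ℂ) * m.angle σ β).im| ≤ |s| * (|m.eps| * Real.pi) := by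
    rw [Complex.im_ofReal_mul, abs_mul]
    exact mul_le_mul_of_nonneg_left (m.abs_im_angle_le σ β) (abs_nonneg _)
  have hn : 0 < ‖β‖ := norm_pos_iff.2 hβ
  rw [Real.norm_of_nonneg (by positivity)] at hb ⊢
  rw [twist, norm_smul, norm_mul, norm_exp_mul_halfLog hσ hβ, Real.rpow_add hn]
  calc ‖c‖ * ‖β‖ ^ t * ‖rot (s * m.angle σ β) *ᵥ v β‖
      ≤ ‖c‖ * ‖β‖ ^ t * (2 * Real.exp (|s| * (|m.eps| * Real.pi)) * (C * ‖β‖ ^ r)) := by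
        refine mul_le_mul_of_nonneg_left (hr.trans ?_) (by positivity)
        refine mul_le_mul ?_ hb (norm_nonneg _) (by positivity)
        exact mul_le_mul_of_nonneg_left (Real.exp_le_exp.2 hi) two_pos.le
    _ = _ := by ring

variable (m)

theorem whPlus_eq_twist (e : Fin 2 → ℂ) :
    m.whPlus e = m.twist 1 (-(1 / 2)) m.d0 1 fun _ => e := by
  funext β
  rw [whPlus, XPlus_eq, powPlus_eq, Matrix.smul_mulVec, smul_smul, twist, one_div,
    ← Complex.exp_neg, mul_comm]
  simp

theorem whMinus_eq_twist (e : Fin 2 → ℂ) :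
    m.whMinus e = m.twist (-1) (1 / 2) (-((m.b : ℂ)⁻¹ * (m.d0 : ℂ)⁻¹)) 1 fun _ => e := by
  funext β
  rw [whMinus, XMinus_eq, powMinus_eq, Matrix.smul_mulVec, smul_smul, twist]
  congr 1
  · push_cast
    ring
  · simp

theorem eventually_ne_zero_cobounded : ∀ᶠ β in Bornology.cobounded ℂ, β ≠ 0 :=
  Bornology.isBounded_def.1 (Bornology.isBounded_singleton (x := (0 : ℂ)))

theorem whEquation (e : Fin 2 → ℂ) {x : ℝ} (hx : x ≠ 0) :
    m.whPlus e x = (-((m.b : ℂ) / (|x| : ℝ))) • (m.G x *ᵥ m.whMinus e x) := by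
  rw [← Matrix.smul_mulVec, m.factorization hx, whPlus, whMinus, Matrix.smul_mulVec,
    Matrix.mulVec_smul, Matrix.mulVec_mulVec, Matrix.mul_assoc,
    Matrix.nonsing_inv_mul _ (m.isUnit_det_XMinus _), Matrix.mul_one, smul_smul]
  congr 1
  have h1 := m.b_ne_zero
  have h2 : powPlus x (1 / 2) ≠ 0 := Complex.exp_ne_zero _
  have h3 : powMinus x (1 / 2) ≠ 0 := Complex.exp_ne_zero _
  field_simp

theorem isWienerHopfSolution_wh (e : Fin 2 → ℂ) :
    m.IsWienerHopfSolution (m.whPlus e) (m.whMinus e) := by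
  have hc : ∀ l : Filter ℂ, (fun _ : ℂ => e) =O[l] fun β => ‖β‖ ^ (0 : ℝ) := fun l => by
    simpa using Asymptotics.isBigO_const_const e (one_ne_zero (α := ℝ)) l
  have hP : ∀ β ∈ CPlus, β ≠ 0 := fun β hβ => (CPlus_subset hβ).2
  have hM : ∀ β ∈ CMinus, β ≠ 0 := fun β hβ => (CMinus_subset hβ).2
  refine ⟨fun β hβ => ?_, fun β hβ => ?_, fun β hβ => ?_, fun β hβ => ?_,
    fun β hβ => m.whEquation e hβ, ?_, ?_, ?_, ?_⟩
  · rw [whPlus_eq_twist]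
    exact differentiableWithinAt_twist one_ne_zero (halfBar_one ▸ CPlus_subset hβ)
      (differentiableWithinAt_const _) _ _ _
  · rw [whMinus_eq_twist]
    exact differentiableWithinAt_twist (by norm_num) (halfBar_neg_one ▸ CMinus_subset hβ)
      (differentiableWithinAt_const _) _ _ _
  · rw [whPlus_eq_twist]
    exact continuousWithinAt_twist one_ne_zero (halfBar_one ▸ hβ) continuousWithinAt_const _ _ _
  · rw [whMinus_eq_twist]
    exact continuousWithinAt_twist (by norm_num) (halfBar_neg_one ▸ hβ)
      continuousWithinAt_const _ _ _
  · rw [whPlus_eq_twist]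
    simpa using isBigO_twist (m := m) (Or.inl rfl)
      (eventually_ne_zero_cobounded.filter_mono inf_le_left) (hc _) (-(1 / 2)) m.d0 1
  · rw [whMinus_eq_twist]
    simpa using isBigO_twist (m := m) (Or.inr rfl)
      (eventually_ne_zero_cobounded.filter_mono inf_le_left) (hc _) (1 / 2) _ 1
  · rw [whPlus_eq_twist]
    simpa using isBigO_twist (m := m) (Or.inl rfl)
      (eventually_nhdsWithin_of_forall hP) (hc _) (-(1 / 2)) m.d0 1
  · rw [whMinus_eq_twist]
    simpa using isBigO_twist (m := m) (Or.inr rfl)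
      (eventually_nhdsWithin_of_forall hM) (hc _) (1 / 2) _ 1

variable {m}

/-- Only the values on the closed half-planes without the origin matter. -/
theorem IsWienerHopfSolution.congr {Φp Φm Ψp Ψm : ℂ → Fin 2 → ℂ}
    (h : m.IsWienerHopfSolution Ψp Ψm) (hp : ∀ β ∈ CPlusBar, Φp β = Ψp β)
    (hm : ∀ β ∈ CMinusBar, Φm β = Ψm β) : m.IsWienerHopfSolution Φp Φm where
  analyticPlus := h.analyticPlus.congr fun β hβ => hp β (CPlus_subset hβ)
  analyticMinus := h.analyticMinus.congr fun β hβ => hm β (CMinus_subset hβ)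
  continuousPlus := h.continuousPlus.congr hp
  continuousMinus := h.continuousMinus.congr hm
  equation β hβ := by
    have hβ' : (β : ℂ) ≠ 0 := Complex.ofReal_ne_zero.2 hβ
    rw [hp β ⟨by simp, hβ'⟩, hm β ⟨by simp, hβ'⟩]
    exact h.equation β hβ
  plusAtInfinity := h.plusAtInfinity.congr'
    (eventually_inf_principal.2 (Eventually.of_forall fun β hβ => (hp β (CPlus_subset hβ)).symm))
    EventuallyEq.rfl
  minusAtInfinity := h.minusAtInfinity.congr'
    (eventually_inf_principal.2 (Eventually.of_forall fun β hβ => (hm β (CMinus_subset hβ)).symm))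
    EventuallyEq.rfl
  plusAtZero := h.plusAtZero.congr'
    (eventually_nhdsWithin_of_forall fun β hβ => (hp β (CPlus_subset hβ)).symm) EventuallyEq.rfl
  minusAtZero := h.minusAtZero.congr'
    (eventually_nhdsWithin_of_forall fun β hβ => (hm β (CMinus_subset hβ)).symm) EventuallyEq.rfl

theorem eq_of_whPlus_eq {e e' : Fin 2 → ℂ} {β : ℂ} (h : m.whPlus e β = m.whPlus e' β) :
    e = e' := by
  rw [whPlus_eq_twist, whPlus_eq_twist] at h
  have h1 := twist_twist (m := m) m.d0_ne_zero 1 (-(1 / 2)) 1 (fun _ => e) β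
  have h2 := twist_twist (m := m) m.d0_ne_zero 1 (-(1 / 2)) 1 (fun _ => e') β
  rw [← h1, ← h2]
  conv_lhs => rw [twist, h]
  rfl

/-- Every solution is of the explicit form: `β₊^{1/2} (X⁺)⁻¹ Φ⁺` and `-b β₋^{-1/2} (X⁻)⁻¹ Φ⁻`
continue each other across the real axis to a bounded function on `ℂ \ {0}`, which is constant. -/
theorem IsWienerHopfSolution.exists_eq {Φp Φm : ℂ → Fin 2 → ℂ}
    (h : m.IsWienerHopfSolution Φp Φm) : ∃ e : Fin 2 → ℂ,
      (∀ β ∈ CPlusBar, Φp β = m.whPlus e β) ∧ ∀ β ∈ CMinusBar, Φm β = m.whMinus e β := by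
  obtain ⟨cm, hcm⟩ : ∃ cm : ℂ, cm = -((m.b : ℂ)⁻¹ * (m.d0 : ℂ)⁻¹) := ⟨_, rfl⟩
  have hcm0 : cm ≠ 0 := hcm ▸ neg_ne_zero.2 (mul_ne_zero (inv_ne_zero m.b_ne_zero)
    (inv_ne_zero m.d0_ne_zero))
  -- `F` and `H` are `Φ⁺` and `Φ⁻` divided by the factors of the explicit solutions
  obtain ⟨F, hF⟩ : ∃ F, F = m.twist 1 (1 / 2) (m.d0 : ℂ)⁻¹ (-1) Φp := ⟨_, rfl⟩
  obtain ⟨H, hH⟩ : ∃ H, H = m.twist (-1) (-(1 / 2)) cm⁻¹ (-1) Φm := ⟨_, rfl⟩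
  have hFinv : ∀ β, m.twist 1 (-(1 / 2)) m.d0 1 F β = Φp β := fun β => by
    have := twist_twist (m := m) (inv_ne_zero m.d0_ne_zero) 1 (1 / 2) (-1) Φp β
    rwa [inv_inv, neg_neg, ← hF] at this
  have hHinv : ∀ β, m.twist (-1) (1 / 2) cm 1 H β = Φm β := fun β => by
    have := twist_twist (m := m) (inv_ne_zero hcm0) (-1) (-(1 / 2)) (-1) Φm β
    rwa [inv_inv, neg_neg, neg_neg, ← hH] at this
  -- the equation on the real axis says that the two functions agree there
  have hreal : ∀ β : ℂ, β.im = 0 → β ≠ 0 → F β = H β := by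
    intro β him hβ
    obtain ⟨x, rfl⟩ : ∃ x : ℝ, (x : ℂ) = β := ⟨β.re, Complex.ext (by simp) (by simp [him])⟩
    have hx : x ≠ 0 := fun h => hβ (by simp [h])
    have h1 : Φm x = m.whMinus (H x) x := by
      rw [whMinus_eq_twist, ← hHinv x, hcm, twist, twist]
    have h2 : Φp x = m.whPlus (H x) x := by
      rw [h.equation x hx, m.whEquation _ hx, h1]
    have h3 : Φp x = m.whPlus (F x) x := by
      rw [whPlus_eq_twist, ← hFinv x, twist, twist]
    exact eq_of_whPlus_eq (h3.symm.trans h2)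
  classical
  set f : ℂ → Fin 2 → ℂ := fun β => if 0 ≤ β.im then F β else H β with hf
  have hfP : ∀ β ∈ CPlusBar, f β = F β := fun β hβ => if_pos hβ.1
  have hfM : ∀ β ∈ CMinusBar, f β = H β := fun β hβ => by
    by_cases h0 : 0 ≤ β.im
    · rw [hf]; simp only [h0, if_true]
      exact hreal β (le_antisymm hβ.1 h0) hβ.2
    · exact if_neg h0
  have hunion : ({0}ᶜ : Set ℂ) = CPlusBar ∪ CMinusBar := by
    ext β
    simp only [CPlusBar, CMinusBar, Set.mem_compl_iff, Set.mem_singleton_iff, Set.mem_union,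
      Set.mem_ofPred_eq, ← or_and_right]
    exact ⟨fun h => ⟨le_total _ _, h⟩, fun h => h.2⟩
  have hclP : ∀ β : ℂ, β ≠ 0 → β ∉ CPlusBar → β ∉ closure CPlusBar := fun β hβ hn hcl => by
    have h1 : closure CPlusBar ⊆ {β : ℂ | 0 ≤ β.im} :=
      closure_minimal (fun z hz => hz.1) (isClosed_le continuous_const Complex.continuous_im)
    exact hn ⟨h1 hcl, hβ⟩
  have hclM : ∀ β : ℂ, β ≠ 0 → β ∉ CMinusBar → β ∉ closure CMinusBar := fun β hβ hn hcl => by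
    have h1 : closure CMinusBar ⊆ {β : ℂ | β.im ≤ 0} :=
      closure_minimal (fun z hz => hz.1) (isClosed_le Complex.continuous_im continuous_const)
    exact hn ⟨h1 hcl, hβ⟩
  have hcont : ContinuousOn f {0}ᶜ := by
    intro β hβ
    rw [hunion]
    refine ContinuousWithinAt.union ?_ ?_
    · by_cases hP : β ∈ CPlusBar
      · have hw : ContinuousWithinAt F CPlusBar β := hF ▸ continuousWithinAt_twist one_ne_zero
          (halfBar_one ▸ hP) (h.continuousPlus β hP) _ _ _
        exact hw.congr hfP (hfP β hP)
      · exact continuousWithinAt_of_notMem_closure (hclP β hβ hP)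
    · by_cases hM : β ∈ CMinusBar
      · have hw : ContinuousWithinAt H CMinusBar β := hH ▸ continuousWithinAt_twist (by norm_num)
          (halfBar_neg_one ▸ hM) (h.continuousMinus β hM) _ _ _
        exact hw.congr hfM (hfM β hM)
      · exact continuousWithinAt_of_notMem_closure (hclM β hβ hM)
  have hoP : IsOpen CPlus := isOpen_lt continuous_const Complex.continuous_im
  have hoM : IsOpen CMinus := isOpen_lt Complex.continuous_im continuous_const
  have hdiff : ∀ β : ℂ, β.im ≠ 0 → DifferentiableAt ℂ f β := by
    intro β hβ
    rcases hβ.lt_or_gt with hlt | hgt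
    · have hd : DifferentiableWithinAt ℂ H CMinus β :=
        hH ▸ differentiableWithinAt_twist (by norm_num)
          (halfBar_neg_one ▸ CMinus_subset hlt) (h.analyticMinus β hlt) _ _ _
      refine (hd.differentiableAt (hoM.mem_nhds hlt)).congr_of_eventuallyEq ?_
      filter_upwards [hoM.mem_nhds hlt] with z hz using hfM z (CMinus_subset hz)
    · have hd : DifferentiableWithinAt ℂ F CPlus β :=
        hF ▸ differentiableWithinAt_twist one_ne_zero
          (halfBar_one ▸ CPlus_subset hgt) (h.analyticPlus β hgt) _ _ _
      refine (hd.differentiableAt (hoP.mem_nhds hgt)).congr_of_eventuallyEq ?_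
      filter_upwards [hoP.mem_nhds hgt] with z hz using hfP z (CPlus_subset hz)
  have hoff : {w : ℂ | w.im ≠ 0} = CPlus ∪ CMinus := by
    ext β
    simp only [CPlus, CMinus, Set.mem_ofPred_eq, Set.mem_union]
    rw [or_comm]; exact ne_iff_lt_or_gt
  have hbdd : ∀ l : Filter ℂ, (∀ᶠ β in l, β ∈ CPlus ∪ CMinus) →
      (Φp =O[l ⊓ 𝓟 CPlus] fun β => ‖β‖ ^ (-(1 / 2) : ℝ)) →
      (Φm =O[l ⊓ 𝓟 CMinus] fun β => ‖β‖ ^ (1 / 2 : ℝ)) → f =O[l] fun _ => (1 : ℝ) := by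
    intro l hl hp hm
    have hsplit : l = l ⊓ 𝓟 CPlus ⊔ l ⊓ 𝓟 CMinus := by
      rw [← inf_sup_left, sup_principal, left_eq_inf, le_principal_iff]
      exact hl
    rw [hsplit]
    refine Asymptotics.IsBigO.sup ?_ ?_
    · have hO := isBigO_twist (m := m) (σ := 1) (Or.inl rfl) (eventually_inf_principal.2
        (Eventually.of_forall fun β hβ => (CPlus_subset hβ).2)) hp (1 / 2) (m.d0 : ℂ)⁻¹ (-1)
      simp only [add_neg_cancel, Real.rpow_zero] at hO
      refine hO.congr' ?_ EventuallyEq.rfl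
      refine eventually_inf_principal.2 (Eventually.of_forall fun β hβ => ?_)
      rw [hfP β (CPlus_subset hβ), hF]
    · have hO := isBigO_twist (m := m) (σ := -1) (Or.inr rfl) (eventually_inf_principal.2
        (Eventually.of_forall fun β hβ => (CMinus_subset hβ).2)) hm (-(1 / 2)) cm⁻¹ (-1)
      simp only [neg_add_cancel, Real.rpow_zero] at hO
      refine hO.congr' ?_ EventuallyEq.rfl
      refine eventually_inf_principal.2 (Eventually.of_forall fun β hβ => ?_)
      rw [hfM β (CMinus_subset hβ), hH]
  obtain ⟨e, he⟩ := exists_eq_const_of_differentiableAt_off_real hcont hdiff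
    (by
      rw [hoff]
      refine hbdd _ self_mem_nhdsWithin ?_ ?_
      · exact h.plusAtZero.mono (by rw [nhdsWithin]; exact inf_le_inf_right _ inf_le_left)
      · exact h.minusAtZero.mono (by rw [nhdsWithin]; exact inf_le_inf_right _ inf_le_left))
    (by
      rw [hoff]
      refine hbdd _ (mem_inf_of_right (mem_principal_self _)) ?_ ?_
      · exact h.plusAtInfinity.mono (inf_le_inf_right _ inf_le_left)
      · exact h.minusAtInfinity.mono (inf_le_inf_right _ inf_le_left))
  refine ⟨e, fun β hβ => ?_, fun β hβ => ?_⟩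
  · rw [whPlus_eq_twist, ← hFinv β, twist, twist, ← he β hβ.2, hfP β hβ]
  · rw [whMinus_eq_twist, ← hHinv β, hcm, twist, twist, ← he β hβ.2, hfM β hβ]

variable (m)

theorem isWienerHopfSolution_iff (Φp Φm : ℂ → Fin 2 → ℂ) :
    m.IsWienerHopfSolution Φp Φm ↔ ∃! e : Fin 2 → ℂ,
      (∀ β ∈ CPlusBar, Φp β = m.whPlus e β) ∧ ∀ β ∈ CMinusBar, Φm β = m.whMinus e β := by
  constructor
  · intro h
    obtain ⟨e, he⟩ := h.exists_eq
    have hI : Complex.I ∈ CPlusBar := ⟨by simp, Complex.I_ne_zero⟩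
    exact ⟨e, he, fun e' he' => eq_of_whPlus_eq ((he'.1 _ hI).symm.trans (he.1 _ hI))⟩
  · rintro ⟨e, he, -⟩
    exact (m.isWienerHopfSolution_wh e).congr he.1 he.2

theorem exp_angle_one (β : ℂ) :
    Complex.exp (-m.angle 1 β * Complex.I) = m.e0 * powPlus β (Complex.I * m.eps) := by
  rw [powPlus, e0, Complex.ofReal_exp, ← Complex.exp_add, angle]
  congr 1
  push_cast
  simp only [one_mul]
  linear_combination (-(m.eps * Real.pi / 2 : ℂ)) * Complex.I_mul_I

theorem exp_angle_neg_one (β : ℂ) :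
    Complex.exp (-m.angle (-1) β * Complex.I) = 1 / m.e0 * powMinus β (Complex.I * m.eps) := by
  rw [powMinus, e0, Complex.ofReal_exp, one_div, ← Complex.exp_neg, ← Complex.exp_add, angle]
  congr 1
  push_cast
  simp only [neg_mul, one_mul, neg_neg]
  linear_combination (m.eps * Real.pi / 2 : ℂ) * Complex.I_mul_I

theorem whPlus_single (β : ℂ) (i j : Fin 2) :
    m.whPlus (Pi.single j 1) β i = m.jumpHat β i j := by
  have h1 := m.exp_angle_one β
  have h2 : Complex.exp (m.angle 1 β * Complex.I) =
      1 / m.e0 * powPlus β (-Complex.I * m.eps) := by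
    have e : powPlus β (-Complex.I * m.eps) = (powPlus β (Complex.I * m.eps))⁻¹ := by
      rw [powPlus, powPlus, ← Complex.exp_neg]; congr 1; ring
    rw [e, ← neg_neg (m.angle 1 β * Complex.I), Complex.exp_neg, ← neg_mul, h1, mul_inv, one_div]
  have hp : 1 / powPlus β (1 / 2) = powPlus β (-(1 / 2)) := by
    rw [powPlus, powPlus, one_div, ← Complex.exp_neg]; congr 1; ring
  rw [whPlus, XPlus_eq, Pi.smul_apply, Matrix.mulVec_single_one, hp]
  fin_cases i <;> fin_cases j <;>
    simp [rot, jumpHat, Complex.cos, Complex.sin, h2, h1, ← neg_mul] <;> ring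

theorem whMinus_single (β : ℂ) (i j : Fin 2) :
    m.whMinus (Pi.single j 1) β i = m.tractionHat β i j := by
  have h1 := m.exp_angle_neg_one β
  have h2 : Complex.exp (m.angle (-1) β * Complex.I) =
      m.e0 * powMinus β (-Complex.I * m.eps) := by
    have e : powMinus β (-Complex.I * m.eps) = (powMinus β (Complex.I * m.eps))⁻¹ := by
      rw [powMinus, powMinus, ← Complex.exp_neg]; congr 1; ring
    rw [e, ← neg_neg (m.angle (-1) β * Complex.I), Complex.exp_neg, ← neg_mul, h1, mul_inv, one_div,
      inv_inv]
  rw [whMinus, XMinus_eq, Pi.smul_apply, Matrix.mulVec_single_one]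
  fin_cases i <;> fin_cases j <;>
    simp [rot, tractionHat, Complex.cos, Complex.sin, h2, h1, ← neg_mul] <;> ring

end Bimaterial

/-! ### Partial derivatives -/

/-- `f` is differentiable at `p` with partial derivatives `a` and `b`. -/
structure HasPd (f : ℝ × ℝ → ℂ) (a b : ℂ) (p : ℝ × ℝ) : Prop where
  diff : DifferentiableAt ℝ f p
  pd_zero : pd 0 f p = a
  pd_one : pd 1 f p = b

namespace HasPd

variable {f g : ℝ × ℝ → ℂ} {a b c d : ℂ} {p : ℝ × ℝ}

theorem of_hasFDerivAt {L : ℝ × ℝ →L[ℝ] ℂ} (h : HasFDerivAt f L p) (h0 : L (1, 0) = a)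
    (h1 : L (0, 1) = b) : HasPd f a b p :=
  ⟨h.differentiableAt, by simpa [pd, h.fderiv] using h0, by simpa [pd, h.fderiv] using h1⟩

theorem self (h : DifferentiableAt ℝ f p) : HasPd f (pd 0 f p) (pd 1 f p) p := ⟨h, rfl, rfl⟩

theorem congr_val (h : HasPd f a b p) (h0 : a = c) (h1 : b = d) : HasPd f c d p := by
  subst h0 h1; exact h

theorem add (hf : HasPd f a b p) (hg : HasPd g c d p) :
    HasPd (fun q => f q + g q) (a + c) (b + d) p :=
  of_hasFDerivAt (hf.diff.hasFDerivAt.add hg.diff.hasFDerivAt)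
    (by rw [← hf.pd_zero, ← hg.pd_zero]; rfl) (by rw [← hf.pd_one, ← hg.pd_one]; rfl)

theorem mul (hf : HasPd f a b p) (hg : HasPd g c d p) :
    HasPd (fun q => f q * g q) (a * g p + f p * c) (b * g p + f p * d) p :=
  of_hasFDerivAt (hf.diff.hasFDerivAt.mul hg.diff.hasFDerivAt)
    (by rw [← hf.pd_zero, ← hg.pd_zero]; simp [pd]; ring)
    (by rw [← hf.pd_one, ← hg.pd_one]; simp [pd]; ring)

theorem const_mul (c : ℂ) (hf : HasPd f a b p) : HasPd (fun q => c * f q) (c * a) (c * b) p :=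
  of_hasFDerivAt (hf.diff.hasFDerivAt.const_mul c)
    (by rw [← hf.pd_zero]; rfl) (by rw [← hf.pd_one]; rfl)

theorem sub (hf : HasPd f a b p) (hg : HasPd g c d p) :
    HasPd (fun q => f q - g q) (a - c) (b - d) p :=
  of_hasFDerivAt (hf.diff.hasFDerivAt.sub hg.diff.hasFDerivAt)
    (by rw [← hf.pd_zero, ← hg.pd_zero]; rfl) (by rw [← hf.pd_one, ← hg.pd_one]; rfl)

theorem congr (hf : HasPd f a b p) (h : g =ᶠ[𝓝 p] f) : HasPd g a b p :=
  of_hasFDerivAt (hf.diff.hasFDerivAt.congr_of_eventuallyEq h) hf.pd_zero hf.pd_one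

/-- Differential of `f` in terms of the partial derivatives. -/
theorem fderiv_apply (hf : HasPd f a b p) (q : ℝ × ℝ) : fderiv ℝ f p q = q.1 * a + q.2 * b := by
  have h : q = q.1 • ((1, 0) : ℝ × ℝ) + q.2 • ((0, 1) : ℝ × ℝ) := by ext <;> simp
  have h0 : fderiv ℝ f p (1, 0) = a := hf.pd_zero
  have h1 : fderiv ℝ f p (0, 1) = b := hf.pd_one
  conv_lhs => rw [h]
  rw [map_add, map_smul, map_smul, h0, h1, Complex.real_smul, Complex.real_smul]

end HasPd

/-! ### Powers of `z` and of its conjugate in a half-plane of the body -/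

/-- The open half-plane `0 < σ x₂`, for `σ = ±1`. -/
def body (σ : ℝ) : Set (ℝ × ℝ) := {p | 0 < σ * p.2}

theorem body_one : body 1 = upperBody := by simp [body, upperBody]

theorem body_neg_one : body (-1) = lowerBody := by simp [body, lowerBody]

theorem isOpen_body (σ : ℝ) : IsOpen (body σ) :=
  isOpen_lt continuous_const (continuous_const.mul continuous_snd)

theorem convex_body (σ : ℝ) : Convex ℝ (body σ) :=
  convex_halfSpace_gt (f := fun p : ℝ × ℝ => σ * p.2)
    ⟨fun a b => by simp [mul_add], fun c a => by simp; ring⟩ 0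

theorem smul_mem_body {σ : ℝ} {p : ℝ × ℝ} (hp : p ∈ body σ) {t : ℝ} (ht : 0 < t) :
    t • p ∈ body σ := by
  have : 0 < t * (σ * p.2) := mul_pos ht hp
  simpa [body, mul_left_comm] using this

/-- `x₁ + τ i x₂`: the complex coordinate for `τ = 1` and its conjugate for `τ = -1`. -/
noncomputable def zc (τ : ℝ) (p : ℝ × ℝ) : ℂ := p.1 + τ * Complex.I * p.2

/-- The power `(x₁ + τ i x₂)^s` in the half-plane `0 < σ x₂`, with the branch that is real on the
positive half-axis. -/
noncomputable def pw (σ τ : ℝ) (s : ℂ) (p : ℝ × ℝ) : ℂ :=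
  Complex.exp (s * halfLog (σ * τ) (zc τ p))

theorem zc_smul (τ t : ℝ) (p : ℝ × ℝ) : zc τ (t • p) = t * zc τ p := by
  simp [zc]; ring

section PowerRules

variable {σ τ : ℝ}

theorem mul_eq_one_or (hσ : σ = 1 ∨ σ = -1) (hτ : τ = 1 ∨ τ = -1) :
    σ * τ = 1 ∨ σ * τ = -1 := by
  rcases hσ with rfl | rfl <;> rcases hτ with rfl | rfl <;> norm_num

theorem zc_mem_halfBar (hτ : τ = 1 ∨ τ = -1) {p : ℝ × ℝ} (hp : p ∈ body σ) :
    zc τ p ∈ halfBar (σ * τ) := by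
  have hττ : τ * τ = 1 := by rcases hτ with rfl | rfl <;> norm_num
  have h : σ * τ * (zc τ p).im = σ * p.2 := by
    simp only [zc, Complex.add_im, Complex.ofReal_im, Complex.mul_im, Complex.mul_re,
      Complex.ofReal_re, Complex.I_re, Complex.I_im]
    linear_combination σ * p.2 * hττ
  have hp' : 0 < σ * p.2 := hp
  refine ⟨h ▸ hp'.le, fun h0 => ?_⟩
  rw [h0, Complex.zero_im, mul_zero] at h
  exact hp'.ne h

theorem ofReal_mem_halfBar (σ : ℝ) {x : ℝ} (hx : x ≠ 0) : (x : ℂ) ∈ halfBar σ :=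
  ⟨by simp, Complex.ofReal_ne_zero.2 hx⟩

theorem zc_real (τ x : ℝ) : zc τ (x, 0) = x := by simp [zc]

theorem hasFDerivAt_zc (τ : ℝ) (p : ℝ × ℝ) : HasFDerivAt (zc τ)
    (Complex.ofRealCLM.comp (ContinuousLinearMap.fst ℝ ℝ ℝ) +
      (τ * Complex.I) • Complex.ofRealCLM.comp (ContinuousLinearMap.snd ℝ ℝ ℝ)) p := by
  have h : zc τ = fun p => (Complex.ofRealCLM.comp (ContinuousLinearMap.fst ℝ ℝ ℝ) +
      (τ * Complex.I) • Complex.ofRealCLM.comp (ContinuousLinearMap.snd ℝ ℝ ℝ)) p := by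
    funext p; simp [zc]
  rw [h]
  exact ContinuousLinearMap.hasFDerivAt _

theorem hasPd_zc (τ : ℝ) (p : ℝ × ℝ) : HasPd (zc τ) 1 (τ * Complex.I) p :=
  HasPd.of_hasFDerivAt (hasFDerivAt_zc τ p) (by simp) (by simp)

theorem pw_add (s t : ℂ) (p : ℝ × ℝ) : pw σ τ (s + t) p = pw σ τ s p * pw σ τ t p := by
  rw [pw, pw, pw, ← Complex.exp_add, add_mul]

theorem zc_mul_pw (hσ : σ = 1 ∨ σ = -1) (hτ : τ = 1 ∨ τ = -1) (s : ℂ) {p : ℝ × ℝ}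
    (hp : zc τ p ≠ 0) : zc τ p * pw σ τ (s - 1) p = pw σ τ s p := by
  have h1 : pw σ τ 1 p = zc τ p := by
    rw [pw, one_mul, exp_halfLog (mul_eq_one_or hσ hτ) hp]
  rw [← h1, ← pw_add]
  congr 1; ring

/-- The power is differentiable up to the boundary of the half-plane, except at the origin. -/
theorem hasFDerivAt_pw (hσ : σ = 1 ∨ σ = -1) (hτ : τ = 1 ∨ τ = -1) (s : ℂ) {p : ℝ × ℝ}
    (hp : zc τ p ∈ halfBar (σ * τ)) : HasFDerivAt (pw σ τ s)
    ((s * pw σ τ (s - 1) p) • (Complex.ofRealCLM.comp (ContinuousLinearMap.fst ℝ ℝ ℝ) +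
      (τ * Complex.I) • Complex.ofRealCLM.comp (ContinuousLinearMap.snd ℝ ℝ ℝ))) p := by
  have h1 := ((hasDerivAt_halfLog (mul_eq_one_or hσ hτ) hp).const_mul s).cexp
  have h2 := h1.comp_hasFDerivAt_of_eq p (hasFDerivAt_zc τ p) rfl
  have e : Complex.exp (s * halfLog (σ * τ) (zc τ p)) * (s * (zc τ p)⁻¹) =
      s * pw σ τ (s - 1) p := by
    have h3 := zc_mul_pw hσ hτ s hp.2
    rw [pw.eq_1 σ τ s] at h3
    rw [← h3]
    have := hp.2
    field_simp
  rw [e] at h2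
  exact h2

theorem hasPd_pw (hσ : σ = 1 ∨ σ = -1) (hτ : τ = 1 ∨ τ = -1) (s : ℂ) {p : ℝ × ℝ}
    (hp : p ∈ body σ) : HasPd (pw σ τ s) (s * pw σ τ (s - 1) p)
      (τ * Complex.I * (s * pw σ τ (s - 1) p)) p :=
  HasPd.of_hasFDerivAt (hasFDerivAt_pw hσ hτ s (zc_mem_halfBar hτ hp)) (by simp)
    (by simp; ring)

theorem continuousAt_pw (hσ : σ = 1 ∨ σ = -1) (hτ : τ = 1 ∨ τ = -1) (s : ℂ) {x : ℝ} (hx : x ≠ 0) :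
    ContinuousAt (pw σ τ s) (x, 0) :=
  (hasFDerivAt_pw hσ hτ s (by rw [zc_real]; exact ofReal_mem_halfBar _ hx)).continuousAt

theorem pw_of_pos (hσ : σ = 1 ∨ σ = -1) (hτ : τ = 1 ∨ τ = -1) (s : ℂ) {x : ℝ} (hx : 0 < x) :
    pw σ τ s (x, 0) = (x : ℂ) ^ s := by
  rw [pw, zc_real, halfLog_of_pos (mul_eq_one_or hσ hτ) hx,
    Complex.cpow_def_of_ne_zero (Complex.ofReal_ne_zero.2 hx.ne'), Complex.ofReal_log hx.le,
    mul_comm]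

theorem pw_of_neg (hσ : σ = 1 ∨ σ = -1) (hτ : τ = 1 ∨ τ = -1) (s : ℂ) {x : ℝ} (hx : x < 0) :
    pw σ τ s (x, 0) = ((-x : ℝ) : ℂ) ^ s * Complex.exp (σ * τ * (Complex.I * Real.pi * s)) := by
  have hx' : 0 < -x := by linarith
  rw [pw, zc_real, halfLog_of_neg (mul_eq_one_or hσ hτ) hx,
    Complex.cpow_def_of_ne_zero (Complex.ofReal_ne_zero.2 hx'.ne'), ← Complex.ofReal_log hx'.le,
    ← Complex.exp_add]
  congr 1
  push_cast
  ring

theorem pw_smul (hσ : σ = 1 ∨ σ = -1) (hτ : τ = 1 ∨ τ = -1) (s : ℂ) {p : ℝ × ℝ}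
    (hp : p ∈ body σ) {t : ℝ} (ht : 0 < t) : pw σ τ s (t • p) = (t : ℂ) ^ s * pw σ τ s p := by
  have hz := (zc_mem_halfBar hτ hp).2
  have h : halfLog (σ * τ) (zc τ (t • p)) = Real.log t + halfLog (σ * τ) (zc τ p) := by
    have hne : -((σ * τ : ℝ) * Complex.I) * zc τ p ≠ 0 := by
      have h1 : ((σ * τ : ℝ) : ℂ) ≠ 0 := by
        rcases mul_eq_one_or hσ hτ with h | h <;> rw [h] <;> simp
      exact mul_ne_zero (neg_ne_zero.2 (mul_ne_zero h1 Complex.I_ne_zero)) hz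
    rw [zc_smul, halfLog, halfLog, mul_left_comm, Complex.log_ofReal_mul ht hne]
    ring
  rw [pw, pw, h, Complex.cpow_def_of_ne_zero (Complex.ofReal_ne_zero.2 ht.ne'),
    ← Complex.ofReal_log ht.le, ← Complex.exp_add]
  congr 1
  ring

end PowerRules

theorem contDiffAt_pw {σ τ : ℝ} (hσ : σ = 1 ∨ σ = -1) (hτ : τ = 1 ∨ τ = -1) (s : ℂ) {p : ℝ × ℝ}
    (hp : p ∈ body σ) : ContDiffAt ℝ 2 (pw σ τ s) p := by
  have hz := zc_mem_halfBar hτ hp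
  have hσ0 : σ * τ ≠ 0 := by rcases mul_eq_one_or hσ hτ with h | h <;> rw [h] <;> norm_num
  have h1 : ContDiffAt ℂ 2 Complex.log (-((σ * τ : ℝ) * Complex.I) * zc τ p) :=
    Complex.contDiffAt_log (mem_slitPlane_of_mem_halfBar hσ0 hz)
  have hzc : ContDiffAt ℝ 2 (zc τ) p := by
    unfold zc
    have h2 : ContDiff ℝ 2 (fun x : ℝ => (x : ℂ)) := Complex.ofRealCLM.contDiff
    exact ((h2.comp contDiff_fst).add (contDiff_const.mul (h2.comp contDiff_snd))).contDiffAt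
  have h2 : ContDiffAt ℝ 2 (fun q => Complex.log (-((σ * τ : ℝ) * Complex.I) * zc τ q)) p :=
    ContDiffAt.comp (g := Complex.log) (f := fun q => -((σ * τ : ℝ) * Complex.I) * zc τ q) p
      (h1.restrict_scalars ℝ) (contDiffAt_const.mul hzc)
  exact (contDiffAt_const.mul (h2.add contDiffAt_const)).cexp

/-! ### Homogeneous Kolosov-Muskhelishvili fields -/

/-- The Kolosov constant `3 - 4ν` of plane strain. -/
noncomputable def Material.kappa (M : Material) : ℝ := 3 - 4 * M.nu

/-- The combination `U₁ + τ i U₂` of the homogeneous displacement field of degree `l` with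
Kolosov-Muskhelishvili potentials proportional to `z^l`, without the customary factor `1 / 2μ`. For
`τ = 1` it is `κ A z^l - l C z z̄^(l-1) - E z̄^l`. As the field is complex, `A` and `C` are
independent; they trade places for `τ = -1`. The coefficient `E` belongs to the second potential. -/
noncomputable def kolDisp (σ τ : ℝ) (κ l A C E : ℂ) (p : ℝ × ℝ) : ℂ :=
  κ * A * pw σ τ l p - l * C * (zc τ p * pw σ (-τ) (l - 1) p) - E * pw σ (-τ) l p

/-- The combination `σ₂₂ - τ i σ₂₁` of the stresses of the field `kolDisp`, up to the factor
`2μl`. -/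
noncomputable def kolTrac (σ τ : ℝ) (l A C E : ℂ) (p : ℝ × ℝ) : ℂ :=
  A * pw σ τ (l - 1) p + C * pw σ (-τ) (l - 1) p +
    (l - 1) * C * (zc τ p * pw σ (-τ) (l - 1 - 1) p) + E * pw σ (-τ) (l - 1) p

/-- The displacement field with `U₁ + i U₂` and `U₁ - i U₂` given by `kolDisp`, with the coefficients
`E` and `F` of the second potential. -/
noncomputable def kolField (σ : ℝ) (κ l A C E F : ℂ) : Disp := fun p =>
  ![1 / 2 * (kolDisp σ 1 κ l A C E p + kolDisp σ (-1) κ l C A F p),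
    -Complex.I / 2 * (kolDisp σ 1 κ l A C E p - kolDisp σ (-1) κ l C A F p)]

section Kolosov

variable {σ : ℝ} (hσ : σ = 1 ∨ σ = -1)

theorem neg_eq_one_or {τ : ℝ} (hτ : τ = 1 ∨ τ = -1) : -τ = 1 ∨ -τ = -1 := by
  rcases hτ with rfl | rfl <;> norm_num

include hσ in
theorem hasPd_kolDisp {τ : ℝ} (hτ : τ = 1 ∨ τ = -1) (κ l A C E : ℂ) {p : ℝ × ℝ}
    (hp : p ∈ body σ) :
    HasPd (kolDisp σ τ κ l A C E)
      (l * (κ * A * pw σ τ (l - 1) p - C * pw σ (-τ) (l - 1) p -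
        (l - 1) * C * (zc τ p * pw σ (-τ) (l - 1 - 1) p) - E * pw σ (-τ) (l - 1) p))
      (τ * Complex.I * l * (κ * A * pw σ τ (l - 1) p - C * pw σ (-τ) (l - 1) p +
        (l - 1) * C * (zc τ p * pw σ (-τ) (l - 1 - 1) p) + E * pw σ (-τ) (l - 1) p)) p := by
  have hτ' := neg_eq_one_or hτ
  have h := (((hasPd_pw hσ hτ l hp).const_mul (κ * A)).sub
    (((hasPd_zc τ p).mul (hasPd_pw hσ hτ' (l - 1) hp)).const_mul (l * C))).sub
      ((hasPd_pw hσ hτ' l hp).const_mul E)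
  refine h.congr_val ?_ ?_
  · ring
  · push_cast
    ring

include hσ in
theorem hasPd_kolTrac {τ : ℝ} (hτ : τ = 1 ∨ τ = -1) (l A C E : ℂ) {p : ℝ × ℝ}
    (hp : p ∈ body σ) :
    HasPd (kolTrac σ τ l A C E)
      ((l - 1) * (A * pw σ τ (l - 1 - 1) p + 2 * C * pw σ (-τ) (l - 1 - 1) p +
        (l - 1 - 1) * C * (zc τ p * pw σ (-τ) (l - 1 - 1 - 1) p) + E * pw σ (-τ) (l - 1 - 1) p))
      (τ * Complex.I * (l - 1) * (A * pw σ τ (l - 1 - 1) p -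
        (l - 1 - 1) * C * (zc τ p * pw σ (-τ) (l - 1 - 1 - 1) p) -
          E * pw σ (-τ) (l - 1 - 1) p)) p := by
  have hτ' := neg_eq_one_or hτ
  have h := ((((hasPd_pw hσ hτ (l - 1) hp).const_mul A).add
    ((hasPd_pw hσ hτ' (l - 1) hp).const_mul C)).add
      (((hasPd_zc τ p).mul (hasPd_pw hσ hτ' (l - 1 - 1) hp)).const_mul ((l - 1) * C))).add
        ((hasPd_pw hσ hτ' (l - 1) hp).const_mul E)
  refine h.congr_val ?_ ?_
  · ring
  · push_cast
    ring

theorem stress_of_hasPd (M : Material) {U : Disp} {p : ℝ × ℝ} {a b c d : ℂ}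
    (h0 : HasPd (fun q => U q 0) a b p) (h1 : HasPd (fun q => U q 1) c d p) :
    stress M U 0 0 p = ((2 * M.mu * M.nu / (1 - 2 * M.nu) : ℝ) : ℂ) * (a + d) + 2 * M.mu * a ∧
    stress M U 0 1 p = M.mu * (b + c) ∧ stress M U 1 0 p = M.mu * (b + c) ∧
    stress M U 1 1 p = ((2 * M.mu * M.nu / (1 - 2 * M.nu) : ℝ) : ℂ) * (a + d) + 2 * M.mu * d := by
  simp only [stress, Fin.sum_univ_two, h0.pd_zero, h0.pd_one, h1.pd_zero, h1.pd_one]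
  refine ⟨?_, ?_, ?_, ?_⟩
  · simp; ring
  · simp [add_comm]
  · simp
  · simp; ring

include hσ in
theorem hasPd_kolField (κ l A C E F : ℂ) {p : ℝ × ℝ} (hp : p ∈ body σ) :
    HasPd (fun q => kolField σ κ l A C E F q 0)
      (1 / 2 * l * ((κ - 1) * (A * pw σ 1 (l - 1) p + C * pw σ (-1) (l - 1) p) -
        (l - 1) * C * (zc 1 p * pw σ (-1) (l - 1 - 1) p) - E * pw σ (-1) (l - 1) p -
        (l - 1) * A * (zc (-1) p * pw σ 1 (l - 1 - 1) p) - F * pw σ 1 (l - 1) p))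
      (Complex.I / 2 * l * ((κ + 1) * (A * pw σ 1 (l - 1) p - C * pw σ (-1) (l - 1) p) +
        (l - 1) * C * (zc 1 p * pw σ (-1) (l - 1 - 1) p) + E * pw σ (-1) (l - 1) p -
        (l - 1) * A * (zc (-1) p * pw σ 1 (l - 1 - 1) p) - F * pw σ 1 (l - 1) p)) p ∧
    HasPd (fun q => kolField σ κ l A C E F q 1)
      (-Complex.I / 2 * l * ((κ + 1) * (A * pw σ 1 (l - 1) p - C * pw σ (-1) (l - 1) p) -
        (l - 1) * C * (zc 1 p * pw σ (-1) (l - 1 - 1) p) - E * pw σ (-1) (l - 1) p +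
        (l - 1) * A * (zc (-1) p * pw σ 1 (l - 1 - 1) p) + F * pw σ 1 (l - 1) p))
      (1 / 2 * l * ((κ - 1) * (A * pw σ 1 (l - 1) p + C * pw σ (-1) (l - 1) p) +
        (l - 1) * C * (zc 1 p * pw σ (-1) (l - 1 - 1) p) + E * pw σ (-1) (l - 1) p +
        (l - 1) * A * (zc (-1) p * pw σ 1 (l - 1 - 1) p) + F * pw σ 1 (l - 1) p)) p := by
  have h1 := hasPd_kolDisp hσ (τ := 1) (Or.inl rfl) κ l A C E hp
  have h2 := hasPd_kolDisp hσ (τ := -1) (Or.inr rfl) κ l C A F hp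
  rw [neg_neg] at h2
  push_cast at h1 h2
  constructor
  · exact ((h1.add h2).const_mul (1 / 2)).congr_val (by ring) (by ring)
  · refine ((h1.sub h2).const_mul (-Complex.I / 2)).congr_val (by ring) ?_
    linear_combination (-(1 / 2) * l * ((κ - 1) * (A * pw σ 1 (l - 1) p + C * pw σ (-1) (l - 1) p) +
        (l - 1) * C * (zc 1 p * pw σ (-1) (l - 1 - 1) p) + E * pw σ (-1) (l - 1) p +
        (l - 1) * A * (zc (-1) p * pw σ 1 (l - 1 - 1) p) + F * pw σ 1 (l - 1) p)) *
        Complex.I_mul_I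

/-- The Lame modulus `λ` in terms of the Kolosov constant: `κ - 1 = 2 (1 - 2ν)`, `3 - κ = 4ν`. -/
theorem Material.lame_mul (M : Material) :
    ((2 * M.mu * M.nu / (1 - 2 * M.nu) : ℝ) : ℂ) * (M.kappa - 1) = M.mu * (3 - M.kappa) := by
  have h : (1 - 2 * M.nu) ≠ 0 := by have := M.nu_lt; linarith
  have h2 : 2 * M.mu * M.nu / (1 - 2 * M.nu) * (M.kappa - 1) = M.mu * (3 - M.kappa) := by
    rw [Material.kappa]
    field_simp
    ring
  exact_mod_cast h2

include hσ in
/-- The stresses of a Kolosov-Muskhelishvili field. -/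
theorem stress_kolField (M : Material) (l A C E F : ℂ) {p : ℝ × ℝ} (hp : p ∈ body σ) :
    stress M (kolField σ M.kappa l A C E F) 0 0 p =
      M.mu * l * (4 * (A * pw σ 1 (l - 1) p + C * pw σ (-1) (l - 1) p) -
        (kolTrac σ 1 l A C E p + kolTrac σ (-1) l C A F p)) ∧
    stress M (kolField σ M.kappa l A C E F) 0 1 p =
      M.mu * l * Complex.I * (kolTrac σ 1 l A C E p - kolTrac σ (-1) l C A F p) ∧
    stress M (kolField σ M.kappa l A C E F) 1 0 p =
      M.mu * l * Complex.I * (kolTrac σ 1 l A C E p - kolTrac σ (-1) l C A F p) ∧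
    stress M (kolField σ M.kappa l A C E F) 1 1 p =
      M.mu * l * (kolTrac σ 1 l A C E p + kolTrac σ (-1) l C A F p) := by
  obtain ⟨h0, h1⟩ := hasPd_kolField hσ M.kappa l A C E F hp
  obtain ⟨s1, s2, s3, s4⟩ := stress_of_hasPd M h0 h1
  have hl := M.lame_mul
  simp only [kolTrac, neg_neg]
  refine ⟨s1.trans ?_, s2.trans ?_, s3.trans ?_, s4.trans ?_⟩
  · linear_combination (l * (A * pw σ 1 (l - 1) p + C * pw σ (-1) (l - 1) p)) * hl
  · ring
  · ring
  · linear_combination (l * (A * pw σ 1 (l - 1) p + C * pw σ (-1) (l - 1) p)) * hl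

include hσ in
theorem contDiffOn_kolField (κ l A C E F : ℂ) :
    ContDiffOn ℝ 2 (kolField σ κ l A C E F) (body σ) := by
  intro p hp
  refine ContDiffAt.contDiffWithinAt ?_
  have hzc : ∀ τ, ContDiffAt ℝ 2 (zc τ) p := fun τ => by
    unfold zc
    have h2 : ContDiff ℝ 2 (fun x : ℝ => (x : ℂ)) := Complex.ofRealCLM.contDiff
    exact ((h2.comp contDiff_fst).add (contDiff_const.mul (h2.comp contDiff_snd))).contDiffAt
  have hd : ∀ τ : ℝ, (τ = 1 ∨ τ = -1) → ∀ A C E : ℂ,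
      ContDiffAt ℝ 2 (kolDisp σ τ κ l A C E) p := fun τ hτ A C E => by
    have hτ' := neg_eq_one_or hτ
    exact ((contDiffAt_const.mul (contDiffAt_pw hσ hτ l hp)).sub
      (contDiffAt_const.mul ((hzc τ).mul (contDiffAt_pw hσ hτ' (l - 1) hp)))).sub
        (contDiffAt_const.mul (contDiffAt_pw hσ hτ' l hp))
  have h1 := hd 1 (Or.inl rfl) A C E
  have h2 := hd (-1) (Or.inr rfl) C A F
  rw [contDiffAt_pi]
  intro i
  fin_cases i
  · exact contDiffAt_const.mul (h1.add h2)
  · exact contDiffAt_const.mul (h1.sub h2)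

include hσ in
theorem isEquilibrium_kolField (M : Material) (l A C E F : ℂ) :
    IsEquilibrium M (body σ) (kolField σ M.kappa l A C E F) := by
  refine ⟨contDiffOn_kolField hσ _ _ _ _ _ _, fun p hp i => ?_⟩
  have ev : ∀ {f g : ℝ × ℝ → ℂ}, (∀ q ∈ body σ, f q = g q) → f =ᶠ[𝓝 p] g := fun h => by
    filter_upwards [(isOpen_body σ).mem_nhds hp] with q hq using h q hq
  have hz := hasPd_pw hσ (τ := 1) (Or.inl rfl) (l - 1) hp
  have hy := hasPd_pw hσ (τ := -1) (Or.inr rfl) (l - 1) hp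
  have t1 := hasPd_kolTrac hσ (τ := 1) (Or.inl rfl) l A C E hp
  have t2 := hasPd_kolTrac hσ (τ := -1) (Or.inr rfl) l C A F hp
  rw [neg_neg] at t2
  push_cast at hz hy t1 t2
  have s00 := ((((hz.const_mul A).add (hy.const_mul C)).const_mul 4).sub (t1.add t2)).const_mul
    (M.mu * l) |>.congr (ev fun q hq => (stress_kolField hσ M l A C E F hq).1)
  have s01 := ((t1.sub t2).const_mul (M.mu * l * Complex.I)).congr
    (ev fun q hq => (stress_kolField hσ M l A C E F hq).2.1)
  have s10 := ((t1.sub t2).const_mul (M.mu * l * Complex.I)).congr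
    (ev fun q hq => (stress_kolField hσ M l A C E F hq).2.2.1)
  have s11 := ((t1.add t2).const_mul (M.mu * l)).congr
    (ev fun q hq => (stress_kolField hσ M l A C E F hq).2.2.2)
  fin_cases i
  · simp only [Fin.sum_univ_two, Fin.zero_eta, s00.pd_zero, s01.pd_one]
    ring_nf
    simp only [Complex.I_sq]
    ring
  · simp only [Fin.sum_univ_two, Fin.mk_one, s10.pd_zero, s11.pd_one]
    ring

end Kolosov

/-! ### Homogeneous equilibrium fields are Kolosov-Muskhelishvili fields -/

/-- `f` is positively homogeneous of degree `s` in the half-plane `0 < σ x₂`. -/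
def HomogeneousOn (σ : ℝ) (s : ℂ) (f : ℝ × ℝ → ℂ) : Prop :=
  ∀ t : ℝ, 0 < t → ∀ p ∈ body σ, f (t • p) = (t : ℂ) ^ s * f p

namespace HomogeneousOn

variable {σ : ℝ} {s : ℂ} {f g : ℝ × ℝ → ℂ}

theorem add (hf : HomogeneousOn σ s f) (hg : HomogeneousOn σ s g) :
    HomogeneousOn σ s fun p => f p + g p := fun t ht p hp => by
  simp only [hf t ht p hp, hg t ht p hp, mul_add]

theorem sub (hf : HomogeneousOn σ s f) (hg : HomogeneousOn σ s g) :
    HomogeneousOn σ s fun p => f p - g p := fun t ht p hp => by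
  simp only [hf t ht p hp, hg t ht p hp, mul_sub]

theorem const_mul (c : ℂ) (hf : HomogeneousOn σ s f) :
    HomogeneousOn σ s fun p => c * f p := fun t ht p hp => by
  simp only [hf t ht p hp]; ring

theorem pd (hf : HomogeneousOn σ s f) (hd : ∀ p ∈ body σ, DifferentiableAt ℝ f p) (k : Fin 2) :
    HomogeneousOn σ (s - 1) (pd k f) := fun t ht p hp => by
  have ht0 : (t : ℂ) ≠ 0 := Complex.ofReal_ne_zero.2 ht.ne'
  have h1 : HasFDerivAt (fun q : ℝ × ℝ => f (t • q))
      ((fderiv ℝ f (t • p)).comp (t • ContinuousLinearMap.id ℝ (ℝ × ℝ))) p :=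
    (hd _ (smul_mem_body hp ht)).hasFDerivAt.comp p ((hasFDerivAt_id p).const_smul t)
  have h2 : HasFDerivAt (fun q : ℝ × ℝ => f (t • q)) ((t : ℂ) ^ s • fderiv ℝ f p) p := by
    refine ((hd p hp).hasFDerivAt.const_mul ((t : ℂ) ^ s)).congr_of_eventuallyEq ?_
    filter_upwards [(isOpen_body σ).mem_nhds hp] with q hq using hf t ht q hq
  have h3 := congrArg (fun L => L ((![(1, 0), (0, 1)] : Fin 2 → ℝ × ℝ) k)) (h1.unique h2)
  simp only [ContinuousLinearMap.comp_apply, _root_.smul_apply,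
    ContinuousLinearMap.id_apply, map_smul, Complex.real_smul, smul_eq_mul] at h3
  rw [Complex.cpow_sub _ _ ht0, Complex.cpow_one, div_mul_eq_mul_div, eq_div_iff ht0, mul_comm]
  exact h3

/-- Euler's relation for homogeneous functions. -/
theorem euler (hf : HomogeneousOn σ s f) {p : ℝ × ℝ} (hp : p ∈ body σ) {a b : ℂ}
    (hd : HasPd f a b p) : p.1 * a + p.2 * b = s * f p := by
  have h1 : HasDerivAt (fun t : ℝ => f (t • p)) (fderiv ℝ f p p) 1 := by
    have hl : HasDerivAt (fun t : ℝ => t • p) p 1 := by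
      simpa using (hasDerivAt_id (1 : ℝ)).smul_const p
    have hf' : HasFDerivAt f (fderiv ℝ f p) ((1 : ℝ) • p) := by
      rw [one_smul]; exact hd.diff.hasFDerivAt
    exact hf'.comp_hasDerivAt 1 hl
  have h2 : HasDerivAt (fun t : ℝ => f (t • p)) (s * f p) 1 := by
    have h3 : HasDerivAt (fun z : ℂ => z ^ s) s 1 := by
      simpa using (hasDerivAt_id (1 : ℂ)).cpow_const (c := s) (by simp)
    have h4 : HasDerivAt (fun t : ℝ => ((t : ℂ) ^ s)) s 1 := by
      have h5 : HasDerivAt (fun z : ℂ => z ^ s) s ((1 : ℝ) : ℂ) := by simpa using h3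
      exact h5.comp_ofReal
    refine (h4.mul_const (f p)).congr_of_eventuallyEq ?_
    filter_upwards [lt_mem_nhds (zero_lt_one' ℝ)] with t ht using hf t ht p hp
  rw [← hd.fderiv_apply p]
  exact h1.unique h2

/-- A homogeneous function of degree `s` satisfying the Cauchy-Riemann equations (for `τ = 1`) or
their conjugates (for `τ = -1`) is a multiple of the power `(x₁ + τ i x₂)^s`. -/
theorem eq_mul_pw (hσ : σ = 1 ∨ σ = -1) {τ : ℝ} (hτ : τ = 1 ∨ τ = -1)
    (hf : HomogeneousOn σ s f)
    (hd : ∀ p ∈ body σ, ∃ a, HasPd f a (τ * Complex.I * a) p) :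
    ∃ c, ∀ p ∈ body σ, f p = c * pw σ τ s p := by
  have hder : ∀ p ∈ body σ, HasPd (fun q => f q * pw σ τ (-s) q) 0 0 p := by
    intro p hp
    obtain ⟨a, ha⟩ := hd p hp
    have he := hf.euler hp ha
    have hz := zc_mul_pw hσ hτ (-s) (zc_mem_halfBar hτ hp).2
    have he' : zc τ p * a = s * f p := by rw [← he, zc]; ring
    refine (ha.mul (hasPd_pw hσ hτ (-s) hp)).congr_val ?_ ?_
    · rw [← hz]
      linear_combination pw σ τ (-s - 1) p * he'
    · rw [← hz]
      linear_combination τ * Complex.I * pw σ τ (-s - 1) p * he'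
  have hp0 : ((0, σ) : ℝ × ℝ) ∈ body σ := by
    rcases hσ with rfl | rfl <;> simp [body]
  refine ⟨f (0, σ) * pw σ τ (-s) (0, σ), fun p hp => ?_⟩
  have hc : f p * pw σ τ (-s) p = f (0, σ) * pw σ τ (-s) (0, σ) := by
    refine (isOpen_body σ).is_const_of_fderiv_eq_zero (𝕜 := ℝ)
      (f := fun q => f q * pw σ τ (-s) q) (convex_body σ).isPreconnected
      (fun q hq => (hder q hq).diff.differentiableWithinAt) (fun q hq => ?_) hp hp0
    refine ContinuousLinearMap.ext fun w => ?_
    rw [(hder q hq).fderiv_apply]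
    simp
  have h0 : pw σ τ (-s) p * pw σ τ s p = 1 := by
    rw [← pw_add, neg_add_cancel, pw]; simp
  rw [← hc, mul_assoc, h0, mul_one]

end HomogeneousOn

/-- The second derivatives of a `C²` function commute. -/
theorem pd_comm {S : Set (ℝ × ℝ)} (hS : IsOpen S) {f : ℝ × ℝ → ℂ} (hf : ContDiffOn ℝ 2 f S)
    {p : ℝ × ℝ} (hp : p ∈ S) : pd 0 (pd 1 f) p = pd 1 (pd 0 f) p := by
  have h1 : ContDiffAt ℝ 2 f p := hf.contDiffAt (hS.mem_nhds hp)
  have h2 : DifferentiableAt ℝ (fderiv ℝ f) p :=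
    (h1.fderiv_right (m := 1) (by norm_num)).differentiableAt (by norm_num)
  have hs : IsSymmSndFDerivAt ℝ f p := h1.isSymmSndFDerivAt (by simp)
  have key : ∀ v w : ℝ × ℝ, fderiv ℝ (fun q => fderiv ℝ f q v) p w = fderiv ℝ (fderiv ℝ f) p w v :=
    fun v w => by
      rw [fderiv_clm_apply h2 (differentiableAt_const v)]
      simp
  exact (key _ _).trans ((hs _ _).trans (key _ _).symm)

section Equilibrium

variable {σ : ℝ} {M : Material} {U : Disp}

/-- Navier's equations say that `(λ + 2μ) div U + τ i μ rot U` satisfies the Cauchy-Riemann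
equations for `τ = 1`, and their conjugates for `τ = -1`. -/
theorem cauchyRiemann_of_isEquilibrium (hU : IsEquilibrium M (body σ) U) {τ : ℝ}
    (hτ : τ = 1 ∨ τ = -1) {p : ℝ × ℝ} (hp : p ∈ body σ) :
    ∃ a, HasPd (fun q =>
      ((2 * M.mu * M.nu / (1 - 2 * M.nu) : ℝ) + 2 * M.mu : ℂ) *
          (pd 0 (fun q => U q 0) q + pd 1 (fun q => U q 1) q) +
        τ * Complex.I * M.mu * (pd 0 (fun q => U q 1) q - pd 1 (fun q => U q 0) q))
      a (τ * Complex.I * a) p := by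
  have hS := isOpen_body σ
  have hpd : ∀ j k, HasPd (pd j fun q => U q k) (pd 0 (pd j fun q => U q k) p)
      (pd 1 (pd j fun q => U q k) p) p := fun j k => HasPd.self (differentiableAt_pd hS hU.1 j k hp)
  have hc0 := pd_comm hS (contDiffOn_comp hU.1 0) hp
  have hc1 := pd_comm hS (contDiffOn_comp hU.1 1) hp
  have e0 := hU.2 p hp 0
  have e1 := hU.2 p hp 1
  have hst : ∀ q ∈ body σ, _ := fun q hq => stress_of_hasPd M
    (HasPd.self (differentiableAt_comp hS hU.1 0 hq))
    (HasPd.self (differentiableAt_comp hS hU.1 1 hq))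
  have ev : ∀ {f g : ℝ × ℝ → ℂ}, (∀ q ∈ body σ, f q = g q) → f =ᶠ[𝓝 p] g := fun h => by
    filter_upwards [hS.mem_nhds hp] with q hq using h q hq
  have s00 := ((((hpd 0 0).add (hpd 1 1)).const_mul
    ((2 * M.mu * M.nu / (1 - 2 * M.nu) : ℝ) : ℂ)).add ((hpd 0 0).const_mul (2 * M.mu))).congr
      (ev fun q hq => (hst q hq).1)
  have s01 := (((hpd 1 0).add (hpd 0 1)).const_mul (M.mu : ℂ)).congr
    (ev fun q hq => (hst q hq).2.1)
  have s10 := (((hpd 1 0).add (hpd 0 1)).const_mul (M.mu : ℂ)).congr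
    (ev fun q hq => (hst q hq).2.2.1)
  have s11 := ((((hpd 0 0).add (hpd 1 1)).const_mul
    ((2 * M.mu * M.nu / (1 - 2 * M.nu) : ℝ) : ℂ)).add ((hpd 1 1).const_mul (2 * M.mu))).congr
      (ev fun q hq => (hst q hq).2.2.2)
  rw [Fin.sum_univ_two, s00.pd_zero, s01.pd_one] at e0
  rw [Fin.sum_univ_two, s10.pd_zero, s11.pd_one] at e1
  have hττ : (τ : ℂ) * τ = 1 := by rcases hτ with rfl | rfl <;> norm_num
  refine ⟨_, ((((hpd 0 0).add (hpd 1 1)).const_mul _).add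
    (((hpd 0 1).sub (hpd 1 0)).const_mul _)).congr_val rfl ?_⟩
  generalize ((2 * M.mu * M.nu / (1 - 2 * M.nu) : ℝ) : ℂ) = L at *
  linear_combination e1 - τ * Complex.I * e0 - 2 * M.mu * hc0 - 2 * M.mu * τ * Complex.I * hc1 -
    M.mu * (pd 0 (pd 0 fun q => U q 1) p - pd 0 (pd 1 fun q => U q 0) p) *
      (Complex.I ^ 2 * hττ + Complex.I_mul_I)

/-- Every equilibrium field that is homogeneous of degree `l ≠ 0` in a half-plane is a
Kolosov-Muskhelishvili field. -/
theorem exists_eq_kolField (hσ : σ = 1 ∨ σ = -1) (hU : IsEquilibrium M (body σ) U) {l : ℂ}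
    (hl : l ≠ 0) (hh : ∀ i, HomogeneousOn σ l fun q => U q i) :
    ∃ A C E F : ℂ, ∀ p ∈ body σ, U p = kolField σ M.kappa l A C E F p := by
  have hS := isOpen_body σ
  have hcomp : ∀ k, ∀ p ∈ body σ, HasPd (fun q => U q k) (pd 0 (fun q => U q k) p)
      (pd 1 (fun q => U q k) p) p := fun k p hp => HasPd.self (differentiableAt_comp hS hU.1 k hp)
  have hhpd : ∀ j k, HomogeneousOn σ (l - 1) (pd j fun q => U q k) := fun j k =>
    (hh k).pd (fun p hp => (hcomp k p hp).diff) j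
  set L : ℂ := ((2 * M.mu * M.nu / (1 - 2 * M.nu) : ℝ) : ℂ) with hL
  have hLame : L * (M.kappa - 1) = M.mu * (3 - M.kappa) := M.lame_mul
  have hmu : (M.mu : ℂ) ≠ 0 := Complex.ofReal_ne_zero.2 M.mu_pos.ne'
  have hk : (M.kappa : ℂ) - 1 ≠ 0 := by
    have h1 := M.nu_lt
    have h2 : M.kappa - 1 ≠ 0 := by rw [Material.kappa]; linarith
    exact_mod_cast h2
  have hk1 : (M.kappa : ℂ) + 1 ≠ 0 := by
    have h1 := M.nu_lt
    have h2 : M.kappa + 1 ≠ 0 := by rw [Material.kappa]; linarith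
    exact_mod_cast h2
  have hP : (L + 2 * M.mu) * (M.kappa - 1) = M.mu * (M.kappa + 1) := by
    linear_combination hLame
  have hhol : ∀ τ : ℝ, (τ = 1 ∨ τ = -1) → ∃ c, ∀ p ∈ body σ,
      (L + 2 * M.mu) * (pd 0 (fun q => U q 0) p + pd 1 (fun q => U q 1) p) +
        τ * Complex.I * M.mu * (pd 0 (fun q => U q 1) p - pd 1 (fun q => U q 0) p) =
      c * pw σ τ (l - 1) p := fun τ hτ =>
    ((((hhpd 0 0).add (hhpd 1 1)).const_mul _).add
      (((hhpd 0 1).sub (hhpd 1 0)).const_mul _)).eq_mul_pw hσ hτ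
        fun p hp => cauchyRiemann_of_isEquilibrium hU hτ hp
  obtain ⟨a, ha⟩ := hhol 1 (Or.inl rfl)
  obtain ⟨c, hc⟩ := hhol (-1) (Or.inr rfl)
  -- the coefficients of the two potentials
  set A : ℂ := a / (2 * M.mu * l * (M.kappa + 1)) with hA
  set C : ℂ := c / (2 * M.mu * l * (M.kappa + 1)) with hC
  have haA : a = 2 * M.mu * l * (M.kappa + 1) * A := by rw [hA]; field_simp
  have hcC : c = 2 * M.mu * l * (M.kappa + 1) * C := by rw [hC]; field_simp
  push_cast at ha hc
  have hdiv : ∀ p ∈ body σ, pd 0 (fun q => U q 0) p + pd 1 (fun q => U q 1) p =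
      l * (M.kappa - 1) * (A * pw σ 1 (l - 1) p + C * pw σ (-1) (l - 1) p) := fun p hp => by
    have h1 := ha p hp
    have h2 := hc p hp
    rw [haA] at h1
    rw [hcC] at h2
    refine mul_left_cancel₀ (mul_ne_zero hmu hk1) ?_
    linear_combination (M.kappa - 1) / 2 * h1 + (M.kappa - 1) / 2 * h2 -
      (pd 0 (fun q => U q 0) p + pd 1 (fun q => U q 1) p) * hP
  have hrot : ∀ p ∈ body σ, Complex.I * (pd 0 (fun q => U q 1) p - pd 1 (fun q => U q 0) p) =
      l * (M.kappa + 1) * (A * pw σ 1 (l - 1) p - C * pw σ (-1) (l - 1) p) := fun p hp => by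
    have h1 := ha p hp
    have h2 := hc p hp
    rw [haA] at h1
    rw [hcC] at h2
    refine mul_left_cancel₀ hmu ?_
    linear_combination h1 / 2 - h2 / 2
  -- what remains of `U₁ ± i U₂` after subtracting the part of the potentials
  have hrem : ∀ τ : ℝ, (τ = 1 ∨ τ = -1) → ∀ A' C' : ℂ,
      (∀ p ∈ body σ, pd 0 (fun q => U q 0) p + pd 1 (fun q => U q 1) p +
        τ * (Complex.I * (pd 0 (fun q => U q 1) p - pd 1 (fun q => U q 0) p)) =
        2 * l * (M.kappa * A' * pw σ τ (l - 1) p - C' * pw σ (-τ) (l - 1) p)) →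
      ∃ E, ∀ p ∈ body σ, U p 0 + τ * Complex.I * U p 1 = kolDisp σ τ M.kappa l A' C' E p := by
    intro τ hτ A' C' hdz
    have hττ : (τ : ℂ) * τ = 1 := by rcases hτ with rfl | rfl <;> norm_num
    have hτ' := neg_eq_one_or hτ
    have hhk : HomogeneousOn σ l (kolDisp σ τ M.kappa l A' C' 0) := fun t ht p hp => by
      have ht0 : (t : ℂ) ≠ 0 := Complex.ofReal_ne_zero.2 ht.ne'
      simp only [kolDisp, pw_smul hσ hτ _ hp ht, pw_smul hσ hτ' _ hp ht, zc_smul]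
      rw [Complex.cpow_sub _ _ ht0, Complex.cpow_one]
      field_simp
    have hh1 : HomogeneousOn σ l fun p => U p 0 + τ * Complex.I * U p 1 -
        kolDisp σ τ M.kappa l A' C' 0 p := ((hh 0).add ((hh 1).const_mul _)).sub hhk
    obtain ⟨E, hE⟩ := hh1.eq_mul_pw hσ hτ' (fun p hp => by
      refine ⟨_, (((hcomp 0 p hp).add ((hcomp 1 p hp).const_mul (τ * Complex.I))).sub
        (hasPd_kolDisp hσ hτ M.kappa l A' C' 0 hp)).congr_val rfl ?_⟩
      have h := hdz p hp
      push_cast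
      linear_combination τ * Complex.I * h +
        pd 1 (fun q => U q 0) p * (Complex.I ^ 2 * hττ + Complex.I_mul_I))
    refine ⟨-E, fun p hp => ?_⟩
    have h := hE p hp
    simp only [kolDisp] at h ⊢
    linear_combination h
  obtain ⟨E, hE⟩ := hrem 1 (Or.inl rfl) A C fun p hp => by
    have h1 := hdiv p hp
    have h2 := hrot p hp
    push_cast
    linear_combination h1 + h2
  obtain ⟨F, hF⟩ := hrem (-1) (Or.inr rfl) C A fun p hp => by
    have h1 := hdiv p hp
    have h2 := hrot p hp
    rw [neg_neg]
    push_cast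
    linear_combination h1 - h2
  refine ⟨A, C, E, F, fun p hp => ?_⟩
  have h1 := hE p hp
  have h2 := hF p hp
  push_cast at h1 h2
  funext i
  fin_cases i
  · simp only [kolField, ← h1, ← h2]
    simp
    ring
  · simp only [kolField, ← h1, ← h2]
    simp
    linear_combination U p 1 * Complex.I_mul_I

end Equilibrium

/-! ### Boundary values of Kolosov-Muskhelishvili fields -/

/-- The tractions `[σ₂₁, σ₂₂]` of `kolField`. -/
noncomputable def kolTraction (σ : ℝ) (μ l A C E F : ℂ) (p : ℝ × ℝ) : Fin 2 → ℂ :=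
  ![μ * l * Complex.I * (kolTrac σ 1 l A C E p - kolTrac σ (-1) l C A F p),
    μ * l * (kolTrac σ 1 l A C E p + kolTrac σ (-1) l C A F p)]

/-- Vectors `[u₁, u₂]` given through `u₁ + i u₂` and `u₁ - i u₂`. -/
theorem vec_eq_iff {a b c d : ℂ} : ![1 / 2 * (a + b), -Complex.I / 2 * (a - b)] =
    ![1 / 2 * (c + d), -Complex.I / 2 * (c - d)] ↔ a = c ∧ b = d := by
  constructor
  · intro h
    have h0 := congrFun h 0
    have h1 := congrFun h 1
    simp only [Matrix.cons_val_zero, Matrix.cons_val_one, Matrix.cons_val_fin_one] at h0 h1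
    constructor
    · linear_combination h0 + Complex.I * h1 + 1 / 2 * (a - b - (c - d)) * Complex.I_mul_I
    · linear_combination h0 - Complex.I * h1 - 1 / 2 * (a - b - (c - d)) * Complex.I_mul_I
  · rintro ⟨rfl, rfl⟩; rfl

theorem vec_eq_iff' {μ ν a b c d : ℂ} :
    ![μ * Complex.I * (a - b), μ * (a + b)] = ![ν * Complex.I * (c - d), ν * (c + d)] ↔
      μ * a = ν * c ∧ μ * b = ν * d := by
  constructor
  · intro h
    have h0 := congrFun h 0
    have h1 := congrFun h 1
    simp only [Matrix.cons_val_zero, Matrix.cons_val_one, Matrix.cons_val_fin_one] at h0 h1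
    constructor
    · linear_combination (-Complex.I / 2) * h0 + h1 / 2 +
        1 / 2 * (μ * (a - b) - ν * (c - d)) * Complex.I_mul_I
    · linear_combination (Complex.I / 2) * h0 + h1 / 2 -
        1 / 2 * (μ * (a - b) - ν * (c - d)) * Complex.I_mul_I
  · rintro ⟨h1, h2⟩
    congr 1
    · linear_combination Complex.I * h1 - Complex.I * h2
    · congr 1
      linear_combination h1 + h2

section Boundary

variable {σ : ℝ} (hσ : σ = 1 ∨ σ = -1)

include hσ in
theorem neBot_nhdsWithin_body (x : ℝ) : (𝓝[body σ] (x, 0)).NeBot := by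
  rw [← mem_closure_iff_nhdsWithin_neBot]
  have h : Tendsto (fun n : ℝ => ((x, σ * n) : ℝ × ℝ)) (𝓝[>] 0) (𝓝 (x, 0)) := by
    have : Continuous fun n : ℝ => ((x, σ * n) : ℝ × ℝ) := by fun_prop
    have h2 := this.tendsto 0
    rw [mul_zero] at h2
    exact h2.mono_left nhdsWithin_le_nhds
  refine mem_closure_of_tendsto h ?_
  filter_upwards [self_mem_nhdsWithin] with n hn
  have hn' : (0 : ℝ) < n := hn
  rcases hσ with rfl | rfl <;> simpa [body] using hn'

include hσ in
theorem continuousAt_kolDisp {τ : ℝ} (hτ : τ = 1 ∨ τ = -1) (κ l A C E : ℂ) {x : ℝ} (hx : x ≠ 0) :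
    ContinuousAt (kolDisp σ τ κ l A C E) (x, 0) := by
  have hτ' := neg_eq_one_or hτ
  exact ((continuousAt_const.mul (continuousAt_pw hσ hτ l hx)).sub
    (continuousAt_const.mul ((hasPd_zc τ _).diff.continuousAt.mul
      (continuousAt_pw hσ hτ' (l - 1) hx)))).sub
        (continuousAt_const.mul (continuousAt_pw hσ hτ' l hx))

include hσ in
theorem continuousAt_kolTrac {τ : ℝ} (hτ : τ = 1 ∨ τ = -1) (l A C E : ℂ) {x : ℝ} (hx : x ≠ 0) :
    ContinuousAt (kolTrac σ τ l A C E) (x, 0) := by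
  have hτ' := neg_eq_one_or hτ
  exact (((continuousAt_const.mul (continuousAt_pw hσ hτ _ hx)).add
    (continuousAt_const.mul (continuousAt_pw hσ hτ' _ hx))).add
    (continuousAt_const.mul ((hasPd_zc τ _).diff.continuousAt.mul
      (continuousAt_pw hσ hτ' _ hx)))).add
        (continuousAt_const.mul (continuousAt_pw hσ hτ' _ hx))

include hσ in
theorem tendsto_kolField (κ l A C E F : ℂ) {x : ℝ} (hx : x ≠ 0) :
    Tendsto (kolField σ κ l A C E F) (𝓝[body σ] (x, 0)) (𝓝 (kolField σ κ l A C E F (x, 0))) := by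
  refine ContinuousAt.tendsto ?_ |>.mono_left nhdsWithin_le_nhds
  have h1 := continuousAt_kolDisp hσ (τ := 1) (Or.inl rfl) κ l A C E hx
  have h2 := continuousAt_kolDisp hσ (τ := -1) (Or.inr rfl) κ l C A F hx
  rw [continuousAt_pi]
  intro i
  fin_cases i
  · exact continuousAt_const.mul (h1.add h2)
  · exact continuousAt_const.mul (h1.sub h2)

include hσ in
theorem tendsto_traction_kolField (M : Material) (l A C E F : ℂ) {x : ℝ} (hx : x ≠ 0) :
    Tendsto (traction M (kolField σ M.kappa l A C E F)) (𝓝[body σ] (x, 0))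
      (𝓝 (kolTraction σ M.mu l A C E F (x, 0))) := by
  have h1 := continuousAt_kolTrac hσ (τ := 1) (Or.inl rfl) l A C E hx
  have h2 := continuousAt_kolTrac hσ (τ := -1) (Or.inr rfl) l C A F hx
  have hc : ContinuousAt (kolTraction σ M.mu l A C E F) (x, 0) := by
    rw [continuousAt_pi]
    intro i
    fin_cases i
    · exact continuousAt_const.mul (h1.sub h2)
    · exact continuousAt_const.mul (h1.add h2)
  refine (hc.tendsto.mono_left nhdsWithin_le_nhds).congr' ?_
  filter_upwards [self_mem_nhdsWithin] with p hp
  obtain ⟨-, -, h10, h11⟩ := stress_kolField hσ M l A C E F hp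
  funext i
  fin_cases i
  · exact h10.symm
  · exact h11.symm

include hσ in
theorem kolDisp_real {τ : ℝ} (hτ : τ = 1 ∨ τ = -1) (κ l A C E : ℂ) {x : ℝ} (hx : x ≠ 0) :
    kolDisp σ τ κ l A C E (x, 0) =
      κ * A * pw σ τ l (x, 0) - (l * C + E) * pw σ (-τ) l (x, 0) := by
  have h := zc_mul_pw hσ (neg_eq_one_or hτ) l (p := (x, 0))
    (by rw [zc_real]; exact Complex.ofReal_ne_zero.2 hx)
  rw [zc_real] at h
  rw [kolDisp, zc_real, h]
  ring

include hσ in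
theorem kolTrac_real {τ : ℝ} (hτ : τ = 1 ∨ τ = -1) (l A C E : ℂ) {x : ℝ} (hx : x ≠ 0) :
    kolTrac σ τ l A C E (x, 0) =
      A * pw σ τ (l - 1) (x, 0) + (l * C + E) * pw σ (-τ) (l - 1) (x, 0) := by
  have h := zc_mul_pw hσ (neg_eq_one_or hτ) (l - 1) (p := (x, 0))
    (by rw [zc_real]; exact Complex.ofReal_ne_zero.2 hx)
  rw [zc_real] at h
  rw [kolTrac, zc_real, h]
  ring

include hσ in
theorem kolTrac_of_pos {τ : ℝ} (hτ : τ = 1 ∨ τ = -1) (l A C E : ℂ) {x : ℝ} (hx : 0 < x) :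
    kolTrac σ τ l A C E (x, 0) = (A + l * C + E) * (x : ℂ) ^ (l - 1) := by
  rw [kolTrac_real hσ hτ l A C E hx.ne', pw_of_pos hσ hτ _ hx,
    pw_of_pos hσ (neg_eq_one_or hτ) _ hx]
  ring

/-- Displacements of a field with traction-free positive half-axis, on that half-axis. -/
theorem kolDisp_of_pos {σ : ℝ} (hσ : σ = 1 ∨ σ = -1) {τ : ℝ} (hτ : τ = 1 ∨ τ = -1)
    (κ l A C : ℂ) {x : ℝ} (hx : 0 < x) :
    kolDisp σ τ κ l A C (-(A + l * C)) (x, 0) = (κ + 1) * A * (x : ℂ) ^ l := by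
  rw [kolDisp_real hσ hτ _ _ _ _ _ hx.ne', pw_of_pos hσ hτ _ hx,
    pw_of_pos hσ (neg_eq_one_or hτ) _ hx]
  ring

theorem kolDisp_of_neg {σ : ℝ} (hσ : σ = 1 ∨ σ = -1) {τ : ℝ} (hτ : τ = 1 ∨ τ = -1)
    (κ l A C : ℂ) {x : ℝ} (hx : x < 0) :
    kolDisp σ τ κ l A C (-(A + l * C)) (x, 0) = A * ((-x : ℝ) : ℂ) ^ l *
      (κ * Complex.exp (σ * τ * (Complex.I * Real.pi * l)) +
        Complex.exp (-(σ * τ * (Complex.I * Real.pi * l)))) := by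
  have e : ((σ : ℂ) * ((-τ : ℝ) : ℂ) * (Complex.I * Real.pi * l)) =
      -(σ * τ * (Complex.I * Real.pi * l)) := by push_cast; ring
  rw [kolDisp_real hσ hτ _ _ _ _ _ hx.ne, pw_of_neg hσ hτ _ hx,
    pw_of_neg hσ (neg_eq_one_or hτ) _ hx, e]
  ring

theorem kolTrac_of_neg {σ : ℝ} (hσ : σ = 1 ∨ σ = -1) {τ : ℝ} (hτ : τ = 1 ∨ τ = -1)
    (l A C : ℂ) {x : ℝ} (hx : x < 0) :
    kolTrac σ τ l A C (-(A + l * C)) (x, 0) = A * ((-x : ℝ) : ℂ) ^ (l - 1) *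
      (Complex.exp (-(σ * τ * (Complex.I * Real.pi * l))) -
        Complex.exp (σ * τ * (Complex.I * Real.pi * l))) := by
  have e1 : Complex.exp ((σ : ℂ) * (τ : ℂ) * (Complex.I * Real.pi * (l - 1))) =
      -Complex.exp (σ * τ * (Complex.I * Real.pi * l)) := by
    have : ((σ : ℂ) * (τ : ℂ) * (Complex.I * Real.pi * (l - 1))) =
      σ * τ * (Complex.I * Real.pi * l) - ((σ * τ : ℝ) : ℂ) * (Real.pi * Complex.I) := by
        push_cast; ring
    rw [this, Complex.exp_sub]
    rcases mul_eq_one_or hσ hτ with h | h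
    · rw [h, Complex.ofReal_one, one_mul, Complex.exp_pi_mul_I]; ring
    · rw [h, Complex.ofReal_neg, Complex.ofReal_one, neg_mul, one_mul, Complex.exp_neg,
        Complex.exp_pi_mul_I, inv_neg, inv_one, div_neg, div_one]
  have e2 : Complex.exp ((σ : ℂ) * ((-τ : ℝ) : ℂ) * (Complex.I * Real.pi * (l - 1))) =
      -Complex.exp (-(σ * τ * (Complex.I * Real.pi * l))) := by
    have : ((σ : ℂ) * ((-τ : ℝ) : ℂ) * (Complex.I * Real.pi * (l - 1))) =
      -(σ * τ * (Complex.I * Real.pi * (l - 1))) := by push_cast; ring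
    rw [this, Complex.exp_neg, e1, Complex.exp_neg, inv_neg]
  rw [kolTrac_real hσ hτ _ _ _ _ hx.ne, pw_of_neg hσ hτ _ hx,
    pw_of_neg hσ (neg_eq_one_or hτ) _ hx, e1, e2]
  ring

end Boundary

/-! ### Dilations of singular solutions -/

/-- The dilated field `p ↦ U (t p)`. -/
def dilate (t : ℝ) (U : Disp) : Disp := fun p => U (t • p)

theorem pd_comp_smul (t : ℝ) (f : ℝ × ℝ → ℂ) (k : Fin 2) (p : ℝ × ℝ) :
    pd k (fun q => f (t • q)) p = t * pd k f (t • p) := by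
  rw [pd, fderiv_comp_smul]
  simp [pd]

theorem stress_dilate (M : Material) (t : ℝ) (U : Disp) (i j : Fin 2) (p : ℝ × ℝ) :
    stress M (dilate t U) i j p = t * stress M U i j (t • p) := by
  have h : ∀ a k, pd a (fun q => dilate t U q k) p = t * pd a (fun q => U q k) (t • p) :=
    fun a k => pd_comp_smul t (fun q => U q k) a p
  simp only [stress, h, ← Finset.mul_sum]
  ring

theorem isEquilibrium_dilate {M : Material} {σ t : ℝ} (ht : 0 < t) {U : Disp}
    (hU : IsEquilibrium M (body σ) U) : IsEquilibrium M (body σ) (dilate t U) := by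
  refine ⟨hU.1.comp (contDiff_const_smul t).contDiffOn fun p hp => smul_mem_body hp ht,
    fun p hp i => ?_⟩
  have h : ∀ j, pd j (stress M (dilate t U) i j) p =
      (t * t : ℂ) * pd j (stress M U i j) (t • p) := fun j => by
    have h1 : stress M (dilate t U) i j = fun q => (t • stress M U i j) (t • q) := by
      funext q
      rw [stress_dilate]
      simp
    have h2 : pd j (t • stress M U i j) (t • p) = t * pd j (stress M U i j) (t • p) := by
      unfold pd
      rw [fderiv_const_smul_field]
      simp
    rw [h1, pd_comp_smul, h2, mul_assoc]
  simp only [h, ← Finset.mul_sum, hU.2 _ (smul_mem_body hp ht) i, mul_zero]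

theorem tendsto_smul_nhdsWithin_body (σ : ℝ) {t : ℝ} (ht : 0 < t) (x : ℝ) :
    Tendsto (fun p : ℝ × ℝ => t • p) (𝓝[body σ] (x, 0)) (𝓝[body σ] (t * x, 0)) := by
  refine tendsto_nhdsWithin_iff.2 ⟨?_, ?_⟩
  · have h : Continuous fun p : ℝ × ℝ => t • p := continuous_const_smul t
    have h2 := h.tendsto ((x, 0) : ℝ × ℝ)
    have e : t • ((x, 0) : ℝ × ℝ) = (t * x, 0) := by simp
    rw [e] at h2
    exact h2.mono_left nhdsWithin_le_nhds
  · filter_upwards [self_mem_nhdsWithin] with p hp using smul_mem_body hp ht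

theorem tendsto_traction_dilate (M : Material) {σ t : ℝ} (ht : 0 < t) {U : Disp} {x : ℝ}
    {s : Fin 2 → ℂ} (h : Tendsto (traction M U) (𝓝[body σ] (t * x, 0)) (𝓝 s)) :
    Tendsto (traction M (dilate t U)) (𝓝[body σ] (x, 0)) (𝓝 ((t : ℂ) • s)) := by
  refine ((h.comp (tendsto_smul_nhdsWithin_body σ ht x)).const_smul (t : ℂ)).congr fun p => ?_
  funext i
  exact (stress_dilate M t U 1 i p).symm

theorem isSingularSolution_dilate {m : Bimaterial} {t : ℝ} (ht : 0 < t) {U : Disp}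
    (hU : IsSingularSolution m U) : IsSingularSolution m (dilate t U) where
  offLine p hp := hU.offLine _ (by simp [hp])
  equilibriumPlus := by
    have h := hU.equilibriumPlus
    rw [← body_one] at h ⊢
    exact isEquilibrium_dilate ht h
  equilibriumMinus := by
    have h := hU.equilibriumMinus
    rw [← body_neg_one] at h ⊢
    exact isEquilibrium_dilate ht h
  traces x hx := by
    obtain ⟨⟨a, ha⟩, b, hb⟩ := hU.traces (t * x) (mul_pos ht hx)
    rw [fromAbove, ← body_one] at ha
    rw [fromBelow, ← body_neg_one] at hb
    rw [fromAbove, fromBelow, ← body_one, ← body_neg_one]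
    exact ⟨⟨a, ha.comp (tendsto_smul_nhdsWithin_body 1 ht x)⟩, b,
      hb.comp (tendsto_smul_nhdsWithin_body (-1) ht x)⟩
  continuous x hx := by
    obtain ⟨a, ha, hb⟩ := hU.continuous (t * x) (mul_neg_of_pos_of_neg ht hx)
    rw [fromAbove, ← body_one] at ha
    rw [fromBelow, ← body_neg_one] at hb
    rw [fromAbove, fromBelow, ← body_one, ← body_neg_one]
    exact ⟨a, ha.comp (tendsto_smul_nhdsWithin_body 1 ht x),
      hb.comp (tendsto_smul_nhdsWithin_body (-1) ht x)⟩
  tractionContinuous x hx := by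
    obtain ⟨a, ha, hb⟩ := hU.tractionContinuous (t * x) (mul_neg_of_pos_of_neg ht hx)
    rw [fromAbove, ← body_one] at ha
    rw [fromBelow, ← body_neg_one] at hb
    rw [fromAbove, fromBelow, ← body_one, ← body_neg_one]
    exact ⟨_, tendsto_traction_dilate _ ht ha, tendsto_traction_dilate _ ht hb⟩
  tractionFree x hx := by
    obtain ⟨ha, hb⟩ := hU.tractionFree (t * x) (mul_pos ht hx)
    rw [fromAbove, ← body_one] at ha
    rw [fromBelow, ← body_neg_one] at hb
    rw [fromAbove, fromBelow, ← body_one, ← body_neg_one]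
    have h1 := tendsto_traction_dilate _ ht ha
    have h2 := tendsto_traction_dilate _ ht hb
    rw [smul_zero] at h1 h2
    exact ⟨h1, h2⟩
  homogeneous := by
    obtain ⟨A, B, hA, hB, h⟩ := hU.homogeneous
    have hd : ∀ {z : ℂ} {A : Disp}, IsHomogeneous z A → IsHomogeneous z (dilate t A) :=
      fun {z A} hA s hs p hp => by
        have hp' : (t • p).2 ≠ 0 := by simpa [ht.ne'] using hp
        rw [dilate, smul_comm, hA s hs _ hp', dilate]
    refine ⟨dilate t A, dilate t B, hd hA, hd hB, fun p hp => h _ ?_⟩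
    simpa [ht.ne'] using hp

/-! ### The modes of the interface crack -/

/-- The field with Kolosov-Muskhelishvili coefficients `A`, `C` in the upper and `-(μ₊/μ₋) A`,
`-(μ₊/μ₋) C` in the lower half-plane, both with traction-free positive half-axis. -/
noncomputable def modeField (m : Bimaterial) (l A C : ℂ) : Disp := fun p =>
  if 0 < p.2 then kolField 1 m.plus.kappa l A C (-(A + l * C)) (-(C + l * A)) p
  else if p.2 < 0 then
    kolField (-1) m.minus.kappa l (-(m.plus.mu / m.minus.mu) * A) (-(m.plus.mu / m.minus.mu) * C)
      (-(-(m.plus.mu / m.minus.mu) * A + l * (-(m.plus.mu / m.minus.mu) * C)))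
      (-(-(m.plus.mu / m.minus.mu) * C + l * (-(m.plus.mu / m.minus.mu) * A))) p
  else 0

theorem kolField_smul_add (σ : ℝ) (κ l A C E F A' C' E' F' c c' : ℂ) (p : ℝ × ℝ) :
    kolField σ κ l (c * A + c' * A') (c * C + c' * C') (c * E + c' * E') (c * F + c' * F') p =
      c • kolField σ κ l A C E F p + c' • kolField σ κ l A' C' E' F' p := by
  funext i
  fin_cases i <;> simp [kolField, kolDisp] <;> ring

theorem modeField_eq (m : Bimaterial) (l A C : ℂ) :
    modeField m l A C = A • modeField m l 1 0 + C • modeField m l 0 1 := by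
  funext p
  simp only [modeField, Pi.add_apply, Pi.smul_apply]
  split_ifs
  · rw [← kolField_smul_add]
    congr 1 <;> ring
  · rw [← kolField_smul_add]
    congr 1 <;> ring
  · simp

/-- The condition on the degree under which the displacements of `modeField` with coefficient
`A ≠ 0` (for `s = 1`), respectively `C ≠ 0` (for `s = -1`), are continuous ahead of the crack. -/
def IsCrackDegree (m : Bimaterial) (s : ℝ) (l : ℂ) : Prop :=
  Complex.exp (2 * Real.pi * m.eps : ℝ) * Complex.exp (s * (Complex.I * Real.pi * l)) +
    Complex.exp (-(s * (Complex.I * Real.pi * l))) = 0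

/-- The continuity of displacements across the interface, for a coefficient `A`. -/
theorem mode_continuity_iff (m : Bimaterial) (A q : ℂ) :
    A * (m.plus.kappa * Complex.exp q + Complex.exp (-q)) =
      -(m.plus.mu / m.minus.mu) * A * (m.minus.kappa * Complex.exp (-q) + Complex.exp q) ↔
    A = 0 ∨ Complex.exp (2 * Real.pi * m.eps : ℝ) * Complex.exp q + Complex.exp (-q) = 0 := by
  have h := m.exp_two_pi_eps_mul
  have h' : Complex.exp (2 * Real.pi * m.eps : ℝ) *
      (m.minus.mu + m.minus.kappa * m.plus.mu) = m.plus.mu + m.plus.kappa * m.minus.mu := by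
    rw [← Complex.ofReal_exp, Material.kappa, Material.kappa]
    exact_mod_cast h
  have hmu : (m.minus.mu : ℂ) ≠ 0 := Complex.ofReal_ne_zero.2 m.minus.mu_pos.ne'
  have hD : ((m.minus.mu : ℂ) + m.minus.kappa * m.plus.mu) ≠ 0 := by
    have h1 := m.minus.nu_lt
    have h2 : m.minus.mu + m.minus.kappa * m.plus.mu ≠ 0 := by
      rw [Material.kappa]
      have := m.minus.mu_pos
      have := mul_pos (by linarith : 0 < 3 - 4 * m.minus.nu) m.plus.mu_pos
      positivity
    exact_mod_cast h2
  have key : m.minus.mu * (A * (m.plus.kappa * Complex.exp q + Complex.exp (-q)) -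
      -(m.plus.mu / m.minus.mu) * A * (m.minus.kappa * Complex.exp (-q) + Complex.exp q)) =
      A * (Complex.exp (2 * Real.pi * m.eps : ℝ) * Complex.exp q + Complex.exp (-q)) *
        (m.minus.mu + m.minus.kappa * m.plus.mu) := by
    have e : (m.minus.mu : ℂ) * (m.plus.mu / m.minus.mu) = m.plus.mu := by field_simp
    linear_combination A * (m.minus.kappa * Complex.exp (-q) + Complex.exp q) * e -
      A * Complex.exp q * h'
  rw [← sub_eq_zero, ← mul_right_inj' hmu, mul_zero, key, mul_eq_zero, mul_eq_zero]
  simp [hD]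

theorem modeField_upper (m : Bimaterial) (l A C : ℂ) {p : ℝ × ℝ} (hp : p ∈ body 1) :
    modeField m l A C p = kolField 1 m.plus.kappa l A C (-(A + l * C)) (-(C + l * A)) p :=
  if_pos (by simpa [body] using hp)

theorem modeField_lower (m : Bimaterial) (l A C : ℂ) {p : ℝ × ℝ} (hp : p ∈ body (-1)) :
    modeField m l A C p =
    kolField (-1) m.minus.kappa l (-(m.plus.mu / m.minus.mu) * A) (-(m.plus.mu / m.minus.mu) * C)
      (-(-(m.plus.mu / m.minus.mu) * A + l * (-(m.plus.mu / m.minus.mu) * C)))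
      (-(-(m.plus.mu / m.minus.mu) * C + l * (-(m.plus.mu / m.minus.mu) * A))) p := by
  have hp' : p.2 < 0 := by simpa [body] using hp
  rw [modeField, if_neg hp'.not_gt, if_pos hp']

section Congr

variable {σ : ℝ} {M : Material} {U V : Disp}

theorem stress_congr (h : ∀ p ∈ body σ, U p = V p) (i j : Fin 2) {p : ℝ × ℝ} (hp : p ∈ body σ) :
    stress M U i j p = stress M V i j p := by
  have hpd : ∀ a k, pd a (fun q => U q k) p = pd a (fun q => V q k) p := fun a k => by
    have : (fun q => U q k) =ᶠ[𝓝 p] fun q => V q k := by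
      filter_upwards [(isOpen_body σ).mem_nhds hp] with q hq
      rw [h q hq]
    rw [pd, pd, this.fderiv_eq]
  simp only [stress, hpd]

theorem IsEquilibrium.congr (hV : IsEquilibrium M (body σ) V) (h : ∀ p ∈ body σ, U p = V p) :
    IsEquilibrium M (body σ) U := by
  refine ⟨hV.1.congr h, fun p hp i => ?_⟩
  rw [← hV.2 p hp i]
  refine Finset.sum_congr rfl fun j _ => ?_
  have : stress M U i j =ᶠ[𝓝 p] stress M V i j := by
    filter_upwards [(isOpen_body σ).mem_nhds hp] with q hq using stress_congr h i j hq
  rw [pd, pd, this.fderiv_eq]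

theorem tendsto_congr_body (h : ∀ p ∈ body σ, U p = V p) {x : ℝ} {a : Fin 2 → ℂ}
    (hV : Tendsto V (𝓝[body σ] (x, 0)) (𝓝 a)) : Tendsto U (𝓝[body σ] (x, 0)) (𝓝 a) :=
  hV.congr' (by filter_upwards [self_mem_nhdsWithin] with p hp using (h p hp).symm)

theorem tendsto_traction_congr_body (h : ∀ p ∈ body σ, U p = V p) {x : ℝ} {a : Fin 2 → ℂ}
    (hV : Tendsto (traction M V) (𝓝[body σ] (x, 0)) (𝓝 a)) :
    Tendsto (traction M U) (𝓝[body σ] (x, 0)) (𝓝 a) :=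
  hV.congr' (by
    filter_upwards [self_mem_nhdsWithin] with p hp
    funext i
    exact (stress_congr h 1 i hp).symm)

end Congr

/-! ### The space of singular solutions -/

/-- The degrees `-1/2 + iε` (for `δ = 1`) and `-1/2 - iε` (for `δ = -1`). -/
noncomputable def crackDegree (m : Bimaterial) (δ : ℝ) : ℂ :=
  -(1 / 2) + δ * (Complex.I * m.eps)

section Degrees

variable (m : Bimaterial)

theorem crackDegree_re (δ : ℝ) : (crackDegree m δ).re = -(1 / 2) := by
  simp [crackDegree]

theorem crackDegree_ne_zero (δ : ℝ) : crackDegree m δ ≠ 0 := fun h => by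
  have := crackDegree_re m δ
  rw [h] at this
  norm_num at this

theorem exp_crackDegree {s : ℝ} (hs : s = 1 ∨ s = -1) (δ : ℝ) :
    Complex.exp (s * (Complex.I * Real.pi * crackDegree m δ)) =
      -(s * Complex.I) * Real.exp (-(s * δ * (Real.pi * m.eps))) := by
  have e : (s * (Complex.I * Real.pi * crackDegree m δ) : ℂ) =
      s * -(Real.pi / 2 * Complex.I) + (-(s * δ * (Real.pi * m.eps)) : ℝ) := by
    rw [crackDegree]
    push_cast
    linear_combination (s * Real.pi * δ * m.eps : ℂ) * Complex.I_mul_I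
  have hI : Complex.exp (s * -(Real.pi / 2 * Complex.I)) = -(s * Complex.I) := by
    rcases hs with rfl | rfl
    · rw [Complex.ofReal_one, one_mul, Complex.exp_neg, Complex.exp_pi_div_two_mul_I]
      simp
    · rw [Complex.ofReal_neg, Complex.ofReal_one, neg_mul, one_mul, neg_neg,
        Complex.exp_pi_div_two_mul_I]
      simp
  rw [e, Complex.exp_add, hI, Complex.ofReal_exp]

theorem exp_neg_crackDegree {s : ℝ} (hs : s = 1 ∨ s = -1) (δ : ℝ) :
    Complex.exp (-(s * (Complex.I * Real.pi * crackDegree m δ))) =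
      s * Complex.I * Real.exp (s * δ * (Real.pi * m.eps)) := by
  have h := exp_crackDegree m (neg_eq_one_or hs) δ
  push_cast at h ⊢
  simpa using h

/-- Of the two degrees, `-1/2 + iε` is the one for the coefficient `A` and `-1/2 - iε` the one for
the coefficient `C`, unless `ε = 0`. -/
theorem isCrackDegree_iff {s : ℝ} (hs : s = 1 ∨ s = -1) (δ : ℝ) :
    IsCrackDegree m s (crackDegree m δ) ↔ (s * δ - 1) * m.eps = 0 := by
  have hs0 : (s : ℂ) * Complex.I ≠ 0 := by
    rcases hs with rfl | rfl <;> simp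
  rw [IsCrackDegree, exp_crackDegree m hs, exp_neg_crackDegree m hs, ← Complex.ofReal_exp]
  have e : ((Real.exp (2 * Real.pi * m.eps) : ℝ) : ℂ) *
      (-(s * Complex.I) * (Real.exp (-(s * δ * (Real.pi * m.eps))) : ℝ)) +
      s * Complex.I * (Real.exp (s * δ * (Real.pi * m.eps)) : ℝ) =
      s * Complex.I * ((Real.exp (s * δ * (Real.pi * m.eps)) -
        Real.exp (2 * Real.pi * m.eps + -(s * δ * (Real.pi * m.eps))) : ℝ) : ℂ) := by
    rw [Real.exp_add]; push_cast; ring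
  rw [e, mul_eq_zero, or_iff_right hs0, Complex.ofReal_eq_zero, sub_eq_zero, Real.exp_eq_exp]
  have hpi := Real.pi_pos.ne'
  constructor
  · intro h
    refine mul_left_cancel₀ hpi ?_
    linear_combination h / 2
  · intro h
    linear_combination 2 * Real.pi * h

/-- The common factor of the tractions ahead of the crack does not vanish. -/
theorem exp_sub_exp_crackDegree_ne_zero (δ : ℝ) :
    Complex.exp (-(Complex.I * Real.pi * crackDegree m δ)) -
      Complex.exp (Complex.I * Real.pi * crackDegree m δ) ≠ 0 := by
  have h1 := exp_crackDegree m (Or.inl rfl) δ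
  have h2 := exp_neg_crackDegree m (Or.inl rfl) δ
  rw [Complex.ofReal_one, one_mul] at h1 h2
  rw [h1, h2]
  have e : (1 : ℂ) * Complex.I * (Real.exp (1 * δ * (Real.pi * m.eps)) : ℝ) -
      -(1 * Complex.I) * (Real.exp (-(1 * δ * (Real.pi * m.eps))) : ℝ) =
      Complex.I * ((Real.exp (1 * δ * (Real.pi * m.eps)) +
        Real.exp (-(1 * δ * (Real.pi * m.eps))) : ℝ) : ℂ) := by push_cast; ring
  rw [e]
  refine mul_ne_zero Complex.I_ne_zero (Complex.ofReal_ne_zero.2 ?_)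
  positivity

end Degrees

section Modes

variable {m : Bimaterial}

theorem tendsto_modeField_above (l A C : ℂ) {x : ℝ} (hx : x ≠ 0) :
    Tendsto (modeField m l A C) (fromAbove x)
      (𝓝 (kolField 1 m.plus.kappa l A C (-(A + l * C)) (-(C + l * A)) (x, 0))) := by
  rw [fromAbove, ← body_one]
  exact tendsto_congr_body (fun p hp => modeField_upper m l A C hp)
    (tendsto_kolField (Or.inl rfl) _ _ _ _ _ _ hx)

theorem tendsto_modeField_below (l A C : ℂ) {x : ℝ} (hx : x ≠ 0) :
    Tendsto (modeField m l A C) (fromBelow x)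
      (𝓝 (kolField (-1) m.minus.kappa l (-(m.plus.mu / m.minus.mu) * A)
        (-(m.plus.mu / m.minus.mu) * C)
        (-(-(m.plus.mu / m.minus.mu) * A + l * (-(m.plus.mu / m.minus.mu) * C)))
        (-(-(m.plus.mu / m.minus.mu) * C + l * (-(m.plus.mu / m.minus.mu) * A))) (x, 0))) := by
  rw [fromBelow, ← body_neg_one]
  exact tendsto_congr_body (fun p hp => modeField_lower m l A C hp)
    (tendsto_kolField (Or.inr rfl) _ _ _ _ _ _ hx)

theorem tendsto_traction_modeField_above (l A C : ℂ) {x : ℝ} (hx : x ≠ 0) :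
    Tendsto (traction m.plus (modeField m l A C)) (fromAbove x)
      (𝓝 (kolTraction 1 m.plus.mu l A C (-(A + l * C)) (-(C + l * A)) (x, 0))) := by
  rw [fromAbove, ← body_one]
  exact tendsto_traction_congr_body (fun p hp => modeField_upper m l A C hp)
    (tendsto_traction_kolField (Or.inl rfl) _ _ _ _ _ _ hx)

theorem tendsto_traction_modeField_below (l A C : ℂ) {x : ℝ} (hx : x ≠ 0) :
    Tendsto (traction m.minus (modeField m l A C)) (fromBelow x)
      (𝓝 (kolTraction (-1) m.minus.mu l (-(m.plus.mu / m.minus.mu) * A)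
        (-(m.plus.mu / m.minus.mu) * C)
        (-(-(m.plus.mu / m.minus.mu) * A + l * (-(m.plus.mu / m.minus.mu) * C)))
        (-(-(m.plus.mu / m.minus.mu) * C + l * (-(m.plus.mu / m.minus.mu) * A))) (x, 0))) := by
  rw [fromBelow, ← body_neg_one]
  exact tendsto_traction_congr_body (fun p hp => modeField_lower m l A C hp)
    (tendsto_traction_kolField (Or.inr rfl) _ _ _ _ _ _ hx)

theorem kolTraction_of_pos {σ : ℝ} (hσ : σ = 1 ∨ σ = -1) (μ l A C : ℂ) {x : ℝ} (hx : 0 < x) :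
    kolTraction σ μ l A C (-(A + l * C)) (-(C + l * A)) (x, 0) = 0 := by
  have h1 := kolTrac_of_pos hσ (τ := 1) (Or.inl rfl) l A C (-(A + l * C)) hx
  have h2 := kolTrac_of_pos hσ (τ := -1) (Or.inr rfl) l C A (-(C + l * A)) hx
  rw [add_neg_cancel, zero_mul] at h1 h2
  funext i
  fin_cases i <;> simp only [kolTraction, h1, h2] <;> simp

theorem isHomogeneous_modeField (m : Bimaterial) (l A C : ℂ) :
    IsHomogeneous l (modeField m l A C) := by
  have hd : ∀ {σ τ : ℝ}, (σ = 1 ∨ σ = -1) → (τ = 1 ∨ τ = -1) → ∀ (κ A C E : ℂ) {t : ℝ}, 0 < t →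
      ∀ p ∈ body σ, kolDisp σ τ κ l A C E (t • p) = (t : ℂ) ^ l * kolDisp σ τ κ l A C E p := by
    intro σ τ hσ hτ κ A C E t ht p hp
    have hτ' := neg_eq_one_or hτ
    have ht0 : (t : ℂ) ≠ 0 := Complex.ofReal_ne_zero.2 ht.ne'
    simp only [kolDisp, pw_smul hσ hτ _ hp ht, pw_smul hσ hτ' _ hp ht, zc_smul]
    rw [Complex.cpow_sub _ _ ht0, Complex.cpow_one]
    field_simp
  have hk : ∀ {σ : ℝ}, (σ = 1 ∨ σ = -1) → ∀ (κ A C E F : ℂ) {t : ℝ}, 0 < t → ∀ p ∈ body σ,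
      kolField σ κ l A C E F (t • p) = (t : ℂ) ^ l • kolField σ κ l A C E F p := by
    intro σ hσ κ A C E F t ht p hp
    have h1 := hd hσ (τ := 1) (Or.inl rfl) κ A C E ht p hp
    have h2 := hd hσ (τ := -1) (Or.inr rfl) κ C A F ht p hp
    funext i
    fin_cases i <;> simp [kolField, h1, h2] <;> ring
  intro t ht p hp
  rcases hp.lt_or_gt with h | h
  · have hb : p ∈ body (-1) := by simpa [body] using h
    rw [modeField_lower m l A C hb, modeField_lower m l A C (smul_mem_body hb ht)]
    exact hk (Or.inr rfl) _ _ _ _ _ ht p hb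
  · have hb : p ∈ body 1 := by simpa [body] using h
    rw [modeField_upper m l A C hb, modeField_upper m l A C (smul_mem_body hb ht)]
    exact hk (Or.inl rfl) _ _ _ _ _ ht p hb

/-- The factor `-μ₊/μ₋` of the lower coefficients makes the tractions continuous ahead of the crack. -/
theorem kolTraction_continuous (m : Bimaterial) (l A C : ℂ) {x : ℝ} (hx : x < 0) :
    kolTraction 1 m.plus.mu l A C (-(A + l * C)) (-(C + l * A)) (x, 0) =
      kolTraction (-1) m.minus.mu l (-(m.plus.mu / m.minus.mu) * A)
        (-(m.plus.mu / m.minus.mu) * C)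
        (-(-(m.plus.mu / m.minus.mu) * A + l * (-(m.plus.mu / m.minus.mu) * C)))
        (-(-(m.plus.mu / m.minus.mu) * C + l * (-(m.plus.mu / m.minus.mu) * A))) (x, 0) := by
  have hmu : (m.minus.mu : ℂ) ≠ 0 := Complex.ofReal_ne_zero.2 m.minus.mu_pos.ne'
  rw [kolTraction, kolTraction, vec_eq_iff', kolTrac_of_neg (Or.inl rfl) (Or.inl rfl) _ _ _ hx,
    kolTrac_of_neg (Or.inl rfl) (Or.inr rfl) _ _ _ hx,
    kolTrac_of_neg (Or.inr rfl) (Or.inl rfl) _ _ _ hx,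
    kolTrac_of_neg (Or.inr rfl) (Or.inr rfl) _ _ _ hx]
  simp only [Complex.ofReal_one, Complex.ofReal_neg, one_mul, neg_mul, mul_neg, neg_neg]
  constructor <;> field_simp <;> ring

theorem kolField_continuous_iff (m : Bimaterial) (l A C : ℂ) {x : ℝ} (hx : x < 0) :
    kolField 1 m.plus.kappa l A C (-(A + l * C)) (-(C + l * A)) (x, 0) =
      kolField (-1) m.minus.kappa l (-(m.plus.mu / m.minus.mu) * A)
        (-(m.plus.mu / m.minus.mu) * C)
        (-(-(m.plus.mu / m.minus.mu) * A + l * (-(m.plus.mu / m.minus.mu) * C)))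
        (-(-(m.plus.mu / m.minus.mu) * C + l * (-(m.plus.mu / m.minus.mu) * A))) (x, 0) ↔
      (A = 0 ∨ IsCrackDegree m 1 l) ∧ (C = 0 ∨ IsCrackDegree m (-1) l) := by
  have hx' : ((-x : ℝ) : ℂ) ^ l ≠ 0 := by
    have h : ((-x : ℝ) : ℂ) ≠ 0 := Complex.ofReal_ne_zero.2 (by linarith)
    rw [Complex.cpow_def_of_ne_zero h]
    exact Complex.exp_ne_zero _
  rw [kolField, kolField, vec_eq_iff, kolDisp_of_neg (Or.inl rfl) (Or.inl rfl) _ _ _ _ hx,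
    kolDisp_of_neg (Or.inl rfl) (Or.inr rfl) _ _ _ _ hx,
    kolDisp_of_neg (Or.inr rfl) (Or.inl rfl) _ _ _ _ hx,
    kolDisp_of_neg (Or.inr rfl) (Or.inr rfl) _ _ _ _ hx, IsCrackDegree, IsCrackDegree,
    ← mode_continuity_iff, ← mode_continuity_iff]
  have h : ∀ a u b v : ℂ, a * ((-x : ℝ) : ℂ) ^ l * u = b * ((-x : ℝ) : ℂ) ^ l * v ↔
      a * u = b * v := fun a u b v => by
    rw [mul_right_comm, mul_right_comm b, mul_left_inj' hx']
  rw [h, h]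
  simp only [Complex.ofReal_one, Complex.ofReal_neg, one_mul, neg_mul, mul_neg, neg_neg]

theorem isSingularSolution_modeField {δ : ℝ} (hδ : δ = 1 ∨ δ = -1) {A C : ℂ}
    (hA : A = 0 ∨ IsCrackDegree m 1 (crackDegree m δ))
    (hC : C = 0 ∨ IsCrackDegree m (-1) (crackDegree m δ)) :
    IsSingularSolution m (modeField m (crackDegree m δ) A C) where
  offLine p hp := by simp [modeField, hp]
  equilibriumPlus := by
    rw [← body_one]
    exact (isEquilibrium_kolField (Or.inl rfl) _ _ _ _ _ _).congr
      fun p hp => modeField_upper m _ A C hp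
  equilibriumMinus := by
    rw [← body_neg_one]
    exact (isEquilibrium_kolField (Or.inr rfl) _ _ _ _ _ _).congr
      fun p hp => modeField_lower m _ A C hp
  traces x hx := ⟨⟨_, tendsto_modeField_above _ A C hx.ne'⟩, _,
    tendsto_modeField_below _ A C hx.ne'⟩
  continuous x hx := ⟨_, tendsto_modeField_above _ A C hx.ne, by
    rw [(kolField_continuous_iff m _ A C hx).2 ⟨hA, hC⟩]
    exact tendsto_modeField_below _ A C hx.ne⟩
  tractionContinuous x hx := ⟨_, tendsto_traction_modeField_above _ A C hx.ne, by
    rw [kolTraction_continuous m _ A C hx]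
    exact tendsto_traction_modeField_below _ A C hx.ne⟩
  tractionFree x hx := by
    have h1 := tendsto_traction_modeField_above (m := m) (crackDegree m δ) A C hx.ne'
    have h2 := tendsto_traction_modeField_below (m := m) (crackDegree m δ) A C hx.ne'
    rw [kolTraction_of_pos (Or.inl rfl) _ _ _ _ hx] at h1
    rw [kolTraction_of_pos (Or.inr rfl) _ _ _ _ hx] at h2
    exact ⟨h1, h2⟩
  homogeneous := by
    have h := isHomogeneous_modeField m (crackDegree m δ) A C
    have h0 : ∀ z, IsHomogeneous z 0 := fun z t _ p _ => by simp
    rcases hδ with rfl | rfl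
    · refine ⟨_, 0, ?_, h0 _, fun p _ => (add_zero _).symm⟩
      convert h using 1
      simp [crackDegree]
    · refine ⟨0, _, h0 _, ?_, fun p _ => (zero_add _).symm⟩
      convert h using 1
      simp [crackDegree, sub_eq_add_neg]

/-- Vanishing of the traction at one point of the positive half-axis determines the coefficients of
the second potential. -/
theorem coeff_eq_of_kolTraction_eq_zero {σ : ℝ} (hσ : σ = 1 ∨ σ = -1) {μ l A C E F : ℂ}
    (hμ : μ * l ≠ 0) (h : kolTraction σ μ l A C E F (1, 0) = 0) :
    E = -(A + l * C) ∧ F = -(C + l * A) := by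
  have h0 : (0 : Fin 2 → ℂ) = ![0 * Complex.I * (0 - 0), 0 * (0 + 0)] := by
    funext i
    fin_cases i <;> simp
  rw [kolTraction, h0, vec_eq_iff', zero_mul, kolTrac_of_pos hσ (Or.inl rfl) _ _ _ _ one_pos,
    kolTrac_of_pos hσ (Or.inr rfl) _ _ _ _ one_pos] at h
  simp only [Complex.ofReal_one, Complex.one_cpow, mul_one] at h
  have h1 := (mul_eq_zero.1 h.1).resolve_left hμ
  have h2 := (mul_eq_zero.1 h.2).resolve_left hμ
  exact ⟨by linear_combination h1, by linear_combination h2⟩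

/-- A homogeneous singular solution is a mode. -/
theorem IsSingularSolution.exists_eq_modeField {U : Disp} (hU : IsSingularSolution m U) {l : ℂ}
    (hl : l ≠ 0) (hne : Complex.exp (-(Complex.I * Real.pi * l)) -
      Complex.exp (Complex.I * Real.pi * l) ≠ 0) (hh : IsHomogeneous l U) :
    ∃ A C : ℂ, U = modeField m l A C ∧ (A = 0 ∨ IsCrackDegree m 1 l) ∧
      (C = 0 ∨ IsCrackDegree m (-1) l) := by
  have hmu : (m.minus.mu : ℂ) ≠ 0 := Complex.ofReal_ne_zero.2 m.minus.mu_pos.ne'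
  have hmu' : (m.plus.mu : ℂ) ≠ 0 := Complex.ofReal_ne_zero.2 m.plus.mu_pos.ne'
  -- by homogeneity it suffices to evaluate the boundary conditions at `x₁ = 1` and `x₁ = -1`
  have hhσ : ∀ σ : ℝ, ∀ i, HomogeneousOn σ l fun q => U q i := fun σ i t ht p hp => by
    have hp0 : p.2 ≠ 0 := fun h => by simp [body, h] at hp
    simp only [hh t ht p hp0, Pi.smul_apply, smul_eq_mul]
  obtain ⟨A, C, E, F, h1⟩ := exists_eq_kolField (Or.inl rfl) (body_one ▸ hU.equilibriumPlus) hl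
    (hhσ 1)
  obtain ⟨A', C', E', F', h2⟩ := exists_eq_kolField (Or.inr rfl)
    (body_neg_one ▸ hU.equilibriumMinus) hl (hhσ (-1))
  have := neBot_nhdsWithin_body (σ := 1) (Or.inl rfl)
  have := neBot_nhdsWithin_body (σ := -1) (Or.inr rfl)
  have f1 := hU.tractionFree 1 one_pos
  have c1 := hU.continuous (-1) (by norm_num)
  have t1 := hU.tractionContinuous (-1) (by norm_num)
  rw [fromAbove, fromBelow, ← body_one, ← body_neg_one] at f1 c1 t1
  have k1 := fun x (hx : x ≠ 0) => tendsto_congr_body h1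
    (tendsto_kolField (Or.inl rfl) m.plus.kappa l A C E F (x := x) hx)
  have k2 := fun x (hx : x ≠ 0) => tendsto_congr_body h2
    (tendsto_kolField (Or.inr rfl) m.minus.kappa l A' C' E' F' (x := x) hx)
  have s1 := fun x (hx : x ≠ 0) => tendsto_traction_congr_body h1
    (tendsto_traction_kolField (Or.inl rfl) m.plus l A C E F (x := x) hx)
  have s2 := fun x (hx : x ≠ 0) => tendsto_traction_congr_body h2
    (tendsto_traction_kolField (Or.inr rfl) m.minus l A' C' E' F' (x := x) hx)
  obtain ⟨rfl, rfl⟩ := coeff_eq_of_kolTraction_eq_zero (Or.inl rfl) (mul_ne_zero hmu' hl)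
    (tendsto_nhds_unique (s1 1 one_ne_zero) f1.1)
  obtain ⟨rfl, rfl⟩ := coeff_eq_of_kolTraction_eq_zero (Or.inr rfl) (mul_ne_zero hmu hl)
    (tendsto_nhds_unique (s2 1 one_ne_zero) f1.2)
  have hm1 : (-1 : ℝ) ≠ 0 := by norm_num
  have hneg : (-1 : ℝ) < 0 := by norm_num
  obtain ⟨a, ha, ha'⟩ := c1
  obtain ⟨s, hs, hs'⟩ := t1
  have ht := (tendsto_nhds_unique (s1 (-1) hm1) hs).trans
    (tendsto_nhds_unique (s2 (-1) hm1) hs').symm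
  have hc := (tendsto_nhds_unique (k1 (-1) hm1) ha).trans
    (tendsto_nhds_unique (k2 (-1) hm1) ha').symm
  rw [kolTraction, kolTraction, vec_eq_iff', kolTrac_of_neg (Or.inl rfl) (Or.inl rfl) _ _ _ hneg,
    kolTrac_of_neg (Or.inl rfl) (Or.inr rfl) _ _ _ hneg,
    kolTrac_of_neg (Or.inr rfl) (Or.inl rfl) _ _ _ hneg,
    kolTrac_of_neg (Or.inr rfl) (Or.inr rfl) _ _ _ hneg] at ht
  simp only [Complex.ofReal_one, Complex.ofReal_neg, one_mul, neg_mul, mul_neg, neg_neg,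
    Complex.one_cpow, mul_one] at ht
  have e : (m.minus.mu : ℂ) * (m.plus.mu / m.minus.mu) = m.plus.mu := by field_simp
  have hA' : A' = -(m.plus.mu / m.minus.mu) * A := by
    have h : (m.minus.mu * l * (Complex.exp (-(Complex.I * Real.pi * l)) -
        Complex.exp (Complex.I * Real.pi * l))) * A' = (m.minus.mu * l *
        (Complex.exp (-(Complex.I * Real.pi * l)) - Complex.exp (Complex.I * Real.pi * l))) *
        (-(m.plus.mu / m.minus.mu) * A) := by
      linear_combination ht.1 + l * (Complex.exp (-(Complex.I * Real.pi * l)) -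
        Complex.exp (Complex.I * Real.pi * l)) * A * e
    exact mul_left_cancel₀ (mul_ne_zero (mul_ne_zero hmu hl) hne) h
  have hC' : C' = -(m.plus.mu / m.minus.mu) * C := by
    have h : (m.minus.mu * l * (Complex.exp (-(Complex.I * Real.pi * l)) -
        Complex.exp (Complex.I * Real.pi * l))) * C' = (m.minus.mu * l *
        (Complex.exp (-(Complex.I * Real.pi * l)) - Complex.exp (Complex.I * Real.pi * l))) *
        (-(m.plus.mu / m.minus.mu) * C) := by
      linear_combination -ht.2 + l * (Complex.exp (-(Complex.I * Real.pi * l)) -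
        Complex.exp (Complex.I * Real.pi * l)) * C * e
    exact mul_left_cancel₀ (mul_ne_zero (mul_ne_zero hmu hl) hne) h
  subst hA' hC'
  refine ⟨A, C, ?_, (kolField_continuous_iff m l A C hneg).1 hc⟩
  funext p
  rcases lt_trichotomy p.2 0 with h | h | h
  · have hb : p ∈ body (-1) := by simpa [body] using h
    rw [h2 p hb, modeField_lower m l A C hb]
  · rw [hU.offLine p h]
    simp [modeField, h]
  · have hb : p ∈ body 1 := by simpa [body] using h
    rw [h1 p hb, modeField_upper m l A C hb]

end Modes

/-! ### Laplace transforms of powers -/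

section Laplace

theorem norm_cpow_mul_exp (a r : ℂ) {x : ℝ} (hx : 0 < x) :
    ‖(x : ℂ) ^ a * Complex.exp (-(r * x))‖ = x ^ a.re * Real.exp (-(r.re * x)) := by
  rw [norm_mul, Complex.norm_cpow_eq_rpow_re_of_pos hx, Complex.norm_exp]
  simp

theorem continuousOn_cpow_mul_exp (a r : ℂ) :
    ContinuousOn (fun x : ℝ => (x : ℂ) ^ a * Complex.exp (-(r * x))) (Set.Ioi 0) := by
  intro x hx
  refine ContinuousAt.continuousWithinAt (ContinuousAt.mul ?_ ?_)
  · exact Complex.continuousAt_ofReal_cpow_const _ _ (Or.inr (ne_of_gt hx))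
  · fun_prop

theorem integrableOn_rpow_mul_exp {a r : ℝ} (ha : -1 < a) (hr : 0 < r) :
    IntegrableOn (fun x : ℝ => x ^ a * Real.exp (-(r * x))) (Set.Ioi 0) := by
  have h := integrableOn_rpow_mul_exp_neg_mul_rpow ha one_pos hr
  simpa only [Real.rpow_one, neg_mul] using h

theorem integrableOn_cpow_mul_exp {a r : ℂ} (ha : -1 < a.re) (hr : 0 < r.re) :
    IntegrableOn (fun x : ℝ => (x : ℂ) ^ a * Complex.exp (-(r * x))) (Set.Ioi 0) := by
  refine (integrableOn_rpow_mul_exp ha hr).mono'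
    ((continuousOn_cpow_mul_exp a r).aestronglyMeasurable measurableSet_Ioi) ?_
  filter_upwards [ae_restrict_mem measurableSet_Ioi] with x hx
  exact (norm_cpow_mul_exp a r hx).le

theorem differentiableAt_laplace_cpow {a r : ℂ} (ha : -1 < a.re) (hr : 0 < r.re) :
    DifferentiableAt ℂ
      (fun r : ℂ => ∫ x in Set.Ioi (0 : ℝ), (x : ℂ) ^ a * Complex.exp (-(r * x))) r := by
  have hs : {z : ℂ | r.re / 2 < z.re} ∈ 𝓝 r :=
    (isOpen_lt continuous_const Complex.continuous_re).mem_nhds (by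
      simp only [Set.mem_ofPred_eq]; linarith)
  have hc : ∀ r : ℂ, ContinuousOn
      (fun x : ℝ => (x : ℂ) ^ a * (Complex.exp (-(r * x)) * -x)) (Set.Ioi 0) := fun r => by
    have h := (continuousOn_cpow_mul_exp a r).mul
      (Complex.continuous_ofReal.neg.continuousOn (s := Set.Ioi (0 : ℝ)))
    exact h.congr fun x _ => (mul_assoc _ _ _).symm
  refine (hasDerivAt_integral_of_dominated_loc_of_deriv_le hs
    (F := fun (r : ℂ) (x : ℝ) => (x : ℂ) ^ a * Complex.exp (-(r * x)))
    (F' := fun (r : ℂ) (x : ℝ) => (x : ℂ) ^ a * (Complex.exp (-(r * x)) * -x))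
    (bound := fun x : ℝ => x ^ (a.re + 1) * Real.exp (-(r.re / 2 * x)))
    ?_ (integrableOn_cpow_mul_exp ha hr) ?_ ?_ ?_ ?_).2.differentiableAt
  · exact Eventually.of_forall fun z =>
      (continuousOn_cpow_mul_exp a z).aestronglyMeasurable measurableSet_Ioi
  · exact (hc r).aestronglyMeasurable measurableSet_Ioi
  · filter_upwards [ae_restrict_mem measurableSet_Ioi] with x hx z hz
    have hx' : (0 : ℝ) < x := hx
    have hz' : r.re / 2 < z.re := hz
    rw [← mul_assoc, norm_mul, norm_cpow_mul_exp a z hx', norm_neg, Complex.norm_of_nonneg hx'.le,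
      Real.rpow_add_one hx'.ne', mul_right_comm]
    gcongr
  · exact integrableOn_rpow_mul_exp (by linarith) (by linarith)
  · refine Eventually.of_forall fun x z _ => ?_
    have h0 : HasDerivAt (fun z : ℂ => z * x) x z := by
      simpa using (hasDerivAt_id z).mul_const (x : ℂ)
    have h : HasDerivAt (fun z : ℂ => -(z * x)) (-x) z := h0.neg
    exact h.cexp.const_mul _

/-- The Laplace transform of a power is given by the Gamma function, by analytic continuation
from the positive half-axis to the right half-plane. -/
theorem laplace_cpow {a r : ℂ} (ha : -1 < a.re) (hr : 0 < r.re) :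
    ∫ x in Set.Ioi (0 : ℝ), (x : ℂ) ^ a * Complex.exp (-(r * x)) =
      Complex.Gamma (a + 1) * Complex.exp (-((a + 1) * Complex.log r)) := by
  set H : Set ℂ := {z | 0 < z.re} with hH
  have hHo : IsOpen H := isOpen_lt continuous_const Complex.continuous_re
  have hf : AnalyticOnNhd ℂ
      (fun r : ℂ => ∫ x in Set.Ioi (0 : ℝ), (x : ℂ) ^ a * Complex.exp (-(r * x))) H :=
    DifferentiableOn.analyticOnNhd
      (fun z hz => (differentiableAt_laplace_cpow ha hz).differentiableWithinAt) hHo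
  have hg : AnalyticOnNhd ℂ
      (fun r : ℂ => Complex.Gamma (a + 1) * Complex.exp (-((a + 1) * Complex.log r))) H :=
    DifferentiableOn.analyticOnNhd (fun z hz =>
      ((((Complex.differentiableAt_log (Or.inl hz)).const_mul _).neg.cexp).const_mul
        _).differentiableWithinAt) hHo
  have hpre : IsPreconnected H := (convex_halfSpace_re_gt 0).isPreconnected
  refine hf.eqOn_of_preconnected_of_frequently_eq hg hpre (z₀ := 1) (by simp [hH]) ?_ hr
  have hreal : ∀ t : ℝ, 0 < t → ∫ x in Set.Ioi (0 : ℝ), (x : ℂ) ^ a * Complex.exp (-((t : ℂ) * x)) =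
      Complex.Gamma (a + 1) * Complex.exp (-((a + 1) * Complex.log t)) := fun t ht => by
    have h := Complex.integral_cpow_mul_exp_neg_mul_Ioi (a := a + 1) (r := t)
      (by simp; linarith) ht
    rw [add_sub_cancel_right] at h
    have ht0 : (t : ℂ) ≠ 0 := Complex.ofReal_ne_zero.2 ht.ne'
    have e : (1 / t : ℂ) ^ (a + 1) = Complex.exp (-((a + 1) * Complex.log t)) := by
      have h1 : Complex.log (1 / t : ℂ) = -Complex.log t := by
        rw [one_div, ← Complex.ofReal_inv, ← Complex.ofReal_log (inv_nonneg.2 ht.le), Real.log_inv,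
          Complex.ofReal_neg, Complex.ofReal_log ht.le]
      rw [Complex.cpow_def_of_ne_zero (one_div_ne_zero ht0), h1]
      congr 1; ring
    rw [h, e, mul_comm]
  have ht : Tendsto (fun t : ℝ => (t : ℂ)) (𝓝[>] 1) (𝓝[≠] 1) := by
    refine tendsto_nhdsWithin_iff.2 ⟨?_, ?_⟩
    · have := Complex.continuous_ofReal.tendsto 1
      rw [Complex.ofReal_one] at this
      exact this.mono_left nhdsWithin_le_nhds
    · filter_upwards [self_mem_nhdsWithin] with t ht h
      have h1 : (1 : ℝ) < t := ht
      have h2 : (t : ℂ) = 1 := h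
      exact h1.ne' (by exact_mod_cast h2)
  refine ht.frequently (Eventually.frequently ?_)
  filter_upwards [self_mem_nhdsWithin] with t ht
  exact hreal t (lt_trans one_pos ht)

theorem integrableOn_Ioi_cpow_mul_exp (a : ℂ) {r : ℂ} (hr : 0 < r.re) {δ : ℝ} (hδ : 0 < δ) :
    IntegrableOn (fun x : ℝ => (x : ℂ) ^ a * Complex.exp (-(r * x))) (Set.Ioi δ) := by
  have hsub : Set.Ioi δ ⊆ Set.Ioi 0 := Set.Ioi_subset_Ioi hδ.le
  -- on `(δ, ∞)` the power is dominated by one of higher exponent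
  have h := (integrableOn_rpow_mul_exp (a := |a.re|) (by linarith [abs_nonneg a.re])
    hr).mono_set hsub |>.const_mul (δ ^ (a.re - |a.re|))
  refine h.mono' (((continuousOn_cpow_mul_exp a r).mono hsub).aestronglyMeasurable
    measurableSet_Ioi) ?_
  filter_upwards [ae_restrict_mem measurableSet_Ioi] with x hx
  have hx' : δ < x := hx
  have hx0 : 0 < x := hδ.trans hx'
  rw [norm_cpow_mul_exp a r hx0, ← mul_assoc]
  refine mul_le_mul_of_nonneg_right ?_ (Real.exp_nonneg _)
  have e : x ^ a.re = x ^ (a.re - |a.re|) * x ^ |a.re| := by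
    rw [← Real.rpow_add hx0]; congr 1; ring
  rw [e]
  refine mul_le_mul_of_nonneg_right ?_ (Real.rpow_nonneg hx0.le _)
  exact Real.rpow_le_rpow_of_nonpos hδ hx'.le (by linarith [le_abs_self a.re])

theorem tendsto_cpow_mul_exp_atTop (a : ℂ) {r : ℂ} (hr : 0 < r.re) :
    Tendsto (fun x : ℝ => (x : ℂ) ^ a * Complex.exp (-(r * x))) atTop (𝓝 0) := by
  rw [tendsto_zero_iff_norm_tendsto_zero]
  refine (tendsto_rpow_mul_exp_neg_mul_atTop_nhds_zero a.re r.re hr).congr' ?_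
  filter_upwards [eventually_gt_atTop 0] with x hx
  rw [norm_cpow_mul_exp a r hx, neg_mul]

/-- Integration by parts. -/
theorem integral_Ioi_cpow_sub_one_mul_exp {l r : ℂ} (hl : l ≠ 0) (hr : 0 < r.re) {δ : ℝ}
    (hδ : 0 < δ) :
    ∫ x in Set.Ioi δ, (x : ℂ) ^ (l - 1) * Complex.exp (-(r * x)) =
      -(1 / l) * ((δ : ℂ) ^ l * Complex.exp (-(r * δ))) +
        r / l * ∫ x in Set.Ioi δ, (x : ℂ) ^ l * Complex.exp (-(r * x)) := by
  have hi1 := integrableOn_Ioi_cpow_mul_exp (l - 1) hr hδ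
  have hi2 := integrableOn_Ioi_cpow_mul_exp l hr hδ
  have hder : ∀ x ∈ Set.Ici δ, HasDerivAt
      (fun x : ℝ => (x : ℂ) ^ l * Complex.exp (-(r * x)))
      (l * ((x : ℂ) ^ (l - 1) * Complex.exp (-(r * x))) -
        r * ((x : ℂ) ^ l * Complex.exp (-(r * x)))) x := by
    intro x hx
    have hx0 : x ≠ 0 := (hδ.trans_le hx).ne'
    have h0 : HasDerivAt (fun x : ℝ => (x : ℂ)) 1 x := Complex.ofRealCLM.hasDerivAt
    have h1 : HasDerivAt (fun x : ℝ => (x : ℂ) ^ l) (l * (x : ℂ) ^ (l - 1)) x := by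
      have h3 : HasDerivAt (fun z : ℂ => z ^ l) (l * (x : ℂ) ^ (l - 1)) (x : ℂ) := by
        simpa using (hasDerivAt_id (x : ℂ)).cpow_const (c := l)
          (Complex.ofReal_mem_slitPlane.2 (hδ.trans_le hx))
      exact h3.comp_ofReal
    have h2 : HasDerivAt (fun x : ℝ => -(r * (x : ℂ))) (-r) x := by
      have h3 : HasDerivAt (fun x : ℝ => r * (x : ℂ)) r x := by simpa using h0.const_mul r
      exact h3.neg
    refine (h1.mul h2.cexp).congr_deriv ?_
    ring
  have h := integral_Ioi_of_hasDerivAt_of_tendsto' hder ((hi1.const_mul l).sub (hi2.const_mul r))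
    (tendsto_cpow_mul_exp_atTop l hr)
  rw [integral_sub (hi1.const_mul l) (hi2.const_mul r), integral_const_mul,
    integral_const_mul] at h
  field_simp
  linear_combination h

/-- The finite part of the Laplace transform of `x^{l-1}` for `-1 < Re l < 0`: subtracting the
power `-δ^l / l` from the integral over `(δ, ∞)`, one is left with the Gamma function. -/
theorem tendsto_laplace_finitePart {l r : ℂ} (hl : -1 < l.re) (hl0 : l ≠ 0) (hr : 0 < r.re) :
    Tendsto (fun δ : ℝ => (∫ x in Set.Ioi δ, (x : ℂ) ^ (l - 1) * Complex.exp (-(r * x))) -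
      -(1 / l) * (δ : ℂ) ^ l) (𝓝[>] 0)
      (𝓝 (Complex.Gamma l * Complex.exp (-(l * Complex.log r)))) := by
  have hr0 : r ≠ 0 := fun h => by simp [h] at hr
  have hint := integrableOn_cpow_mul_exp hl hr
  have t1 : Tendsto (fun δ : ℝ => ∫ x in Set.Ioi δ, (x : ℂ) ^ l * Complex.exp (-(r * x)))
      (𝓝[>] 0) (𝓝 (∫ x in Set.Ioi (0 : ℝ), (x : ℂ) ^ l * Complex.exp (-(r * x)))) := by
    have hcov : AECover (volume.restrict (Set.Ioi (0 : ℝ))) (𝓝[>] (0 : ℝ))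
        fun δ : ℝ => Set.Ioi δ := aecover_Ioi_of_Ioi (tendsto_id.mono_left nhdsWithin_le_nhds)
    refine (hcov.integral_tendsto_of_countably_generated hint).congr' ?_
    filter_upwards [self_mem_nhdsWithin] with δ hδ
    rw [Measure.restrict_restrict measurableSet_Ioi, Set.inter_eq_left.2]
    exact Set.Ioi_subset_Ioi (le_of_lt hδ)
  have t2 : Tendsto (fun δ : ℝ => (δ : ℂ) ^ l * (Complex.exp (-(r * δ)) - 1)) (𝓝[>] 0) (𝓝 0) := by
    have s1 : Tendsto (fun δ : ℝ => (δ : ℂ)⁻¹ * (Complex.exp (-(r * δ)) - 1)) (𝓝[>] 0)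
        (𝓝 (-r)) := by
      have h2 : HasDerivAt (fun x : ℝ => Complex.exp (-(r * (x : ℂ)))) (-r) 0 := by
        have h0 : HasDerivAt (fun x : ℝ => (x : ℂ)) 1 0 := Complex.ofRealCLM.hasDerivAt
        simpa using ((h0.const_mul r).neg).cexp
      have h3 := h2.tendsto_slope_zero_right
      refine h3.congr fun t => ?_
      simp
    have s2 : Tendsto (fun δ : ℝ => (δ : ℂ) ^ (l + 1)) (𝓝[>] 0) (𝓝 0) := by
      have hre : 0 < (l + 1).re := by simp; linarith
      rw [tendsto_zero_iff_norm_tendsto_zero]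
      have h := ((Real.continuousAt_rpow_const 0 (l + 1).re (Or.inr hre.le)).tendsto).mono_left
        (nhdsWithin_le_nhds (s := Set.Ioi (0 : ℝ)))
      rw [Real.zero_rpow hre.ne'] at h
      refine h.congr' ?_
      filter_upwards [self_mem_nhdsWithin] with δ hδ
      rw [Complex.norm_cpow_eq_rpow_re_of_pos hδ]
    have h := s2.mul s1
    rw [zero_mul] at h
    refine h.congr' ?_
    filter_upwards [self_mem_nhdsWithin] with δ hδ
    have hδ0 : (δ : ℂ) ≠ 0 := Complex.ofReal_ne_zero.2 (ne_of_gt hδ)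
    rw [Complex.cpow_add _ _ hδ0, Complex.cpow_one]
    field_simp
  have h := (t2.const_mul (-(1 / l))).add (t1.const_mul (r / l))
  have hval : -(1 / l) * 0 + r / l * ∫ x in Set.Ioi (0 : ℝ), (x : ℂ) ^ l * Complex.exp (-(r * x)) =
      Complex.Gamma l * Complex.exp (-(l * Complex.log r)) := by
    rw [laplace_cpow hl hr, Complex.Gamma_add_one l hl0]
    have e : Complex.exp (-((l + 1) * Complex.log r)) =
        Complex.exp (-(l * Complex.log r)) * r⁻¹ := by
      rw [← Complex.exp_log hr0, ← Complex.exp_neg, ← Complex.exp_add, Complex.exp_log hr0]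
      congr 1; ring
    rw [e]
    field_simp
    ring
  rw [hval] at h
  refine h.congr' ?_
  filter_upwards [self_mem_nhdsWithin] with δ hδ
  rw [integral_Ioi_cpow_sub_one_mul_exp hl0 hr hδ]
  ring

end Laplace

/-! ### Finite parts and transforms -/

theorem HasFinitePart.add {f g : ℝ → ℂ} {L K : ℂ} (hf : HasFinitePart f L)
    (hg : HasFinitePart g K) : HasFinitePart (fun δ => f δ + g δ) (L + K) := by
  classical
  obtain ⟨s, c, hs, hc⟩ := hf
  obtain ⟨t, d, ht, hd⟩ := hg
  refine ⟨s ∪ t, fun z => (if z ∈ s then c z else 0) + if z ∈ t then d z else 0, fun z hz => ?_, ?_⟩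
  · rcases Finset.mem_union.1 hz with h | h
    exacts [hs z h, ht z h]
  · refine (hc.add hd).congr fun δ => ?_
    simp only [add_mul, Finset.sum_add_distrib, ite_mul, zero_mul]
    rw [← Finset.sum_filter, ← Finset.sum_filter, Finset.filter_mem_eq_inter,
      Finset.filter_mem_eq_inter, Finset.inter_eq_right.2 Finset.subset_union_left,
      Finset.inter_eq_right.2 Finset.subset_union_right]
    ring

theorem HasFinitePart.const_mul (a : ℂ) {f : ℝ → ℂ} {L : ℂ} (hf : HasFinitePart f L) :
    HasFinitePart (fun δ => a * f δ) (a * L) := by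
  obtain ⟨s, c, hs, hc⟩ := hf
  refine ⟨s, fun z => a * c z, hs, (hc.const_mul a).congr fun δ => ?_⟩
  simp only [mul_sub, Finset.mul_sum, mul_assoc]

theorem HasPlusTransform.add {f g : ℝ → ℂ} {β L K : ℂ} (hf : HasPlusTransform f β L)
    (hg : HasPlusTransform g β K) : HasPlusTransform (fun x => f x + g x) β (L + K) := by
  constructor
  · simp only [add_mul]
    exact hf.1.add hg.1
  · simp only [add_mul]
    rw [integral_add hf.1 hg.1, hf.2, hg.2]

theorem HasPlusTransform.const_mul (a : ℂ) {f : ℝ → ℂ} {β L : ℂ} (hf : HasPlusTransform f β L) :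
    HasPlusTransform (fun x => a * f x) β (a * L) := by
  have e : ∀ x : ℝ, a * f x * Complex.exp (Complex.I * β * x) =
      a * (f x * Complex.exp (Complex.I * β * x)) := fun x => mul_assoc _ _ _
  simp only [HasPlusTransform, e]
  constructor
  · exact hf.1.const_mul a
  · rw [integral_const_mul, hf.2]

theorem HasPlusTransform.congr {f g : ℝ → ℂ} {β L : ℂ} (hf : HasPlusTransform f β L)
    (h : ∀ x : ℝ, 0 < x → g x = f x) : HasPlusTransform g β L := by
  have h' : Set.EqOn (fun x : ℝ => f x * Complex.exp (Complex.I * β * x))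
      (fun x : ℝ => g x * Complex.exp (Complex.I * β * x)) (Set.Ioi 0) := fun x hx => by
    simp only [h x hx]
  exact ⟨hf.1.congr_fun h' measurableSet_Ioi,
    (setIntegral_congr_fun measurableSet_Ioi h').symm.trans hf.2⟩

theorem HasMinusTransform.add {f g : ℝ → ℂ} {β L K : ℂ} (hf : HasMinusTransform f β L)
    (hg : HasMinusTransform g β K) : HasMinusTransform (fun x => f x + g x) β (L + K) := by
  constructor
  · intro δ hδ
    simp only [add_mul]
    exact (hf.1 δ hδ).add (hg.1 δ hδ)
  · obtain ⟨s, c, hs, hc⟩ := hf.2.add hg.2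
    refine ⟨s, c, hs, hc.congr' ?_⟩
    filter_upwards [self_mem_nhdsWithin] with δ hδ
    simp only [add_mul]
    rw [integral_add (hf.1 δ hδ) (hg.1 δ hδ)]

theorem HasMinusTransform.const_mul (a : ℂ) {f : ℝ → ℂ} {β L : ℂ} (hf : HasMinusTransform f β L) :
    HasMinusTransform (fun x => a * f x) β (a * L) := by
  have e : ∀ x : ℝ, a * f x * Complex.exp (Complex.I * β * x) =
      a * (f x * Complex.exp (Complex.I * β * x)) := fun x => mul_assoc _ _ _
  simp only [HasMinusTransform, e]
  constructor
  · intro δ hδ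
    exact (hf.1 δ hδ).const_mul a
  · simp only [integral_const_mul]
    exact hf.2.const_mul a

theorem HasMinusTransform.congr {f g : ℝ → ℂ} {β L : ℂ} (hf : HasMinusTransform f β L)
    (h : ∀ x : ℝ, x < 0 → g x = f x) : HasMinusTransform g β L := by
  have h' : ∀ δ : ℝ, 0 < δ → Set.EqOn (fun x : ℝ => f x * Complex.exp (Complex.I * β * x))
      (fun x : ℝ => g x * Complex.exp (Complex.I * β * x)) (Set.Iio (-δ)) := fun δ hδ x hx => by
    have hx' : x < -δ := hx
    simp only [h x (by linarith)]
  refine ⟨fun δ hδ => (hf.1 δ hδ).congr_fun (h' δ hδ) measurableSet_Iio, ?_⟩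
  obtain ⟨s, c, hs, hc⟩ := hf.2
  refine ⟨s, c, hs, hc.congr' ?_⟩
  filter_upwards [self_mem_nhdsWithin] with δ hδ
  rw [setIntegral_congr_fun measurableSet_Iio (h' δ hδ)]

theorem hasPlusTransform_cpow {l β : ℂ} (hl : -1 < l.re) (hβ : 0 < β.im) :
    HasPlusTransform (fun x => (x : ℂ) ^ l) β
      (Complex.Gamma (l + 1) * Complex.exp (-((l + 1) * Complex.log (-Complex.I * β)))) := by
  have hr : 0 < (-Complex.I * β).re := by simpa using hβ
  have e : ∀ x : ℝ, Complex.I * β * x = -(-Complex.I * β * x) := fun x => by ring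
  simp only [HasPlusTransform, e]
  exact ⟨integrableOn_cpow_mul_exp hl hr, laplace_cpow hl hr⟩

theorem hasMinusTransform_cpow {l β : ℂ} (hl : -1 < l.re) (hl' : l.re < 0) (hβ : β.im < 0) :
    HasMinusTransform (fun x => ((-x : ℝ) : ℂ) ^ (l - 1)) β
      (Complex.Gamma l * Complex.exp (-(l * Complex.log (Complex.I * β)))) := by
  have hr : 0 < (Complex.I * β).re := by simpa using hβ
  have hl0 : l ≠ 0 := fun h => by simp [h] at hl'
  have e : ∀ x : ℝ, ((-x : ℝ) : ℂ) ^ (l - 1) * Complex.exp (Complex.I * β * x) =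
      (fun y : ℝ => (y : ℂ) ^ (l - 1) * Complex.exp (-(Complex.I * β * y))) (-x) := fun x => by
    simp only
    congr 2
    push_cast; ring
  constructor
  · intro δ hδ
    simp only [e]
    have h := (integrableOn_Ioi_cpow_mul_exp (l - 1) hr hδ).comp_neg
    simpa using h
  · refine ⟨{l}, fun _ => -(1 / l), by simpa using hl', ?_⟩
    refine (tendsto_laplace_finitePart hl hl0 hr).congr fun δ => ?_
    have h := integral_comp_neg_Iic (-δ)
      (fun y : ℝ => (y : ℂ) ^ (l - 1) * Complex.exp (-(Complex.I * β * y)))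
    rw [neg_neg] at h
    simp only [e, Finset.sum_singleton]
    rw [← integral_Iic_eq_integral_Iio, ← h]

/-! ### The weight functions -/

section Waves

variable (m : Bimaterial)

/-- The coefficient of the power in the displacement jump of the normalized singular solution of
degree `crackDegree m δ`. The Gamma factor cancels the one of the transform. -/
noncomputable def amplitude (δ : ℝ) : ℂ :=
  m.d0 / 2 * Complex.exp (-(Complex.I * Real.pi / 4)) / Complex.Gamma (crackDegree m δ + 1)

/-- The direction of the displacement jump and of the traction for the degree
`crackDegree m δ`: the common eigenvectors of the rotations. -/
noncomputable def polarization (δ : ℝ) : Fin 2 → ℂ := ![1, -(δ * Complex.I)]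

/-- The normalized singular solution of degree `crackDegree m δ`, `δ = ±1`: a multiple of the mode
with `A = 1`, `C = 0` for `δ = 1` and with `A = 0`, `C = 1` for `δ = -1`. -/
noncomputable def wave (δ : ℝ) : Disp :=
  (amplitude m δ / (2 * m.plus.mu * m.b)) •
    modeField m (crackDegree m δ) ((1 + δ) / 2) ((1 - δ) / 2)

theorem Gamma_crackDegree_ne_zero (δ : ℝ) : Complex.Gamma (crackDegree m δ + 1) ≠ 0 :=
  Complex.Gamma_ne_zero_of_re_pos (by
    rw [Complex.add_re, crackDegree_re, Complex.one_re]; norm_num)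

theorem exp_neg_pi_div_four :
    Complex.exp (-(Complex.I * Real.pi / 4)) = (1 - Complex.I) * (Real.sqrt 2 : ℝ) / 2 := by
  have e : -(Complex.I * Real.pi / 4) = ((-(Real.pi / 4) : ℝ) : ℂ) * Complex.I := by
    push_cast; ring
  rw [e, Complex.exp_mul_I, ← Complex.ofReal_cos, ← Complex.ofReal_sin, Real.cos_neg,
    Real.sin_neg, Real.cos_pi_div_four, Real.sin_pi_div_four]
  push_cast
  ring

/-- By the reflection formula, `Γ(1/2 + iε) Γ(1/2 - iε) = π / cosh πε = π d₀²`. -/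
theorem Gamma_mul_Gamma : Complex.Gamma (1 / 2 + Complex.I * m.eps) *
    Complex.Gamma (1 / 2 - Complex.I * m.eps) = Real.pi * (m.d0 : ℂ) ^ 2 := by
  have h := Complex.Gamma_mul_Gamma_one_sub (1 / 2 + Complex.I * m.eps)
  have e1 : (1 : ℂ) - (1 / 2 + Complex.I * m.eps) = 1 / 2 - Complex.I * m.eps := by ring
  have e2 : Complex.sin (Real.pi * (1 / 2 + Complex.I * m.eps)) =
      Complex.cosh (Real.pi * m.eps : ℝ) := by
    have : (Real.pi : ℂ) * (1 / 2 + Complex.I * m.eps) =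
        ((Real.pi * m.eps : ℝ) : ℂ) * Complex.I + Real.pi / 2 := by push_cast; ring
    rw [this, Complex.sin_add_pi_div_two, Complex.cos_mul_I]
  have hc : (m.d0 : ℂ) ^ 2 * Complex.cosh (Real.pi * m.eps : ℝ) = 1 := by
    rw [← Complex.ofReal_cosh]; exact_mod_cast m.d0_sq_mul_cosh
  have hc0 : Complex.cosh (Real.pi * m.eps : ℝ) ≠ 0 := fun h0 => by
    rw [h0, mul_zero] at hc; exact zero_ne_one hc
  rw [e1, e2] at h
  rw [h, div_eq_iff hc0, mul_assoc, hc, mul_one]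

/-- The amplitudes in terms of the constants `c₁^±`, where `g` and `g'` are the two values of the
Gamma function. -/
theorem amplitude_aux {g g' : ℂ} (hg : g ≠ 0) (hg' : g' ≠ 0)
    (h : g * g' = Real.pi * (m.d0 : ℂ) ^ 2) :
    m.d0 / 2 * Complex.exp (-(Complex.I * Real.pi / 4)) / g =
      1 / (2 * (m.d0 : ℂ) * (Real.sqrt (2 * Real.pi) : ℂ)) /
        ((1 + Complex.I) * (Real.sqrt Real.pi : ℂ) / (2 * g')) := by
  have hd := m.d0_ne_zero
  have h2 : ((Real.sqrt 2 : ℝ) : ℂ) ^ 2 = 2 := by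
    exact_mod_cast Real.sq_sqrt (show (0 : ℝ) ≤ 2 by norm_num)
  have hp : ((Real.sqrt Real.pi : ℝ) : ℂ) ^ 2 = Real.pi := by
    exact_mod_cast Real.sq_sqrt Real.pi_pos.le
  have h20 : ((Real.sqrt 2 : ℝ) : ℂ) ≠ 0 := Complex.ofReal_ne_zero.2 (by positivity)
  have hp0 : ((Real.sqrt Real.pi : ℝ) : ℂ) ≠ 0 :=
    Complex.ofReal_ne_zero.2 (Real.sqrt_pos.2 Real.pi_pos).ne'
  have hI : (1 : ℂ) + Complex.I ≠ 0 := fun h => by simpa using congrArg Complex.re h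
  rw [exp_neg_pi_div_four, Real.sqrt_mul (by norm_num), Complex.ofReal_mul]
  generalize ((Real.sqrt 2 : ℝ) : ℂ) = r at *
  generalize ((Real.sqrt Real.pi : ℝ) : ℂ) = t at *
  generalize (m.d0 : ℂ) = d at *
  rw [← hp] at h
  rw [div_eq_div_iff hg (div_ne_zero (mul_ne_zero hI hp0) (mul_ne_zero two_ne_zero hg')),
    div_mul_eq_mul_div 1, one_mul, mul_div_assoc', div_eq_div_iff (mul_ne_zero two_ne_zero hg')
      (mul_ne_zero (mul_ne_zero two_ne_zero hd) (mul_ne_zero h20 hp0))]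
  linear_combination -2 * h + d ^ 2 * t ^ 2 * (1 - Complex.I ^ 2) / 2 * h2 -
    d ^ 2 * t ^ 2 * Complex.I_mul_I

theorem isSingularSolution_wave {δ : ℝ} (hδ : δ = 1 ∨ δ = -1) :
    IsSingularSolution m (wave m δ) := by
  refine isSingularSolution_smul _ (isSingularSolution_modeField hδ ?_ ?_)
  · rcases hδ with rfl | rfl
    · exact Or.inr ((isCrackDegree_iff m (Or.inl rfl) 1).2 (by norm_num))
    · left; norm_num
  · rcases hδ with rfl | rfl
    · left; norm_num
    · exact Or.inr ((isCrackDegree_iff m (Or.inr rfl) (-1)).2 (by norm_num))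

theorem neBot_fromAbove (x : ℝ) : (fromAbove x).NeBot := by
  rw [fromAbove, ← body_one]; exact neBot_nhdsWithin_body (Or.inl rfl) x

theorem neBot_fromBelow (x : ℝ) : (fromBelow x).NeBot := by
  rw [fromBelow, ← body_neg_one]; exact neBot_nhdsWithin_body (Or.inr rfl) x

variable {m}

theorem jump_eq {U : Disp} {x : ℝ} {a b : Fin 2 → ℂ} (ha : Tendsto U (fromAbove x) (𝓝 a))
    (hb : Tendsto U (fromBelow x) (𝓝 b)) : jump U x = a - b := by
  have := neBot_fromAbove x
  have := neBot_fromBelow x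
  rw [jump, ha.limUnder_eq, hb.limUnder_eq]

theorem lineTraction_eq {U : Disp} {x : ℝ} {a : Fin 2 → ℂ}
    (ha : Tendsto (traction m.plus U) (fromAbove x) (𝓝 a)) : lineTraction m U x = a := by
  have := neBot_fromAbove x
  rw [lineTraction, ha.limUnder_eq]

theorem IsSingularSolution.exists_tendsto {U : Disp} (hU : IsSingularSolution m U) {x : ℝ}
    (hx : x ≠ 0) : (∃ a, Tendsto U (fromAbove x) (𝓝 a)) ∧ ∃ a, Tendsto U (fromBelow x) (𝓝 a) := by
  rcases hx.lt_or_gt with h | h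
  · obtain ⟨a, h1, h2⟩ := hU.continuous x h
    exact ⟨⟨a, h1⟩, a, h2⟩
  · exact hU.traces x h

theorem IsSingularSolution.exists_tendsto_traction {U : Disp} (hU : IsSingularSolution m U) {x : ℝ}
    (hx : x ≠ 0) : ∃ a, Tendsto (traction m.plus U) (fromAbove x) (𝓝 a) := by
  rcases hx.lt_or_gt with h | h
  · obtain ⟨a, h1, -⟩ := hU.tractionContinuous x h
    exact ⟨a, h1⟩
  · exact ⟨0, (hU.tractionFree x h).1⟩

theorem jump_smul_add_smul {U V : Disp} (hU : IsSingularSolution m U)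
    (hV : IsSingularSolution m V) (c d : ℂ) {x : ℝ} (hx : x ≠ 0) :
    jump (c • U + d • V) x = c • jump U x + d • jump V x := by
  obtain ⟨⟨a, ha⟩, b, hb⟩ := hU.exists_tendsto hx
  obtain ⟨⟨a', ha'⟩, b', hb'⟩ := hV.exists_tendsto hx
  rw [jump_eq ha hb, jump_eq ha' hb']
  refine (jump_eq ((ha.const_smul c).add (ha'.const_smul d))
    ((hb.const_smul c).add (hb'.const_smul d))).trans ?_
  rw [smul_sub, smul_sub]
  abel

theorem lineTraction_smul_add_smul {U V : Disp} (hU : IsSingularSolution m U)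
    (hV : IsSingularSolution m V) (c d : ℂ) {x : ℝ} (hx : x ≠ 0) :
    lineTraction m (c • U + d • V) x = c • lineTraction m U x + d • lineTraction m V x := by
  obtain ⟨a, ha⟩ := hU.exists_tendsto_traction hx
  obtain ⟨b, hb⟩ := hV.exists_tendsto_traction hx
  rw [lineTraction_eq ha, lineTraction_eq hb]
  exact lineTraction_eq (tendsto_traction_add isOpen_upperBody (hU.equilibriumPlus.smul c)
    (hV.equilibriumPlus.smul d) (tendsto_traction_smul c ha) (tendsto_traction_smul d hb))

theorem IsSingularSolution.jump_eq_zero {U : Disp} (hU : IsSingularSolution m U) {x : ℝ}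
    (hx : x < 0) : jump U x = 0 := by
  obtain ⟨a, h1, h2⟩ := hU.continuous x hx
  rw [jump_eq h1 h2, sub_self]

theorem IsSingularSolution.lineTraction_eq_zero {U : Disp} (hU : IsSingularSolution m U) {x : ℝ}
    (hx : 0 < x) : lineTraction m U x = 0 := lineTraction_eq (hU.tractionFree x hx).1

theorem jump_wave (δ : ℝ) {x : ℝ} (hx : 0 < x) :
    jump (wave m δ) x = (amplitude m δ * (x : ℂ) ^ crackDegree m δ) • polarization δ := by
  have ha := (tendsto_modeField_above (m := m) (crackDegree m δ) ((1 + δ) / 2) ((1 - δ) / 2)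
    hx.ne').const_smul (amplitude m δ / (2 * m.plus.mu * m.b))
  have hb := (tendsto_modeField_below (m := m) (crackDegree m δ) ((1 + δ) / 2) ((1 - δ) / 2)
    hx.ne').const_smul (amplitude m δ / (2 * m.plus.mu * m.b))
  have hmu : (m.minus.mu : ℂ) ≠ 0 := Complex.ofReal_ne_zero.2 m.minus.mu_pos.ne'
  have hmu' : (m.plus.mu : ℂ) ≠ 0 := Complex.ofReal_ne_zero.2 m.plus.mu_pos.ne'
  have hb0 := m.b_ne_zero
  have hK : (m.plus.kappa + 1 : ℂ) + m.plus.mu / m.minus.mu * (m.minus.kappa + 1) =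
      2 * (2 * m.plus.mu * m.b) := by
    have : m.plus.kappa + 1 + m.plus.mu / m.minus.mu * (m.minus.kappa + 1) =
        2 * (2 * m.plus.mu * m.b) := by
      have h1 := m.plus.mu_pos.ne'
      have h2 := m.minus.mu_pos.ne'
      rw [Bimaterial.b, Material.kappa, Material.kappa]
      field_simp
      ring
    exact_mod_cast this
  have hN : amplitude m δ / (2 * m.plus.mu * m.b) * (2 * m.plus.mu * m.b) = amplitude m δ :=
    div_mul_cancel₀ _ (mul_ne_zero (mul_ne_zero two_ne_zero hmu') hb0)
  refine (jump_eq ha hb).trans ?_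
  rw [← smul_sub]
  funext i
  simp only [kolField, kolDisp_of_pos (Or.inl rfl) (Or.inl rfl) _ _ _ _ hx,
    kolDisp_of_pos (Or.inl rfl) (Or.inr rfl) _ _ _ _ hx,
    kolDisp_of_pos (Or.inr rfl) (Or.inl rfl) _ _ _ _ hx,
    kolDisp_of_pos (Or.inr rfl) (Or.inr rfl) _ _ _ _ hx]
  generalize amplitude m δ / (2 * m.plus.mu * m.b) = N at *
  fin_cases i
  · simp only [Pi.smul_apply, Pi.sub_apply, smul_eq_mul, polarization, Fin.zero_eta,
      Matrix.cons_val_zero]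
    linear_combination (x : ℂ) ^ crackDegree m δ * (N / 2 * hK + hN)
  · simp only [Pi.smul_apply, Pi.sub_apply, smul_eq_mul, polarization, Fin.mk_one,
      Matrix.cons_val_zero, Matrix.cons_val_one]
    linear_combination (-δ * Complex.I) * (x : ℂ) ^ crackDegree m δ * (N / 2 * hK + hN)

theorem lineTraction_wave (δ : ℝ) {x : ℝ} (hx : x < 0) (hδ : δ = 1 ∨ δ = -1) :
    lineTraction m (wave m δ) x =
      (-(amplitude m δ * crackDegree m δ / (m.b * (m.d0 : ℂ) ^ 2)) *
        ((-x : ℝ) : ℂ) ^ (crackDegree m δ - 1)) • polarization δ := by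
  have ha := tendsto_traction_smul (amplitude m δ / (2 * m.plus.mu * m.b))
    (tendsto_traction_modeField_above (m := m) (crackDegree m δ) ((1 + δ) / 2) ((1 - δ) / 2) hx.ne)
  have hmu' : (m.plus.mu : ℂ) ≠ 0 := Complex.ofReal_ne_zero.2 m.plus.mu_pos.ne'
  have hb0 := m.b_ne_zero
  have hd0 := m.d0_ne_zero
  have hD : Complex.exp (-(Complex.I * Real.pi * crackDegree m δ)) -
      Complex.exp (Complex.I * Real.pi * crackDegree m δ) = 2 * Complex.I / (m.d0 : ℂ) ^ 2 := by
    have h1 := exp_crackDegree m (Or.inl rfl) δ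
    have h2 := exp_neg_crackDegree m (Or.inl rfl) δ
    rw [Complex.ofReal_one, one_mul] at h1 h2
    have h3 : (m.d0 : ℂ) ^ 2 * ((Real.exp (1 * δ * (Real.pi * m.eps)) : ℝ) +
        (Real.exp (-(1 * δ * (Real.pi * m.eps))) : ℝ) : ℂ) = 2 := by
      have h4 : m.d0 ^ 2 * (Real.exp (1 * δ * (Real.pi * m.eps)) +
          Real.exp (-(1 * δ * (Real.pi * m.eps)))) = 2 := by
        have h5 := m.d0_sq_mul_cosh
        rw [Real.cosh_eq] at h5
        rcases hδ with rfl | rfl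
        · simp only [one_mul]; linarith
        · simp only [one_mul, neg_mul, neg_neg]; linarith
      exact_mod_cast h4
    rw [h1, h2, eq_div_iff (pow_ne_zero 2 hd0)]
    linear_combination Complex.I * h3
  have hN : amplitude m δ / (2 * m.plus.mu * m.b) * (m.plus.mu * crackDegree m δ) *
      (2 * Complex.I / (m.d0 : ℂ) ^ 2) =
      amplitude m δ * crackDegree m δ / (m.b * (m.d0 : ℂ) ^ 2) * Complex.I := by
    field_simp
  rw [wave, lineTraction_eq ha]
  funext i
  simp only [kolTraction, kolTrac_of_neg (Or.inl rfl) (Or.inl rfl) _ _ _ hx,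
    kolTrac_of_neg (Or.inl rfl) (Or.inr rfl) _ _ _ hx]
  generalize ((-x : ℝ) : ℂ) ^ (crackDegree m δ - 1) = R at *
  simp only [Complex.ofReal_one, Complex.ofReal_neg, one_mul, neg_mul, neg_neg]
  have hD' : Complex.exp (Complex.I * Real.pi * crackDegree m δ) -
      Complex.exp (-(Complex.I * Real.pi * crackDegree m δ)) = -(2 * Complex.I / (m.d0 : ℂ) ^ 2) :=
    by rw [← hD]; ring
  rw [hD, hD']
  generalize amplitude m δ / (2 * m.plus.mu * m.b) = N at *
  generalize 2 * Complex.I / (m.d0 : ℂ) ^ 2 = D at *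
  fin_cases i
  · simp only [Pi.smul_apply, smul_eq_mul, polarization, Fin.zero_eta,
      Matrix.cons_val_zero]
    linear_combination R * Complex.I * hN + amplitude m δ * crackDegree m δ /
      (m.b * (m.d0 : ℂ) ^ 2) * R * Complex.I_mul_I
  · simp only [Pi.smul_apply, smul_eq_mul, polarization, Fin.mk_one,
      Matrix.cons_val_zero, Matrix.cons_val_one]
    linear_combination R * δ * hN

/-- Every singular solution is a combination of the two waves. If `ε ≠ 0`, its two homogeneous parts
are combinations of it and of a dilation, hence singular solutions; if `ε = 0`, the two degrees coincide. -/
theorem IsSingularSolution.exists_eq_wave {U : Disp} (hU : IsSingularSolution m U) :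
    ∃ a c : ℂ, U = a • wave m 1 + c • wave m (-1) := by
  have hmu : (2 * m.plus.mu * m.b : ℂ) ≠ 0 := mul_ne_zero (mul_ne_zero two_ne_zero
    (Complex.ofReal_ne_zero.2 m.plus.mu_pos.ne')) m.b_ne_zero
  have hN : ∀ δ, amplitude m δ / (2 * m.plus.mu * m.b) ≠ 0 := fun δ =>
    div_ne_zero (div_ne_zero (mul_ne_zero (div_ne_zero m.d0_ne_zero two_ne_zero)
      (Complex.exp_ne_zero _)) (Gamma_crackDegree_ne_zero m δ)) hmu
  have hw1 : ∀ a : ℂ, ∃ a', a • modeField m (crackDegree m 1) 1 0 = a' • wave m 1 := fun a =>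
    ⟨a / (amplitude m 1 / (2 * m.plus.mu * m.b)), by
      rw [wave, smul_smul, div_mul_cancel₀ _ (hN 1)]; norm_num⟩
  have hw2 : ∀ a : ℂ, ∃ a', a • modeField m (crackDegree m (-1)) 0 1 = a' • wave m (-1) := fun a =>
    ⟨a / (amplitude m (-1) / (2 * m.plus.mu * m.b)), by
      rw [wave, smul_smul, div_mul_cancel₀ _ (hN (-1))]; norm_num⟩
  have hmode : ∀ {V : Disp} {δ : ℝ}, IsSingularSolution m V → IsHomogeneous (crackDegree m δ) V →
      ∃ A C : ℂ, V = modeField m (crackDegree m δ) A C ∧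
        (A = 0 ∨ IsCrackDegree m 1 (crackDegree m δ)) ∧
        (C = 0 ∨ IsCrackDegree m (-1) (crackDegree m δ)) := fun {V δ} hV hh =>
    hV.exists_eq_modeField (crackDegree_ne_zero m δ) (exp_sub_exp_crackDegree_ne_zero m δ) hh
  obtain ⟨A, B, hA, hB, hAB⟩ := hU.homogeneous
  have e1 : -(1 / 2) + Complex.I * (m.eps : ℂ) = crackDegree m 1 := by simp [crackDegree]
  have e2 : -(1 / 2) - Complex.I * (m.eps : ℂ) = crackDegree m (-1) := by
    simp [crackDegree, sub_eq_add_neg]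
  rw [e1] at hA
  rw [e2] at hB
  by_cases hε : m.eps = 0
  · have e3 : crackDegree m (-1) = crackDegree m 1 := by simp [crackDegree, hε]
    rw [e3] at hB
    have hh : IsHomogeneous (crackDegree m 1) U := fun t ht p hp => by
      have hp' : (t • p).2 ≠ 0 := by simpa [ht.ne'] using hp
      rw [hAB p hp, hAB _ hp', hA t ht p hp, hB t ht p hp, smul_add]
    obtain ⟨a, c, hac, -, -⟩ := hmode hU hh
    obtain ⟨a', ha'⟩ := hw1 a
    obtain ⟨c', hc'⟩ := hw2 c
    refine ⟨a', c', ?_⟩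
    rw [hac, modeField_eq, ← ha', ← hc', e3]
  · -- at the dilation `t` the quotient of the two powers is `-1`
    set t : ℝ := Real.exp (Real.pi / (2 * m.eps)) with ht
    have ht0 : 0 < t := Real.exp_pos _
    have htC : (t : ℂ) ≠ 0 := Complex.ofReal_ne_zero.2 ht0.ne'
    have hne : (t : ℂ) ^ crackDegree m 1 - (t : ℂ) ^ crackDegree m (-1) ≠ 0 := by
      have h1 : crackDegree m 1 = crackDegree m (-1) + 2 * (Complex.I * m.eps) := by
        simp [crackDegree]; ring
      have h2 : (t : ℂ) ^ (2 * (Complex.I * m.eps)) = -1 := by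
        have hε' : (m.eps : ℂ) ≠ 0 := Complex.ofReal_ne_zero.2 hε
        rw [Complex.cpow_def_of_ne_zero htC, ← Complex.ofReal_log ht0.le, ht, Real.log_exp,
          ← Complex.exp_pi_mul_I]
        congr 1
        push_cast
        field_simp
      have h3 : (t : ℂ) ^ crackDegree m (-1) ≠ 0 := by
        rw [Complex.cpow_def_of_ne_zero htC]; exact Complex.exp_ne_zero _
      rw [h1, Complex.cpow_add _ _ htC, h2]
      intro h
      exact h3 (by linear_combination (-1 / 2 : ℂ) * h)
    set k := ((t : ℂ) ^ crackDegree m 1 - (t : ℂ) ^ crackDegree m (-1))⁻¹ with hk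
    have hk1 : k * ((t : ℂ) ^ crackDegree m 1 - (t : ℂ) ^ crackDegree m (-1)) = 1 :=
      inv_mul_cancel₀ hne
    obtain ⟨V, hV⟩ : ∃ V : Disp, V = k • (dilate t U + (-(t : ℂ) ^ crackDegree m (-1)) • U) :=
      ⟨_, rfl⟩
    have hVs : IsSingularSolution m V := hV ▸ isSingularSolution_smul _
      (isSingularSolution_add (isSingularSolution_dilate ht0 hU) (isSingularSolution_smul _ hU))
    have hVA : ∀ p : ℝ × ℝ, p.2 ≠ 0 → V p = A p := fun p hp => by
      have hp' : (t • p).2 ≠ 0 := by simpa [ht0.ne'] using hp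
      funext i
      simp only [hV, dilate, Pi.smul_apply, Pi.add_apply, hAB p hp, hAB _ hp', hA t ht0 p hp,
        hB t ht0 p hp, smul_eq_mul]
      linear_combination A p i * hk1
    obtain ⟨V', hV'⟩ : ∃ V' : Disp, V' = U + (-1 : ℂ) • V := ⟨_, rfl⟩
    have hVs' : IsSingularSolution m V' := hV' ▸
      isSingularSolution_add hU (isSingularSolution_smul _ hVs)
    have hVB : ∀ p : ℝ × ℝ, p.2 ≠ 0 → V' p = B p := fun p hp => by
      simp only [hV', Pi.add_apply, Pi.smul_apply, hVA p hp, hAB p hp]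
      module
    have hhV : IsHomogeneous (crackDegree m 1) V := fun s hs p hp => by
      have hp' : (s • p).2 ≠ 0 := by simpa [hs.ne'] using hp
      rw [hVA p hp, hVA _ hp', hA s hs p hp]
    have hhV' : IsHomogeneous (crackDegree m (-1)) V' := fun s hs p hp => by
      have hp' : (s • p).2 ≠ 0 := by simpa [hs.ne'] using hp
      rw [hVB p hp, hVB _ hp', hB s hs p hp]
    obtain ⟨a, c, h1, -, hc⟩ := hmode hVs hhV
    obtain ⟨a₂, c₂, h2, ha₂, -⟩ := hmode hVs' hhV'
    have hc0 : c = 0 := hc.resolve_right fun h => hε (by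
      have := (isCrackDegree_iff m (Or.inr rfl) 1).1 h
      linarith)
    have ha0 : a₂ = 0 := ha₂.resolve_right fun h => hε (by
      have := (isCrackDegree_iff m (Or.inl rfl) (-1)).1 h
      linarith)
    obtain ⟨a', ha'⟩ := hw1 a
    obtain ⟨c', hc'⟩ := hw2 c₂
    have hU2 : U = V + V' := by rw [hV', neg_one_smul]; abel
    have hV1 : V = a' • wave m 1 := by rw [h1, hc0, modeField_eq, zero_smul, add_zero, ha']
    have hV2 : V' = c' • wave m (-1) := by rw [h2, ha0, modeField_eq, zero_smul, zero_add, hc']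
    exact ⟨a', c', by rw [hU2, hV1, hV2]⟩

end Waves

/-! ### Transforms of the singular solutions -/

section Transforms

variable (m : Bimaterial)

theorem hasPlusTransform_wave (δ : ℝ) {β : ℂ} (hβ : 0 < β.im) (i : Fin 2) :
    HasPlusTransform (fun x => jump (wave m δ) x i) β
      (m.d0 / 2 * Complex.exp (-(Complex.I * Real.pi / 4)) *
        Complex.exp (-((crackDegree m δ + 1) * Complex.log (-Complex.I * β))) *
          polarization δ i) := by
  have hG := Gamma_crackDegree_ne_zero m δ
  have hA : amplitude m δ * Complex.Gamma (crackDegree m δ + 1) =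
      m.d0 / 2 * Complex.exp (-(Complex.I * Real.pi / 4)) := div_mul_cancel₀ _ hG
  have h := (hasPlusTransform_cpow (l := crackDegree m δ)
    (by rw [crackDegree_re]; norm_num) hβ).const_mul (amplitude m δ * polarization δ i)
  rw [show amplitude m δ * polarization δ i * (Complex.Gamma (crackDegree m δ + 1) *
      Complex.exp (-((crackDegree m δ + 1) * Complex.log (-Complex.I * β)))) =
      amplitude m δ * Complex.Gamma (crackDegree m δ + 1) *
      Complex.exp (-((crackDegree m δ + 1) * Complex.log (-Complex.I * β))) * polarization δ i by
        ring, hA] at h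
  refine h.congr fun x hx => ?_
  rw [jump_wave δ hx, Pi.smul_apply, smul_eq_mul]
  ring

theorem hasMinusTransform_wave {δ : ℝ} (hδ : δ = 1 ∨ δ = -1) {β : ℂ} (hβ : β.im < 0) (i : Fin 2) :
    HasMinusTransform (fun x => lineTraction m (wave m δ) x i) β
      (-(1 / (2 * m.b * m.d0)) * Complex.exp (-(Complex.I * Real.pi / 4)) *
        Complex.exp (-(crackDegree m δ * Complex.log (Complex.I * β))) * polarization δ i) := by
  have hG := Gamma_crackDegree_ne_zero m δ
  have hA : amplitude m δ * Complex.Gamma (crackDegree m δ + 1) =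
      m.d0 / 2 * Complex.exp (-(Complex.I * Real.pi / 4)) := div_mul_cancel₀ _ hG
  have hb0 := m.b_ne_zero
  have hd0 := m.d0_ne_zero
  rw [Complex.Gamma_add_one _ (crackDegree_ne_zero m δ)] at hA
  have h := (hasMinusTransform_cpow (l := crackDegree m δ)
    (by rw [crackDegree_re]; norm_num) (by rw [crackDegree_re]; norm_num) hβ).const_mul
      (-(amplitude m δ * crackDegree m δ / (m.b * (m.d0 : ℂ) ^ 2)) * polarization δ i)
  rw [show -(amplitude m δ * crackDegree m δ / (m.b * (m.d0 : ℂ) ^ 2)) * polarization δ i *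
      (Complex.Gamma (crackDegree m δ) *
        Complex.exp (-(crackDegree m δ * Complex.log (Complex.I * β)))) =
      -(amplitude m δ * (crackDegree m δ * Complex.Gamma (crackDegree m δ)) /
        (m.b * (m.d0 : ℂ) ^ 2)) *
      Complex.exp (-(crackDegree m δ * Complex.log (Complex.I * β))) * polarization δ i by
        ring, hA, show -((m.d0 : ℂ) / 2 * Complex.exp (-(Complex.I * Real.pi / 4)) /
      (m.b * (m.d0 : ℂ) ^ 2)) = -(1 / (2 * m.b * m.d0)) *
        Complex.exp (-(Complex.I * Real.pi / 4)) by field_simp] at h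
  refine h.congr fun x hx => ?_
  rw [lineTraction_wave δ hx hδ, Pi.smul_apply, smul_eq_mul]
  ring

/-- The rotations act on the polarizations by scalars. -/
theorem rot_mulVec_eq_polarization (θ : ℂ) (e : Fin 2 → ℂ) : rot θ *ᵥ e =
    ((e 0 + Complex.I * e 1) * (Complex.exp (θ * Complex.I) / 2)) • polarization 1 +
      ((e 0 - Complex.I * e 1) * (Complex.exp (-θ * Complex.I) / 2)) • polarization (-1) := by
  rw [rot_mulVec, Complex.cos, Complex.sin]
  funext i
  fin_cases i
  · simp [polarization]
    ring
  · simp [polarization]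
    linear_combination ((1 / 2 : ℂ) * e 1 *
      (Complex.exp (θ * Complex.I) + Complex.exp (-(θ * Complex.I)))) * Complex.I_mul_I

theorem whPlus_apply (e : Fin 2 → ℂ) (β : ℂ) (i : Fin 2) : m.whPlus e β i =
    (e 0 + Complex.I * e 1) * (m.d0 / 2 * Complex.exp (-(Complex.I * Real.pi / 4)) *
      Complex.exp (-((crackDegree m 1 + 1) * Complex.log (-Complex.I * β))) * polarization 1 i) +
    (e 0 - Complex.I * e 1) * (m.d0 / 2 * Complex.exp (-(Complex.I * Real.pi / 4)) *
      Complex.exp (-((crackDegree m (-1) + 1) * Complex.log (-Complex.I * β))) *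
        polarization (-1) i) := by
  have h : ∀ δ : ℝ, Complex.exp (-(1 / 2) * halfLog 1 β) *
      Complex.exp (δ * (-(m.eps : ℂ) * Complex.log (-Complex.I * β)) * Complex.I) =
      Complex.exp (-(Complex.I * Real.pi / 4)) *
        Complex.exp (-((crackDegree m δ + 1) * Complex.log (-Complex.I * β))) := fun δ => by
    rw [← Complex.exp_add, ← Complex.exp_add, halfLog, crackDegree, Complex.ofReal_one, one_mul]
    congr 1
    ring
  have h1 := h 1
  have h2 := h (-1)
  rw [Bimaterial.whPlus_eq_twist, Bimaterial.twist, Bimaterial.angle, rot_mulVec_eq_polarization]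
  simp only [Pi.smul_apply, Pi.add_apply, smul_eq_mul, Complex.ofReal_one, one_mul, neg_neg,
    Complex.ofReal_neg, Complex.ofReal_div, Complex.ofReal_ofNat, neg_mul] at h1 h2 ⊢
  linear_combination (e 0 + Complex.I * e 1) * m.d0 / 2 * polarization 1 i * h1 +
    (e 0 - Complex.I * e 1) * m.d0 / 2 * polarization (-1) i * h2

theorem whMinus_apply (e : Fin 2 → ℂ) (β : ℂ) (i : Fin 2) : m.whMinus e β i =
    (e 0 + Complex.I * e 1) * (-(1 / (2 * m.b * m.d0)) *
      Complex.exp (-(Complex.I * Real.pi / 4)) *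
      Complex.exp (-(crackDegree m 1 * Complex.log (Complex.I * β))) * polarization 1 i) +
    (e 0 - Complex.I * e 1) * (-(1 / (2 * m.b * m.d0)) *
      Complex.exp (-(Complex.I * Real.pi / 4)) *
      Complex.exp (-(crackDegree m (-1) * Complex.log (Complex.I * β))) *
        polarization (-1) i) := by
  have h : ∀ δ : ℝ, Complex.exp (1 / 2 * halfLog (-1) β) *
      Complex.exp (δ * (-(m.eps : ℂ) * Complex.log (Complex.I * β)) * Complex.I) =
      Complex.exp (-(Complex.I * Real.pi / 4)) *
        Complex.exp (-(crackDegree m δ * Complex.log (Complex.I * β))) := fun δ => by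
    rw [← Complex.exp_add, ← Complex.exp_add]
    simp only [halfLog, crackDegree, Complex.ofReal_neg, Complex.ofReal_one, neg_mul, one_mul,
      neg_neg]
    congr 1
    ring
  have h1 := h 1
  have h2 := h (-1)
  rw [Bimaterial.whMinus_eq_twist, Bimaterial.twist, Bimaterial.angle, rot_mulVec_eq_polarization]
  simp only [Pi.smul_apply, Pi.add_apply, smul_eq_mul, Complex.ofReal_one, one_mul, neg_neg,
    Complex.ofReal_neg, Complex.ofReal_div, Complex.ofReal_ofNat, neg_mul] at h1 h2 ⊢
  linear_combination -(e 0 + Complex.I * e 1) / (2 * m.b * m.d0) * polarization 1 i * h1 -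
    (e 0 - Complex.I * e 1) / (2 * m.b * m.d0) * polarization (-1) i * h2

/-- The singular solution whose transforms are the solution of the Wiener-Hopf problem with the
constant vector `e`. -/
noncomputable def weightField : (Fin 2 → ℂ) →ₗ[ℂ] singularSolutions m where
  toFun e := (e 0 + Complex.I * e 1) • ⟨wave m 1, isSingularSolution_wave m (Or.inl rfl)⟩ +
    (e 0 - Complex.I * e 1) • ⟨wave m (-1), isSingularSolution_wave m (Or.inr rfl)⟩
  map_add' e f := by simp only [Pi.add_apply]; module
  map_smul' c e := by simp only [Pi.smul_apply, smul_eq_mul, RingHom.id_apply]; module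

theorem coe_weightField (e : Fin 2 → ℂ) : (weightField m e : Disp) =
    (e 0 + Complex.I * e 1) • wave m 1 + (e 0 - Complex.I * e 1) • wave m (-1) := rfl

theorem jump_weightField (e : Fin 2 → ℂ) {x : ℝ} (hx : x ≠ 0) (i : Fin 2) :
    jump (weightField m e : Disp) x i = (e 0 + Complex.I * e 1) * jump (wave m 1) x i +
      (e 0 - Complex.I * e 1) * jump (wave m (-1)) x i := by
  rw [coe_weightField, jump_smul_add_smul (isSingularSolution_wave m (Or.inl rfl))
    (isSingularSolution_wave m (Or.inr rfl)) _ _ hx]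
  rfl

theorem lineTraction_weightField (e : Fin 2 → ℂ) {x : ℝ} (hx : x ≠ 0) (i : Fin 2) :
    lineTraction m (weightField m e : Disp) x i =
      (e 0 + Complex.I * e 1) * lineTraction m (wave m 1) x i +
      (e 0 - Complex.I * e 1) * lineTraction m (wave m (-1)) x i := by
  rw [coe_weightField, lineTraction_smul_add_smul (isSingularSolution_wave m (Or.inl rfl))
    (isSingularSolution_wave m (Or.inr rfl)) _ _ hx]
  rfl

theorem isTransformPair_weightField (e : Fin 2 → ℂ) :
    IsTransformPair m (weightField m e) (m.whPlus e) (m.whMinus e) := by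
  constructor
  · intro β hβ i
    rw [whPlus_apply]
    exact (((hasPlusTransform_wave m 1 hβ i).const_mul _).add
      ((hasPlusTransform_wave m (-1) hβ i).const_mul _)).congr fun x hx =>
        jump_weightField m e hx.ne' i
  · intro β hβ i
    rw [whMinus_apply]
    exact (((hasMinusTransform_wave m (Or.inl rfl) hβ i).const_mul _).add
      ((hasMinusTransform_wave m (Or.inr rfl) hβ i).const_mul _)).congr fun x hx =>
        lineTraction_weightField m e hx.ne i

variable {m}

/-- The vector `e` is determined by the transform of the jump at `β = i`. -/
theorem eq_of_isTransformPair_weightField {e e' : Fin 2 → ℂ} {Φp Φm : ℂ → Fin 2 → ℂ}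
    (h : IsTransformPair m (weightField m e) Φp Φm)
    (h' : m.whPlus e' Complex.I = Φp Complex.I) : e = e' := by
  have hI : 0 < Complex.I.im := by simp
  refine Bimaterial.eq_of_whPlus_eq (m := m) (β := Complex.I) ?_
  rw [h']
  funext i
  exact ((isTransformPair_weightField m e).1 _ hI i).2.symm.trans (h.1 _ hI i).2

variable (m)

theorem injective_weightField : Function.Injective (weightField m) := fun _ e' h =>
  eq_of_isTransformPair_weightField (h ▸ isTransformPair_weightField m e') rfl

theorem surjective_weightField : Function.Surjective (weightField m) := fun ⟨U, hU⟩ => by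
  obtain ⟨a, c, h⟩ := IsSingularSolution.exists_eq_wave hU
  refine ⟨![(a + c) / 2, -Complex.I * (a - c) / 2], Subtype.ext ?_⟩
  refine (coe_weightField m _).trans (Eq.trans ?_ h.symm)
  congr 2
  · simp only [Matrix.cons_val_zero, Matrix.cons_val_one]
    linear_combination -((a - c) / 2) * Complex.I_mul_I
  · simp only [Matrix.cons_val_zero, Matrix.cons_val_one]
    linear_combination ((a - c) / 2) * Complex.I_mul_I

/-- The parametrization of the singular solutions by the constant vector `e`. -/
noncomputable def weightEquiv : (Fin 2 → ℂ) ≃ₗ[ℂ] singularSolutions m :=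
  LinearEquiv.ofBijective (weightField m) ⟨injective_weightField m, surjective_weightField m⟩

/-- The basis of weight functions. -/
noncomputable def weightBasis : Module.Basis (Fin 2) ℂ (singularSolutions m) :=
  (Pi.basisFun ℂ (Fin 2)).map (weightEquiv m)

theorem weightBasis_apply (j : Fin 2) : weightBasis m j = weightField m (Pi.single j 1) := by
  rw [weightBasis, Module.Basis.map_apply, Pi.basisFun_apply]
  rfl

theorem sum_smul_weightBasis (e : Fin 2 → ℂ) :
    ∑ j, e j • (weightBasis m j : Disp) = weightField m e := by
  rw [Fin.sum_univ_two, weightBasis_apply, weightBasis_apply, ← Submodule.coe_smul,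
    ← Submodule.coe_smul, ← Submodule.coe_add, ← map_smul, ← map_smul, ← map_add]
  congr 2
  funext i
  fin_cases i <;> simp

/-! ### The explicit weight functions -/

theorem amplitude_one : amplitude m 1 =
    1 / (2 * (m.d0 : ℂ) * (Real.sqrt (2 * Real.pi) : ℂ)) / m.c1Minus := by
  have e1 : crackDegree m 1 + 1 = 1 / 2 + Complex.I * m.eps := by
    rw [crackDegree]; push_cast; ring
  have e2 : crackDegree m (-1) + 1 = 1 / 2 - Complex.I * m.eps := by
    rw [crackDegree]; push_cast; ring
  rw [amplitude, Bimaterial.c1Minus, e1]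
  exact amplitude_aux m (e1 ▸ Gamma_crackDegree_ne_zero m 1)
    (e2 ▸ Gamma_crackDegree_ne_zero m (-1)) (Gamma_mul_Gamma m)

theorem amplitude_neg_one : amplitude m (-1) =
    1 / (2 * (m.d0 : ℂ) * (Real.sqrt (2 * Real.pi) : ℂ)) / m.c1Plus := by
  have e1 : crackDegree m 1 + 1 = 1 / 2 + Complex.I * m.eps := by
    rw [crackDegree]; push_cast; ring
  have e2 : crackDegree m (-1) + 1 = 1 / 2 - Complex.I * m.eps := by
    rw [crackDegree]; push_cast; ring
  rw [amplitude, Bimaterial.c1Plus, e2]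
  exact amplitude_aux m (e2 ▸ Gamma_crackDegree_ne_zero m (-1))
    (e1 ▸ Gamma_crackDegree_ne_zero m 1) ((mul_comm _ _).trans (Gamma_mul_Gamma m))

theorem cpow_ofReal_add {x : ℝ} (hx : 0 < x) (r : ℝ) (z : ℂ) :
    (x : ℂ) ^ ((r : ℂ) + z) = ((x ^ r : ℝ) : ℂ) * (x : ℂ) ^ z := by
  rw [Complex.cpow_add _ _ (Complex.ofReal_ne_zero.2 hx.ne'), Complex.ofReal_cpow hx.le]

theorem jump_weightField_single (j : Fin 2) {x : ℝ} (hx : x ≠ 0) (i : Fin 2) :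
    jump (weightField m (Pi.single j 1) : Disp) x i = m.jumpMatrix x i j := by
  rcases hx.lt_or_gt with h | h
  · rw [(weightField m _).2.jump_eq_zero h, Bimaterial.jumpMatrix, if_neg h.not_gt]
    rfl
  have hs : ((x ^ (-(1 / 2) : ℝ) : ℝ) : ℂ) = (Real.sqrt x : ℂ)⁻¹ := by
    rw [Real.rpow_neg h.le, ← Real.sqrt_eq_rpow, Complex.ofReal_inv]
  have e1 : (x : ℂ) ^ crackDegree m 1 = (Real.sqrt x : ℂ)⁻¹ * (x : ℂ) ^ (Complex.I * m.eps) := by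
    rw [← hs, ← cpow_ofReal_add h, crackDegree]; congr 1; push_cast; ring
  have e2 : (x : ℂ) ^ crackDegree m (-1) =
      (Real.sqrt x : ℂ)⁻¹ * (x : ℂ) ^ (-Complex.I * m.eps) := by
    rw [← hs, ← cpow_ofReal_add h, crackDegree]; congr 1; push_cast; ring
  rw [jump_weightField m _ hx, jump_wave 1 h, jump_wave (-1) h, amplitude_one, amplitude_neg_one,
    e1, e2, Bimaterial.jumpMatrix, if_pos h, Real.sqrt_mul (by positivity) x, Complex.ofReal_mul]
  generalize (x : ℂ) ^ (Complex.I * m.eps) = u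
  generalize (x : ℂ) ^ (-Complex.I * m.eps) = v
  fin_cases i <;> fin_cases j
  all_goals
    simp [polarization, matB]
    ring_nf
    try simp only [Complex.I_sq]
    try ring

theorem lineTraction_weightField_single (j : Fin 2) {x : ℝ} (hx : x ≠ 0) (i : Fin 2) :
    lineTraction m (weightField m (Pi.single j 1) : Disp) x i = m.tractionMatrix x i j := by
  rcases hx.lt_or_gt.symm with h | h
  · rw [(weightField m _).2.lineTraction_eq_zero h, Bimaterial.tractionMatrix, if_neg h.not_gt]
    rfl
  have h' : 0 < -x := by linarith
  have e1 : ((-x : ℝ) : ℂ) ^ (crackDegree m 1 - 1) =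
      (((-x) ^ (-(3 / 2) : ℝ) : ℝ) : ℂ) * ((-x : ℝ) : ℂ) ^ (Complex.I * m.eps) := by
    rw [← cpow_ofReal_add h', crackDegree]; congr 1; push_cast; ring
  have e2 : ((-x : ℝ) : ℂ) ^ (crackDegree m (-1) - 1) =
      (((-x) ^ (-(3 / 2) : ℝ) : ℝ) : ℂ) * ((-x : ℝ) : ℂ) ^ (-Complex.I * m.eps) := by
    rw [← cpow_ofReal_add h', crackDegree]; congr 1; push_cast; ring
  have c1 : crackDegree m 1 = -(1 / 2 - Complex.I * m.eps) := by
    rw [crackDegree]; push_cast; ring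
  have c2 : crackDegree m (-1) = -(1 / 2 + Complex.I * m.eps) := by
    rw [crackDegree]; push_cast; ring
  rw [lineTraction_weightField m _ hx, lineTraction_wave 1 h (Or.inl rfl),
    lineTraction_wave (-1) h (Or.inr rfl), amplitude_one, amplitude_neg_one,
    e1, e2, c1, c2, Bimaterial.tractionMatrix, if_pos h]
  generalize ((-x : ℝ) : ℂ) ^ (Complex.I * m.eps) = u
  generalize ((-x : ℝ) : ℂ) ^ (-Complex.I * m.eps) = v
  generalize (((-x) ^ (-(3 / 2) : ℝ) : ℝ) : ℂ) = w
  generalize (1 / 2 - Complex.I * m.eps : ℂ) = p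
  generalize (1 / 2 + Complex.I * m.eps : ℂ) = q
  fin_cases i <;> fin_cases j
  all_goals
    simp [polarization, matB]
    ring_nf
    try simp only [Complex.I_sq]
    try ring

end Transforms

end InterfaceCrack

theorem mainTheorem2 (m : InterfaceCrack.Bimaterial) :
    -- the factorization of the matrix coefficient
    (((∀ i j, DifferentiableOn ℂ (fun β => m.XPlus β i j) InterfaceCrack.CPlus) ∧
        (∀ i j, ContinuousOn (fun β => m.XPlus β i j) InterfaceCrack.CPlusBar) ∧
        ∀ β ∈ InterfaceCrack.CPlusBar, IsUnit (m.XPlus β).det) ∧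
      ((∀ i j, DifferentiableOn ℂ (fun β => m.XMinus β i j) InterfaceCrack.CMinus) ∧
        (∀ i j, ContinuousOn (fun β => m.XMinus β i j) InterfaceCrack.CMinusBar) ∧
        ∀ β ∈ InterfaceCrack.CMinusBar, IsUnit (m.XMinus β).det) ∧
      ∀ β : ℝ, β ≠ 0 →
        (-((m.b : ℂ) / (|β| : ℝ))) • m.G β =
          (-((m.b : ℂ) / (InterfaceCrack.powPlus β (1 / 2) *
            InterfaceCrack.powMinus β (1 / 2)))) • (m.XPlus β * (m.XMinus β)⁻¹)) ∧
    -- the solutions of the Wiener-Hopf problem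
    (∀ Φp Φm : ℂ → Fin 2 → ℂ, m.IsWienerHopfSolution Φp Φm ↔
      ∃! e : Fin 2 → ℂ,
        (∀ β ∈ InterfaceCrack.CPlusBar, Φp β = m.whPlus e β) ∧
        ∀ β ∈ InterfaceCrack.CMinusBar, Φm β = m.whMinus e β) ∧
    -- singular solutions correspond to solutions of the Wiener-Hopf problem
    (∀ U ∈ InterfaceCrack.singularSolutions m, ∃ Φp Φm : ℂ → Fin 2 → ℂ,
      m.IsWienerHopfSolution Φp Φm ∧ InterfaceCrack.IsTransformPair m U Φp Φm) ∧
    (∀ Φp Φm : ℂ → Fin 2 → ℂ, m.IsWienerHopfSolution Φp Φm →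
      ∃! U : InterfaceCrack.Disp, U ∈ InterfaceCrack.singularSolutions m ∧
        InterfaceCrack.IsTransformPair m U Φp Φm) ∧
    -- the space of singular solutions and the weight functions
    Module.finrank ℂ (InterfaceCrack.singularSolutions m) = 2 ∧
    ∃ W : Module.Basis (Fin 2) ℂ (InterfaceCrack.singularSolutions m),
      (∀ e : Fin 2 → ℂ,
        InterfaceCrack.IsTransformPair m (∑ j, e j • (W j : InterfaceCrack.Disp))
          (m.whPlus e) (m.whMinus e)) ∧
      (∀ j : Fin 2,
        (∀ β ∈ InterfaceCrack.CPlusBar, ∀ i, m.whPlus (Pi.single j 1) β i = m.jumpHat β i j) ∧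
        (∀ β ∈ InterfaceCrack.CMinusBar, ∀ i,
          m.whMinus (Pi.single j 1) β i = m.tractionHat β i j) ∧
        ∀ x : ℝ, x ≠ 0 → ∀ i,
          InterfaceCrack.jump (W j : InterfaceCrack.Disp) x i = m.jumpMatrix x i j ∧
          InterfaceCrack.lineTraction m (W j : InterfaceCrack.Disp) x i =
            m.tractionMatrix x i j) := by
  refine ⟨⟨⟨fun i j β hβ => (m.differentiableAt_XPlus (InterfaceCrack.Bimaterial.CPlus_subset hβ)
        i j).differentiableWithinAt,
      fun i j β hβ => (m.differentiableAt_XPlus hβ i j).continuousAt.continuousWithinAt,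
      fun β _ => m.isUnit_det_XPlus β⟩,
    ⟨fun i j β hβ => (m.differentiableAt_XMinus (InterfaceCrack.Bimaterial.CMinus_subset hβ)
        i j).differentiableWithinAt,
      fun i j β hβ => (m.differentiableAt_XMinus hβ i j).continuousAt.continuousWithinAt,
      fun β _ => m.isUnit_det_XMinus β⟩,
    fun β hβ => m.factorization hβ⟩,
    m.isWienerHopfSolution_iff, fun U hU => ?_, fun Φp Φm h => ?_, ?_,
    InterfaceCrack.weightBasis m, fun e => ?_, fun j => ⟨fun β _ i => m.whPlus_single β i j,
      fun β _ i => m.whMinus_single β i j, fun x hx i => ?_⟩⟩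
  · obtain ⟨e, he⟩ := InterfaceCrack.surjective_weightField m ⟨U, hU⟩
    have hU' : (InterfaceCrack.weightField m e : InterfaceCrack.Disp) = U :=
      congrArg Subtype.val he
    exact ⟨_, _, m.isWienerHopfSolution_wh e,
      hU' ▸ InterfaceCrack.isTransformPair_weightField m e⟩
  · obtain ⟨e, hp, hm⟩ := h.exists_eq
    have ht := InterfaceCrack.isTransformPair_weightField m e
    refine ⟨InterfaceCrack.weightField m e, ⟨(InterfaceCrack.weightField m e).2,
      fun β hβ i => ?_, fun β hβ i => ?_⟩, fun U hU => ?_⟩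
    · rw [hp β (InterfaceCrack.Bimaterial.CPlus_subset hβ)]
      exact ht.1 β hβ i
    · rw [hm β (InterfaceCrack.Bimaterial.CMinus_subset hβ)]
      exact ht.2 β hβ i
    · obtain ⟨e', he'⟩ := InterfaceCrack.surjective_weightField m ⟨U, hU.1⟩
      have hU' : (InterfaceCrack.weightField m e' : InterfaceCrack.Disp) = U :=
        congrArg Subtype.val he'
      have hI : Complex.I ∈ InterfaceCrack.CPlusBar := ⟨by simp, Complex.I_ne_zero⟩
      have ht' : InterfaceCrack.IsTransformPair m (InterfaceCrack.weightField m e') Φp Φm :=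
        hU'.symm ▸ hU.2
      rw [← hU', InterfaceCrack.eq_of_isTransformPair_weightField ht' (hp _ hI).symm]
  · rw [← (InterfaceCrack.weightEquiv m).finrank_eq, Module.finrank_fin_fun]
  · rw [InterfaceCrack.sum_smul_weightBasis]
    exact InterfaceCrack.isTransformPair_weightField m e
  · rw [InterfaceCrack.weightBasis_apply]
    exact ⟨InterfaceCrack.jump_weightField_single m j hx i,
      InterfaceCrack.lineTraction_weightField_single m j hx i⟩
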